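/- Let $\Gamma\curvearrowright (X,\mu)$ and $\Lambda\curvearrowright (Y,\nu)$ be probability measure preserving actions (not necessarily free) of countable groups on standard probability spaces. Let $A=L^\infty(X)\subset M=L(\mathcal R_{\Gamma\curvearrowright X})$ and $B=L^\infty(Y)\subset N=L(\mathcal R_{\Lambda\curvearrowright Y})$ be the associated Cartan inclusions in the von Neumann algebras of the orbit equivalence relations, with their canonical traces $\tau$. For a free ultrafilter $\omega$ on $\mathbb N$ let $M^\omega$ be the tracial ultrapower, let $A^\omega\subset M^\omega$ be the subalgebra of classes of bounded sequences in $A$, and let $M(\omega)\subset M^\omega$ be the von Neumann subalgebra generated by $A^\omega$ and the normalizer $\mathcal N_M(A)=\{u\in\mathcal U(M): uAu^*=A\}$ (constant sequences); similarly $B^\omega\subset N(\omega)$. Isomorphisms between these algebras are trace preserving $*$-isomorphisms, and $\Gamma$, $\Lambda$ act on $A$, $B$. For trace preserving partial isomorphisms $\alpha:Ap\to Aq$, $\beta:Ap'\to Aq'$ ($p,q,p',q'$ projections of $A$) put $\|\alpha-\beta\|_2=(\tau(p)+\tau(p')-2\tau(r))^{1/2}$, where $r\le pp'$ is the largest projection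 such that $\alpha=\beta$ on $Ar$; similarly for $B$. If $\{q_\psi\}_{\psi\in\Lambda}\subset B$ are mutually orthogonal projections with $\{\psi(q_\psi)\}_\psi$ mutually orthogonal, $\oplus_\psi\psi|_{Bq_\psi}$ denotes the partial isomorphism with domain $B\sum_\psi q_\psi$ that equals $\psi$ on each $Bq_\psi$; similarly for $A$. The following are equivalent. (a) For some free ultrafilter $\omega$ on $\mathbb N$, there is an isomorphism $\theta:M(\omega)\simeq N(\omega)$ with $\theta(A^\omega)=B^\omega$ whose restriction to $A^\omega$ is of ultraproduct form: there are isomorphisms $\theta_n:A\simeq B$, $n\in\mathbb N$, with $\theta((a_n)_n)=(\theta_n(a_n))_n$ for all $(a_n)_n\in A^\omega$. (b) The property in (a) holds for every free ultrafilter $\omega$ on $\mathbb N$. (c) There are families $t^\phi=\{t^\phi_\psi\}_{\psi\in\Lambda}\subset[0,1]$ for $\phi\in\Gamma$ and $s^\psi=\{s^\psi_\phi\}_{\phi\in\Gamma}\subset[0,1]$ for $\psi\in\Lambda$, with $\sum_\psi t^\phi_\psi=1$ and $\sum_\phi s^\psi_\phi=1$ for all $\phi,\psi$, such that for all finite $E\subset\Gamma$,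 $F\subset\Lambda$ and every $\varepsilon>0$ there are an isomorphism $\theta':A\simeq B$ and, for every $\psi_0\in F$, mutually orthogonal projections $\{p^{\psi_0}_\phi\}_{\phi\in\Gamma}\subset A$ with $\{\phi(p^{\psi_0}_\phi)\}_\phi$ mutually orthogonal and, for every $\phi_0\in E$, mutually orthogonal projections $\{q^{\phi_0}_\psi\}_{\psi\in\Lambda}\subset B$ with $\{\psi(q^{\phi_0}_\psi)\}_\psi$ mutually orthogonal, such that for all $\phi_0\in E$, $\psi_0\in F$, $\phi\in\Gamma$, $\psi\in\Lambda$: $\tau(p^{\psi_0}_\phi)\le s^{\psi_0}_\phi$, $\tau(q^{\phi_0}_\psi)\le t^{\phi_0}_\psi$, $\|\theta'\phi_0\theta'^{-1}-\oplus_\psi\psi|_{Bq^{\phi_0}_\psi}\|_2\le\varepsilon$ and $\|\theta'^{-1}\psi_0\theta'-\oplus_\phi\phi|_{Ap^{\psi_0}_\phi}\|_2\le\varepsilon$. (d) There are isomorphisms $\theta_n:A\simeq B$, $n\in\mathbb N$, and, for every $n$, mutually orthogonal projections $\{p^\psi_{\phi,n}\}_{\phi\in\Gamma}\subset A$ with $\{\phi(p^\psi_{\phi,n})\}_\phi$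 mutually orthogonal, for each $\psi\in\Lambda$, and mutually orthogonal projections $\{q^\phi_{\psi,n}\}_{\psi\in\Lambda}\subset B$ with $\{\psi(q^\phi_{\psi,n})\}_\psi$ mutually orthogonal, for each $\phi\in\Gamma$, such that for all $\phi\in\Gamma$ and $\psi\in\Lambda$: $$\lim_n\|\theta_n\phi\theta_n^{-1}-\oplus_\psi\psi|_{Bq^\phi_{\psi,n}}\|_2=0,\qquad \lim_n\|\theta_n^{-1}\psi\theta_n-\oplus_\phi\phi|_{Ap^\psi_{\phi,n}}\|_2=0,$$ $$\sum_\phi\liminf_n\tau(p^\psi_{\phi,n})=1,\qquad \sum_\psi\liminf_n\tau(q^\phi_{\psi,n})=1.$$ -/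

import Mathlib

open MeasureTheory Filter Topology
open scoped BoundedContinuousFunction InnerProductSpace

namespace AppOE

/-! ### Tracial von Neumann algebras, Cartan data and ultrapowers -/

section Tracial

variable {H : Type*} [NormedAddCommGroup H] [InnerProductSpace ℂ H] [CompleteSpace H]

/-- The von Neumann algebra generated by a set of bounded operators: its double commutant
(the commutants being those of the set together with its adjoints). -/
noncomputable def vonNeumannGenerated (S : Set (H →L[ℂ] H)) : VonNeumannAlgebra H where
  toStarSubalgebra :=
    StarSubalgebra.centralizer ℂ (StarSubalgebra.centralizer ℂ S : Set (H →L[ℂ] H))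
  centralizer_centralizer' := by
    have h : ((StarSubalgebra.centralizer ℂ
        (StarSubalgebra.centralizer ℂ S : Set (H →L[ℂ] H)) : StarSubalgebra ℂ (H →L[ℂ] H)) :
          Set (H →L[ℂ] H)) =
        (StarSubalgebra.centralizer ℂ S : Set (H →L[ℂ] H)).centralizer := by
      rw [StarSubalgebra.coe_centralizer, Set.union_eq_left.2]
      intro x hx
      have := star_mem (Set.mem_star.1 hx)
      rwa [star_star] at this
    change Set.centralizer (Set.centralizer ((StarSubalgebra.centralizer ℂ
        (StarSubalgebra.centralizer ℂ S : Set (H →L[ℂ] H)) : StarSubalgebra ℂ (H →L[ℂ] H)) :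
          Set (H →L[ℂ] H))) = _
    rw [h]
    exact (Set.centralizer_centralizer_centralizer _).trans h.symm

/-- A von Neumann algebra on `H` together with a unit vector whose vector state
`x ↦ ⟪ξ, x ξ⟫` is a trace on it. -/
structure TracialVNA (H : Type*) [NormedAddCommGroup H] [InnerProductSpace ℂ H]
    [CompleteSpace H] where
  /-- the von Neumann algebra -/
  alg : VonNeumannAlgebra H
  /-- the vector implementing the trace -/
  vec : H
  norm_vec : ‖vec‖ = 1
  tracial : ∀ x ∈ alg, ∀ y ∈ alg, ⟪vec, x (y vec)⟫_ℂ = ⟪vec, y (x vec)⟫_ℂ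

namespace TracialVNA

variable (M : TracialVNA H)

/-- The underlying `*`-algebra. -/
abbrev Carrier : Type _ := M.alg.toStarSubalgebra

/-- The trace `τ(x) = ⟪ξ, x ξ⟫`. -/
noncomputable def tr (x : M.Carrier) : ℂ := ⟪M.vec, (x : H →L[ℂ] H) M.vec⟫_ℂ

/-- The Hilbert norm `‖x‖₂ = τ(x* x)^{1/2} = ‖x ξ‖`. -/
def norm2 (x : M.Carrier) : ℝ := ‖(x : H →L[ℂ] H) M.vec‖

theorem tr_mul_comm (x y : M.Carrier) : M.tr (x * y) = M.tr (y * x) :=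
  M.tracial x x.2 y y.2

theorem tr_star_mul_self (x : M.Carrier) : M.tr (star x * x) = ((M.norm2 x ^ 2 : ℝ) : ℂ) := by
  change ⟪M.vec, (star (x : H →L[ℂ] H)) ((x : H →L[ℂ] H) M.vec)⟫_ℂ = _
  rw [ContinuousLinearMap.star_eq_adjoint, ContinuousLinearMap.adjoint_inner_right,
    inner_self_eq_norm_sq_to_K]
  simp [norm2]

theorem norm2_nonneg (x : M.Carrier) : 0 ≤ M.norm2 x := norm_nonneg _

theorem norm2_star (x : M.Carrier) : M.norm2 (star x) = M.norm2 x := by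
  have h := M.tr_star_mul_self (star x)
  rw [star_star, M.tr_mul_comm, M.tr_star_mul_self] at h
  have h' : M.norm2 x ^ 2 = M.norm2 (star x) ^ 2 := by exact_mod_cast h
  exact ((sq_eq_sq₀ (M.norm2_nonneg _) (M.norm2_nonneg _)).1 h').symm

theorem norm2_add_le (x y : M.Carrier) : M.norm2 (x + y) ≤ M.norm2 x + M.norm2 y :=
  norm_add_le ((x : H →L[ℂ] H) M.vec) ((y : H →L[ℂ] H) M.vec)

theorem norm2_mul_le (x y : M.Carrier) : M.norm2 (x * y) ≤ ‖x‖ * M.norm2 y :=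
  (x : H →L[ℂ] H).le_opNorm _

theorem norm2_mul_le' (x y : M.Carrier) : M.norm2 (x * y) ≤ ‖y‖ * M.norm2 x := by
  rw [← M.norm2_star, star_mul, ← M.norm2_star x]
  refine (M.norm2_mul_le _ _).trans_eq ?_
  rw [norm_star]

theorem norm_tr_le (x : M.Carrier) : ‖M.tr x‖ ≤ M.norm2 x := by
  refine (norm_inner_le_norm _ _).trans_eq ?_
  rw [M.norm_vec, one_mul]; rfl

theorem norm2_le_norm (x : M.Carrier) : M.norm2 x ≤ ‖x‖ := by
  refine ((x : H →L[ℂ] H).le_opNorm _).trans_eq ?_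
  rw [M.norm_vec, mul_one]; rfl

/-- The ideal of bounded sequences `(x n)` in `M` with `‖x n‖₂ → 0` along `ω`. -/
noncomputable def ultraIdeal (ω : Ultrafilter ℕ) : Ideal (ℕ →ᵇ M.Carrier) where
  carrier := {x | Tendsto (fun n => M.norm2 (x n)) ω (𝓝 0)}
  zero_mem' := by simp [norm2]
  add_mem' := by
    intro x y hx hy
    refine squeeze_zero (fun n => M.norm2_nonneg _) (fun n => M.norm2_add_le (x n) (y n)) ?_
    simpa using Tendsto.add hx hy
  smul_mem' := by
    intro c x hx
    refine squeeze_zero (fun n => M.norm2_nonneg _) (g := fun n => ‖c‖ * M.norm2 (x n))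
      (fun n => ?_) ?_
    · exact (M.norm2_mul_le (c n) (x n)).trans
        (mul_le_mul_of_nonneg_right (c.norm_coe_le_norm n) (M.norm2_nonneg _))
    · simpa using Tendsto.const_mul ‖c‖ hx

theorem mem_ultraIdeal {ω : Ultrafilter ℕ} {x : ℕ →ᵇ M.Carrier} :
    x ∈ M.ultraIdeal ω ↔ Tendsto (fun n => M.norm2 (x n)) ω (𝓝 0) := Iff.rfl

instance (ω : Ultrafilter ℕ) : (M.ultraIdeal ω).IsTwoSided where
  mul_mem_of_left := by
    intro x c hx
    refine squeeze_zero (fun n => M.norm2_nonneg _) (g := fun n => ‖c‖ * M.norm2 (x n))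
      (fun n => ?_) ?_
    · exact (M.norm2_mul_le' (x n) (c n)).trans
        (mul_le_mul_of_nonneg_right (c.norm_coe_le_norm n) (M.norm2_nonneg _))
    · simpa using Tendsto.const_mul ‖c‖ hx

/-- The tracial ultrapower `M^ω`: bounded sequences modulo those tending to `0` in `‖·‖₂`
along `ω`. -/
def Ultra (ω : Ultrafilter ℕ) : Type _ := (ℕ →ᵇ M.Carrier) ⧸ M.ultraIdeal ω

noncomputable instance (ω : Ultrafilter ℕ) : Ring (M.Ultra ω) :=
  inferInstanceAs (Ring ((ℕ →ᵇ M.Carrier) ⧸ M.ultraIdeal ω))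

noncomputable instance (ω : Ultrafilter ℕ) : Algebra ℂ (M.Ultra ω) :=
  inferInstanceAs (Algebra ℂ ((ℕ →ᵇ M.Carrier) ⧸ M.ultraIdeal ω))

/-- The class in `M^ω` of a bounded sequence. -/
noncomputable def ultraMk (ω : Ultrafilter ℕ) (x : ℕ →ᵇ M.Carrier) : M.Ultra ω :=
  Ideal.Quotient.mk (M.ultraIdeal ω) x

/-- The involution of `M^ω`, `(x n)* = (x n *)`. -/
noncomputable instance (ω : Ultrafilter ℕ) : StarRing (M.Ultra ω) where
  star := Quotient.map' star (by
    intro x y h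
    rw [Submodule.quotientRel_def, mem_ultraIdeal] at h ⊢
    refine h.congr fun n => ?_
    rw [← M.norm2_star]; simp)
  star_involutive := by
    intro x; induction x using Quotient.inductionOn' with
    | h x => exact congrArg (Ideal.Quotient.mk (M.ultraIdeal ω)) (star_star x)
  star_mul := by
    intro x y; induction x using Quotient.inductionOn' with
    | h x => induction y using Quotient.inductionOn' with
      | h y => exact congrArg (Ideal.Quotient.mk (M.ultraIdeal ω)) (star_mul x y)
  star_add := by
    intro x y; induction x using Quotient.inductionOn' with
    | h x => induction y using Quotient.inductionOn' with
      | h y => exact congrArg (Ideal.Quotient.mk (M.ultraIdeal ω)) (star_add x y)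

theorem ultraMk_add (ω : Ultrafilter ℕ) (x y : ℕ →ᵇ M.Carrier) :
    M.ultraMk ω (x + y) = M.ultraMk ω x + M.ultraMk ω y := rfl

theorem ultraMk_mul (ω : Ultrafilter ℕ) (x y : ℕ →ᵇ M.Carrier) :
    M.ultraMk ω (x * y) = M.ultraMk ω x * M.ultraMk ω y := rfl

theorem ultraMk_algebraMap (ω : Ultrafilter ℕ) (c : ℂ) :
    M.ultraMk ω (algebraMap ℂ _ c) = algebraMap ℂ _ c := rfl

theorem star_ultraMk (ω : Ultrafilter ℕ) (x : ℕ →ᵇ M.Carrier) :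
    star (M.ultraMk ω x) = M.ultraMk ω (star x) := rfl

instance (ω : Ultrafilter ℕ) : StarModule ℂ (M.Ultra ω) where
  star_smul := by
    intro c x; induction x using Quotient.inductionOn' with
    | h x => exact congrArg (Ideal.Quotient.mk (M.ultraIdeal ω)) (star_smul c x)

/-- The trace of `M^ω`, `τ((x n)) = lim_{n → ω} τ(x n)`. -/
noncomputable def ultraTr (ω : Ultrafilter ℕ) (x : M.Ultra ω) : ℂ :=
  Quotient.liftOn' x (fun x => limUnder (ω : Filter ℕ) fun n => M.tr (x n)) (by
    intro x y h
    rw [Submodule.quotientRel_def, mem_ultraIdeal] at h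
    have hd : Tendsto (fun n => M.tr (x n) - M.tr (y n)) ω (𝓝 0) := by
      refine squeeze_zero_norm (fun n => ?_) h
      have : M.tr (x n) - M.tr (y n) = M.tr ((x - y) n) := by simp [tr]
      rw [this]; exact M.norm_tr_le _
    have hb : ∃ z, Tendsto (fun n => M.tr (y n)) ω (𝓝 z) := by
      obtain ⟨z, -, hz⟩ := (isCompact_closedBall (0 : ℂ) ‖y‖).ultrafilter_le_nhds
        (ω.map fun n => M.tr (y n)) (by
          refine le_principal_iff.2 (Filter.mem_map.2 (Filter.univ_mem' fun n => ?_))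
          exact mem_closedBall_zero_iff.2
            (((M.norm_tr_le _).trans (M.norm2_le_norm _)).trans (y.norm_coe_le_norm n)))
      exact ⟨z, hz⟩
    obtain ⟨z, hz⟩ := hb
    have hx : Tendsto (fun n => M.tr (x n)) ω (𝓝 z) := by simpa using hd.add hz
    change limUnder _ _ = limUnder _ _
    rw [hx.limUnder_eq, hz.limUnder_eq])

/-- The Hilbert norm `‖x‖₂ = τ(x* x)^{1/2}` of `M^ω`. -/
noncomputable def ultraNorm2 (ω : Ultrafilter ℕ) (x : M.Ultra ω) : ℝ :=
  Real.sqrt (M.ultraTr ω (star x * x)).re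

/-- The von Neumann subalgebra of `M^ω` generated by a set: the smallest unital `*`-subalgebra
containing it and closed in `‖·‖₂`. (A unital `*`-subalgebra of a von Neumann algebra with a
faithful normal trace is weakly closed if and only if it is `‖·‖₂`-closed.) -/
noncomputable def ultraGenerated (ω : Ultrafilter ℕ) (S : Set (M.Ultra ω)) :
    StarSubalgebra ℂ (M.Ultra ω) :=
  sInf {N | S ⊆ N ∧ ∀ x, (∀ ε > 0, ∃ y ∈ N, M.ultraNorm2 ω (x - y) < ε) → x ∈ N}

variable (A : StarSubalgebra ℂ M.Carrier)

/-- The normalizer `𝒩_M(A)`: the unitaries `u` of `M` with `u A u* = A`. -/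
def normalizer : Set M.Carrier :=
  {u | u ∈ unitary M.Carrier ∧ (fun a => u * a * star u) '' (A : Set M.Carrier) = A}

/-- The subalgebra `A^ω` of `M^ω`. -/
def ultraSub (ω : Ultrafilter ℕ) : StarSubalgebra ℂ (M.Ultra ω) where
  carrier := {x | ∃ a : ℕ →ᵇ M.Carrier, (∀ n, a n ∈ A) ∧ M.ultraMk ω a = x}
  mul_mem' := by
    rintro _ _ ⟨a, ha, rfl⟩ ⟨b, hb, rfl⟩
    exact ⟨a * b, fun n => mul_mem (ha n) (hb n), M.ultraMk_mul ω a b⟩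
  add_mem' := by
    rintro _ _ ⟨a, ha, rfl⟩ ⟨b, hb, rfl⟩
    exact ⟨a + b, fun n => add_mem (ha n) (hb n), M.ultraMk_add ω a b⟩
  algebraMap_mem' := fun c => ⟨algebraMap ℂ _ c, fun n => A.algebraMap_mem c,
    M.ultraMk_algebraMap ω c⟩
  star_mem' := by
    rintro _ ⟨a, ha, rfl⟩
    exact ⟨star a, fun n => star_mem (ha n), (M.star_ultraMk ω a).symm⟩

/-- `M(ω) = A^ω ∨ 𝒩_M(A)`, the von Neumann subalgebra of `M^ω` generated by `A^ω` and the
constant sequences with value in the normalizer of `A` in `M`. -/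
noncomputable def ultraCartan (ω : Ultrafilter ℕ) : StarSubalgebra ℂ (M.Ultra ω) :=
  M.ultraGenerated ω ((M.ultraSub A ω : Set (M.Ultra ω)) ∪
    (fun u => M.ultraMk ω (BoundedContinuousFunction.const ℕ u)) '' M.normalizer A)

/-- The trace of `M`, restricted to `A`. -/
noncomputable def trOn (a : A) : ℂ := M.tr a

end TracialVNA

end Tracial

/-! ### A criterion for a vector state to be a trace -/

section Trace

variable {H : Type*} [NormedAddCommGroup H] [InnerProductSpace ℂ H] [CompleteSpace H]

theorem subset_vonNeumannGenerated (S : Set (H →L[ℂ] H)) :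
    S ⊆ (vonNeumannGenerated S : Set (H →L[ℂ] H)) := by
  intro s hs
  change s ∈ StarSubalgebra.centralizer ℂ (StarSubalgebra.centralizer ℂ S : Set (H →L[ℂ] H))
  rw [StarSubalgebra.mem_centralizer_iff]
  intro g hg
  refine ⟨(((StarSubalgebra.mem_centralizer_iff ℂ).1 hg s hs).1).symm, ?_⟩
  exact (((StarSubalgebra.mem_centralizer_iff ℂ).1 (star_mem hg) s hs).1).symm

theorem vonNeumannGenerated_commute {S : Set (H →L[ℂ] H)} (hS : ∀ s ∈ S, star s ∈ S)
    {x r : H →L[ℂ] H} (hx : x ∈ vonNeumannGenerated S) (hr : r ∈ S.centralizer) (v : H) :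
    x (r v) = r (x v) := by
  have hr' : r ∈ StarSubalgebra.centralizer ℂ S := by
    rw [StarSubalgebra.mem_centralizer_iff]
    exact fun s hs => ⟨hr s hs, hr _ (hS s hs)⟩
  have h := ((StarSubalgebra.mem_centralizer_iff ℂ).1 hx r hr').1
  exact (congrArg (fun T : H →L[ℂ] H => T v) h).symm

theorem centralizer_star {S : Set (H →L[ℂ] H)} (hS : ∀ s ∈ S, star s ∈ S)
    {r : H →L[ℂ] H} (hr : r ∈ S.centralizer) : star r ∈ S.centralizer := by
  intro s hs
  have h := congrArg star (hr (star s) (hS s hs))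
  simpa using h.symm

/-- The elements of the generated von Neumann algebra acting on `ξ` as right operators do. -/
def rightImplemented (S : Set (H →L[ℂ] H)) (ξ : H) : Set (H →L[ℂ] H) :=
  {y | y ∈ vonNeumannGenerated S ∧ ∃ r ∈ S.centralizer, y ξ = r ξ ∧ star y ξ = star r ξ}

theorem tracial_of_right {S : Set (H →L[ℂ] H)} (hS : ∀ s ∈ S, star s ∈ S) (ξ : H)
    (hr : ∀ s ∈ S, ∃ r ∈ S.centralizer, s ξ = r ξ ∧ star s ξ = star r ξ)
    {x y : H →L[ℂ] H} (hx : x ∈ vonNeumannGenerated S) (hy : y ∈ vonNeumannGenerated S) :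
    ⟪ξ, x (y ξ)⟫_ℂ = ⟪ξ, y (x ξ)⟫_ℂ := by
  set V := vonNeumannGenerated S
  -- traciality when one of the elements has a right version
  have step : ∀ x ∈ V, ∀ y ∈ rightImplemented S ξ, ⟪ξ, x (y ξ)⟫_ℂ = ⟪ξ, y (x ξ)⟫_ℂ := by
    rintro x hx y ⟨hy, r, hr, h1, h2⟩
    rw [h1, vonNeumannGenerated_commute hS hx hr]
    have e1 : ⟪ξ, r (x ξ)⟫_ℂ = ⟪star r ξ, x ξ⟫_ℂ := by
      rw [ContinuousLinearMap.star_eq_adjoint, ContinuousLinearMap.adjoint_inner_left]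
    rw [e1, ← h2, ContinuousLinearMap.star_eq_adjoint, ContinuousLinearMap.adjoint_inner_left]
  -- the span of `N ξ`
  let N : Submodule ℂ (H →L[ℂ] H) :=
    { carrier := rightImplemented S ξ
      zero_mem' := ⟨zero_mem V, 0, by intro s _; simp, by simp, by simp⟩
      add_mem' := by
        rintro a b ⟨ha, r, hr, h1, h2⟩ ⟨hb, t, ht, h3, h4⟩
        refine ⟨add_mem ha hb, r + t, ?_, ?_, ?_⟩
        · intro s hs
          rw [mul_add, add_mul, hr s hs, ht s hs]
        · simp [h1, h3]
        · simp [h2, h4]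
      smul_mem' := by
        rintro c a ⟨ha, r, hr, h1, h2⟩
        refine ⟨V.toStarSubalgebra.smul_mem ha c, c • r, ?_, ?_, ?_⟩
        · intro s hs
          rw [mul_smul_comm, smul_mul_assoc, hr s hs]
        · simp [h1]
        · simp [h2] }
  have hmul : ∀ s ∈ S, ∀ a ∈ N, s * a ∈ N := by
    rintro s hs a ⟨ha, r, hr', h1, h2⟩
    have hsV : s ∈ V := subset_vonNeumannGenerated S hs
    obtain ⟨t, ht, h3, h4⟩ := hr s hs
    refine ⟨mul_mem hsV ha, r * t, ?_, ?_, ?_⟩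
    · intro s hs
      rw [← mul_assoc, hr' s hs, mul_assoc, ht s hs, mul_assoc]
    · change s (a ξ) = r (t ξ)
      rw [h1, vonNeumannGenerated_commute hS hsV hr', h3]
    · rw [star_mul, star_mul]
      change star a (star s ξ) = star t (star r ξ)
      rw [h4, vonNeumannGenerated_commute hS (star_mem ha) (centralizer_star hS ht), h2]
  have hstar : ∀ a ∈ N, star a ∈ N := by
    rintro a ⟨ha, r, hr', h1, h2⟩
    exact ⟨star_mem ha, star r, centralizer_star hS hr', h2, by simpa using h1⟩
  have hone : (1 : H →L[ℂ] H) ∈ N := ⟨one_mem V, 1, by intro s _; simp, rfl, rfl⟩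
  let K : Submodule ℂ H := (N.map (ContinuousLinearMap.apply ℂ H ξ).toLinearMap).topologicalClosure
  have hKcl : IsClosed (K : Set H) := Submodule.isClosed_topologicalClosure _
  have : CompleteSpace K := hKcl.completeSpace_coe
  have hKS : ∀ s ∈ S, ∀ v ∈ K, s v ∈ K := by
    intro s hs v hv
    refine map_mem_closure s.continuous hv ?_
    rintro _ ⟨a, ha, rfl⟩
    exact ⟨s * a, hmul s hs a ha, rfl⟩
  have hξK : ξ ∈ K := subset_closure ⟨1, hone, rfl⟩
  have hP : K.starProjection ∈ S.centralizer := by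
    intro s hs
    ext1 v
    change s (K.starProjection v) = K.starProjection (s v)
    have hdec : s v = s (K.starProjection v) + s (v - K.starProjection v) := by
      rw [← map_add, add_sub_cancel]
    have h1 : K.starProjection (s (K.starProjection v)) = s (K.starProjection v) :=
      Submodule.starProjection_eq_self_iff.2 (hKS s hs _ (Submodule.starProjection_apply_mem K v))
    have h2 : K.starProjection (s (v - K.starProjection v)) = 0 := by
      rw [Submodule.starProjection_apply_eq_zero_iff]
      intro w hw
      rw [← ContinuousLinearMap.adjoint_inner_left, ← ContinuousLinearMap.star_eq_adjoint]
      exact Submodule.sub_starProjection_mem_orthogonal (K := K) v _ (hKS _ (hS s hs) w hw)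
    rw [hdec, map_add, h1, h2, add_zero]
  have hVK : ∀ x ∈ V, x ξ ∈ K := by
    intro x hx
    have h := vonNeumannGenerated_commute hS hx hP ξ
    rw [Submodule.starProjection_eq_self_iff.2 hξK] at h
    rw [h]
    exact Submodule.starProjection_apply_mem K _
  -- approximation of `x` by elements with a right version
  have hnorm : ∀ a ∈ N, ‖star a ξ‖ = ‖a ξ‖ := by
    intro a ha
    have h := step (star a) (star_mem ha.1) a ha
    have e1 : ⟪ξ, star a (a ξ)⟫_ℂ = ⟪a ξ, a ξ⟫_ℂ := by
      rw [ContinuousLinearMap.star_eq_adjoint, ContinuousLinearMap.adjoint_inner_right]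
    have e2 : ⟪ξ, a (star a ξ)⟫_ℂ = ⟪star a ξ, star a ξ⟫_ℂ := by
      rw [ContinuousLinearMap.star_eq_adjoint, ContinuousLinearMap.adjoint_inner_left]
    rw [e1, e2, inner_self_eq_norm_sq_to_K, inner_self_eq_norm_sq_to_K] at h
    have h' : ‖a ξ‖ ^ 2 = ‖star a ξ‖ ^ 2 := by exact_mod_cast h
    exact ((sq_eq_sq₀ (norm_nonneg _) (norm_nonneg _)).1 h').symm
  obtain ⟨w, hw, hwx⟩ := mem_closure_iff_seq_limit.1 (hVK x hx)
  choose a ha haw using hw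
  replace haw : ∀ n, a n ξ = w n := haw
  have hax : Tendsto (fun n => a n ξ) atTop (𝓝 (x ξ)) := by simpa only [haw] using hwx
  have hstarC : CauchySeq fun n => star (a n) ξ := by
    have hc := hax.cauchySeq
    rw [Metric.cauchySeq_iff'] at hc ⊢
    intro ε hε
    obtain ⟨n, hn⟩ := hc ε hε
    refine ⟨n, fun k hk => ?_⟩
    have h := hn k hk
    rw [dist_eq_norm] at h ⊢
    have e := hnorm (a k - a n) (sub_mem (ha k) (ha n))
    simp only [star_sub, sub_apply] at e
    rwa [e]
  obtain ⟨ζ, hζ⟩ := cauchySeq_tendsto_of_complete hstarC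
  -- `⟪ζ, b ξ⟫ = ⟪x* ξ, b ξ⟫` for `b ∈ N`
  have hweak : ∀ z ∈ V, ⟪ζ, z ξ⟫_ℂ = ⟪ξ, z (x ξ)⟫_ℂ := by
    intro z hz
    refine tendsto_nhds_unique (hζ.inner tendsto_const_nhds)
      (Tendsto.congr (fun n => ?_)
        (tendsto_const_nhds.inner ((z.continuous.tendsto _).comp hax)))
    change ⟪ξ, z (a n ξ)⟫_ℂ = _
    rw [step z hz _ (ha n), ContinuousLinearMap.star_eq_adjoint,
      ContinuousLinearMap.adjoint_inner_left]
  have hN : ∀ b ∈ N, ⟪ζ, b ξ⟫_ℂ = ⟪star x ξ, b ξ⟫_ℂ := by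
    intro b hb
    rw [hweak b hb.1, ← step x hx b hb, ContinuousLinearMap.star_eq_adjoint,
      ContinuousLinearMap.adjoint_inner_left]
  have hK : ∀ v ∈ K, ⟪ζ, v⟫_ℂ = ⟪star x ξ, v⟫_ℂ := by
    intro v hv
    refine closure_minimal ?_ (isClosed_eq (by fun_prop) (by fun_prop)) hv
    rintro _ ⟨b, hb, rfl⟩
    exact hN b hb
  have hfin := hK _ (hVK y hy)
  rw [hweak y hy, ContinuousLinearMap.star_eq_adjoint,
    ContinuousLinearMap.adjoint_inner_left] at hfin
  exact hfin.symm

end Trace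

/-! ### The von Neumann algebra of the orbit equivalence relation -/

section Orbit

variable (Γ : Type*) [Group Γ] {X : Type*} [MeasurableSpace X] [MulAction Γ X]

/-- The canonical measure of the orbit equivalence relation, as a measure on `X × X`: the
supremum of the images of `μ` on the graphs of the group elements. As these images agree on
intersections of graphs, it is the unique measure `m` carried by `{(x, g x)}` such that
`m {(x, g x) | x ∈ X₀} = μ X₀` for all measurable `X₀` and all `g`. -/
noncomputable def orbitMeasure (μ : Measure X) : Measure (X × X) :=
  ⨆ g : Γ, μ.map fun x => (x, g • x)

variable (μ : Measure X)

theorem orbitMeasure_le_map {T : X × X → X × X} (hT : Measurable T)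
    (h : ∀ g : Γ, ∃ k : Γ, (μ.map fun x => (x, g • x)) = (μ.map fun x => (x, k • x)).map T) :
    orbitMeasure Γ μ ≤ (orbitMeasure Γ μ).map T := by
  refine iSup_le fun g => ?_
  obtain ⟨k, hk⟩ := h g
  rw [hk]
  exact Measure.map_mono (le_iSup (fun g : Γ => μ.map fun x => (x, g • x)) k) hT

variable [MeasurableConstSMul Γ X]

theorem measurable_graph (g : Γ) : Measurable fun x : X => (x, g • x) :=
  measurable_id.prodMk (measurable_const_smul g)

theorem measurable_smul_fst (g : Γ) : Measurable fun z : X × X => (g • z.1, z.2) :=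
  (measurable_fst.const_smul g).prodMk measurable_snd

theorem measurable_smul_snd (g : Γ) : Measurable fun z : X × X => (z.1, g • z.2) :=
  measurable_fst.prodMk (measurable_snd.const_smul g)

theorem measurePreserving_smul_snd (g : Γ) :
    MeasurePreserving (fun z : X × X => (z.1, g • z.2)) (orbitMeasure Γ μ)
      (orbitMeasure Γ μ) := by
  have key : ∀ g : Γ, orbitMeasure Γ μ ≤
      (orbitMeasure Γ μ).map fun z : X × X => (z.1, g • z.2) := by
    intro g
    refine orbitMeasure_le_map Γ μ (measurable_smul_snd Γ g) fun h => ⟨g⁻¹ * h, ?_⟩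
    rw [Measure.map_map (measurable_smul_snd Γ g) (measurable_graph Γ _)]
    congr 1
    funext x
    simp [mul_smul]
  refine ⟨measurable_smul_snd Γ g, le_antisymm ?_ (key g)⟩
  refine (Measure.map_mono (key g⁻¹) (measurable_smul_snd Γ g)).trans_eq ?_
  rw [Measure.map_map (measurable_smul_snd Γ g) (measurable_smul_snd Γ g⁻¹)]
  have : ((fun z : X × X => (z.1, g • z.2)) ∘ fun z : X × X => (z.1, g⁻¹ • z.2)) = id := by
    funext z; simp
  rw [this, Measure.map_id]

/-- The diagonal of `X × X` has measure `1`. -/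
theorem orbitMeasure_diagonal [MeasurableEq X] [IsProbabilityMeasure μ] :
    orbitMeasure Γ μ (Set.diagonal X) = 1 := by
  have hD : MeasurableSet (Set.diagonal X) := measurableSet_diagonal
  have hd : Measurable fun x : X => (x, x) := measurable_id.prodMk measurable_id
  apply le_antisymm
  · have hle : orbitMeasure Γ μ ≤ (μ.map fun x => (x, x)) +
        (orbitMeasure Γ μ).restrict (Set.diagonal X)ᶜ := by
      refine iSup_le fun g => ?_
      rw [← Measure.restrict_add_restrict_compl (μ := μ.map fun x => (x, g • x)) hD]
      refine add_le_add ?_ (Measure.restrict_mono le_rfl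
        (le_iSup (fun g : Γ => μ.map fun x => (x, g • x)) g))
      refine Measure.le_iff.2 fun C hC => ?_
      rw [Measure.restrict_apply hC, Measure.map_apply (measurable_graph Γ g) (hC.inter hD),
        Measure.map_apply hd hC]
      refine measure_mono ?_
      rintro x ⟨hx, hx'⟩
      have hx'' : x = g • x := hx'
      change (x, x) ∈ C
      have hx : (x, g • x) ∈ C := hx
      rwa [← hx''] at hx
    refine (hle _).trans_eq ?_
    rw [Measure.add_apply, Measure.map_apply hd hD, Measure.restrict_apply hD]
    simp [Set.diagonal]
  · refine le_trans ?_ (le_iSup (fun g : Γ => μ.map fun x => (x, g • x)) 1 _)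
    rw [Measure.map_apply (measurable_graph Γ 1) hD]
    simp [Set.diagonal]

variable [SMulInvariantMeasure Γ X μ]

theorem measurePreserving_smul_fst (g : Γ) :
    MeasurePreserving (fun z : X × X => (g • z.1, z.2)) (orbitMeasure Γ μ)
      (orbitMeasure Γ μ) := by
  have key : ∀ g : Γ, orbitMeasure Γ μ ≤
      (orbitMeasure Γ μ).map fun z : X × X => (g • z.1, z.2) := by
    intro g
    refine orbitMeasure_le_map Γ μ (measurable_smul_fst Γ g) fun h => ⟨h * g, ?_⟩
    rw [Measure.map_map (measurable_smul_fst Γ g) (measurable_graph Γ _)]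
    conv_lhs => rw [← (measurePreserving_smul g μ).map_eq]
    rw [Measure.map_map (measurable_graph Γ _) (measurable_const_smul g)]
    congr 1
    funext x
    simp [mul_smul]
  refine ⟨measurable_smul_fst Γ g, le_antisymm ?_ (key g)⟩
  refine (Measure.map_mono (key g⁻¹) (measurable_smul_fst Γ g)).trans_eq ?_
  rw [Measure.map_map (measurable_smul_fst Γ g) (measurable_smul_fst Γ g⁻¹)]
  have : ((fun z : X × X => (g • z.1, z.2)) ∘ fun z : X × X => (g⁻¹ • z.1, z.2)) = id := by
    funext z; simp
  rw [this, Measure.map_id]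

/-- The Hilbert space `L²(ℛ, m)`. -/
abbrev OrbitL2 : Type _ := Lp ℂ 2 (orbitMeasure Γ μ)

/-- The operator `(u_g ξ)(x, y) = ξ(g⁻¹ x, y)` on `L²(ℛ, m)`. -/
noncomputable def leftShift (g : Γ) : OrbitL2 Γ μ →L[ℂ] OrbitL2 Γ μ :=
  (Lp.compMeasurePreservingₗᵢ ℂ (fun z : X × X => (g⁻¹ • z.1, z.2))
    (measurePreserving_smul_fst Γ μ g⁻¹)).toContinuousLinearMap

/-- The operator `(v_g ξ)(x, y) = ξ(x, g⁻¹ y)` on `L²(ℛ, m)`. -/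
noncomputable def rightShift (g : Γ) : OrbitL2 Γ μ →L[ℂ] OrbitL2 Γ μ :=
  (Lp.compMeasurePreservingₗᵢ ℂ (fun z : X × X => (z.1, g⁻¹ • z.2))
    (measurePreserving_smul_snd Γ μ g⁻¹)).toContinuousLinearMap

theorem leftShift_coe (g : Γ) (ξ : OrbitL2 Γ μ) :
    leftShift Γ μ g ξ =ᵐ[orbitMeasure Γ μ] fun z => ξ (g⁻¹ • z.1, z.2) :=
  Lp.coeFn_compMeasurePreserving ξ (measurePreserving_smul_fst Γ μ g⁻¹)

theorem rightShift_coe (g : Γ) (ξ : OrbitL2 Γ μ) :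
    rightShift Γ μ g ξ =ᵐ[orbitMeasure Γ μ] fun z => ξ (z.1, g⁻¹ • z.2) :=
  Lp.coeFn_compMeasurePreserving ξ (measurePreserving_smul_snd Γ μ g⁻¹)

theorem norm_leftShift (g : Γ) (ξ : OrbitL2 Γ μ) : ‖leftShift Γ μ g ξ‖ = ‖ξ‖ :=
  (Lp.compMeasurePreservingₗᵢ ℂ _ (measurePreserving_smul_fst Γ μ g⁻¹)).norm_map ξ

theorem norm_rightShift (g : Γ) (ξ : OrbitL2 Γ μ) : ‖rightShift Γ μ g ξ‖ = ‖ξ‖ :=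
  (Lp.compMeasurePreservingₗᵢ ℂ _ (measurePreserving_smul_snd Γ μ g⁻¹)).norm_map ξ

theorem leftShift_mul_inv (g : Γ) : leftShift Γ μ g * leftShift Γ μ g⁻¹ = 1 := by
  ext1 ξ
  apply Lp.ext
  have h := (measurePreserving_smul_fst Γ μ g⁻¹).quasiMeasurePreserving.ae_eq_comp
    (leftShift_coe Γ μ g⁻¹ ξ)
  refine (leftShift_coe Γ μ g _).trans (h.trans (Eventually.of_forall fun z => ?_))
  simp [Function.comp]

theorem rightShift_mul_inv (g : Γ) : rightShift Γ μ g * rightShift Γ μ g⁻¹ = 1 := by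
  ext1 ξ
  apply Lp.ext
  have h := (measurePreserving_smul_snd Γ μ g⁻¹).quasiMeasurePreserving.ae_eq_comp
    (rightShift_coe Γ μ g⁻¹ ξ)
  refine (rightShift_coe Γ μ g _).trans (h.trans (Eventually.of_forall fun z => ?_))
  simp [Function.comp]

theorem star_eq_of_isometry {H : Type*} [NormedAddCommGroup H] [InnerProductSpace ℂ H]
    [CompleteSpace H] {u v : H →L[ℂ] H} (hu : ∀ ξ, ‖u ξ‖ = ‖ξ‖) (huv : u * v = 1) :
    star u = v := by
  have h1 : star u * u = 1 := (ContinuousLinearMap.norm_map_iff_adjoint_comp_self u).1 hu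
  calc star u = star u * (u * v) := by rw [huv, mul_one]
    _ = v := by rw [← mul_assoc, h1, one_mul]

theorem star_leftShift (g : Γ) : star (leftShift Γ μ g) = leftShift Γ μ g⁻¹ :=
  star_eq_of_isometry (norm_leftShift Γ μ g) (leftShift_mul_inv Γ μ g)

theorem star_rightShift (g : Γ) : star (rightShift Γ μ g) = rightShift Γ μ g⁻¹ :=
  star_eq_of_isometry (norm_rightShift Γ μ g) (rightShift_mul_inv Γ μ g)

/-- Bounded measurable complex functions. -/
def BddMeasurable {Z : Type*} [MeasurableSpace Z] (F : Z → ℂ) : Prop :=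
  Measurable F ∧ ∃ C : ℝ, ∀ z, ‖F z‖ ≤ C

theorem BddMeasurable.memLp {Z : Type*} [MeasurableSpace Z] {F : Z → ℂ} (hF : BddMeasurable F)
    (m : Measure Z) : MemLp F ⊤ m := by
  obtain ⟨C, hC⟩ := hF.2
  exact memLp_top_of_bound hF.1.aestronglyMeasurable C (Eventually.of_forall hC)

theorem BddMeasurable.comp {Z W : Type*} [MeasurableSpace Z] [MeasurableSpace W] {F : Z → ℂ}
    (hF : BddMeasurable F) {T : W → Z} (hT : Measurable T) : BddMeasurable (F ∘ T) :=
  ⟨hF.1.comp hT, hF.2.imp fun _ hC z => hC (T z)⟩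

theorem BddMeasurable.star {Z : Type*} [MeasurableSpace Z] {F : Z → ℂ}
    (hF : BddMeasurable F) : BddMeasurable (star F) :=
  ⟨continuous_star.measurable.comp hF.1, hF.2.imp fun _ hC z => by simpa using hC z⟩

theorem BddMeasurable.add {Z : Type*} [MeasurableSpace Z] {F G : Z → ℂ}
    (hF : BddMeasurable F) (hG : BddMeasurable G) : BddMeasurable (F + G) := by
  obtain ⟨C, hC⟩ := hF.2
  obtain ⟨D, hD⟩ := hG.2
  exact ⟨hF.1.add hG.1, C + D, fun z => norm_add_le_of_le (hC z) (hD z)⟩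

theorem BddMeasurable.mul {Z : Type*} [MeasurableSpace Z] {F G : Z → ℂ}
    (hF : BddMeasurable F) (hG : BddMeasurable G) : BddMeasurable (F * G) := by
  obtain ⟨C, hC⟩ := hF.2
  obtain ⟨D, hD⟩ := hG.2
  exact ⟨hF.1.mul hG.1, C * D, fun z => norm_mul_le_of_le (hC z) (hD z)⟩

theorem bddMeasurable_const {Z : Type*} [MeasurableSpace Z] (c : ℂ) :
    BddMeasurable fun _ : Z => c :=
  ⟨measurable_const, ‖c‖, fun _ => le_rfl⟩

/-- Multiplication by a bounded measurable function, on `L²`. -/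
noncomputable def mulOp {Z : Type*} [MeasurableSpace Z] (m : Measure Z) {F : Z → ℂ}
    (hF : BddMeasurable F) : Lp ℂ 2 m →L[ℂ] Lp ℂ 2 m :=
  (ContinuousLinearMap.mul ℂ ℂ).holderL m ⊤ 2 2 ((hF.memLp m).toLp F)

theorem mulOp_coe {Z : Type*} [MeasurableSpace Z] (m : Measure Z) {F : Z → ℂ}
    (hF : BddMeasurable F) (ξ : Lp ℂ 2 m) : mulOp m hF ξ =ᵐ[m] fun z => F z * ξ z := by
  refine ((ContinuousLinearMap.mul ℂ ℂ).coeFn_holder ((hF.memLp m).toLp F) ξ).trans ?_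
  filter_upwards [(hF.memLp m).coeFn_toLp] with z hz
  simp [hz]

theorem star_mulOp {Z : Type*} [MeasurableSpace Z] (m : Measure Z) {F : Z → ℂ}
    (hF : BddMeasurable F) : star (mulOp m hF) = mulOp m hF.star := by
  rw [ContinuousLinearMap.star_eq_adjoint, eq_comm, ContinuousLinearMap.eq_adjoint_iff]
  intro ξ η
  rw [L2.inner_def, L2.inner_def]
  refine integral_congr_ae ?_
  filter_upwards [mulOp_coe m hF η, mulOp_coe m hF.star ξ] with z h1 h2
  rw [h1, h2]
  simp
  ring

theorem mulOp_mul {Z : Type*} [MeasurableSpace Z] (m : Measure Z) {F G : Z → ℂ}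
    (hF : BddMeasurable F) (hG : BddMeasurable G) :
    mulOp m hF * mulOp m hG = mulOp m (hF.mul hG) := by
  ext1 ξ
  apply Lp.ext
  filter_upwards [mulOp_coe m hF (mulOp m hG ξ), mulOp_coe m hG ξ, mulOp_coe m (hF.mul hG) ξ]
    with z h1 h2 h3
  rw [h3]
  refine h1.trans ?_
  rw [h2, Pi.mul_apply, mul_assoc]

theorem mulOp_add {Z : Type*} [MeasurableSpace Z] (m : Measure Z) {F G : Z → ℂ}
    (hF : BddMeasurable F) (hG : BddMeasurable G) :
    mulOp m hF + mulOp m hG = mulOp m (hF.add hG) := by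
  ext1 ξ
  apply Lp.ext
  filter_upwards [Lp.coeFn_add (mulOp m hF ξ) (mulOp m hG ξ), mulOp_coe m hF ξ,
    mulOp_coe m hG ξ, mulOp_coe m (hF.add hG) ξ] with z h1 h2 h3 h4
  rw [h4]
  refine h1.trans ?_
  rw [Pi.add_apply, h2, h3, Pi.add_apply, add_mul]

theorem mulOp_const {Z : Type*} [MeasurableSpace Z] (m : Measure Z) (c : ℂ) :
    mulOp m (bddMeasurable_const (Z := Z) c) = algebraMap ℂ _ c := by
  ext1 ξ
  apply Lp.ext
  filter_upwards [mulOp_coe m (bddMeasurable_const (Z := Z) c) ξ, Lp.coeFn_smul c ξ]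
    with z h1 h2
  rw [h1, Algebra.algebraMap_eq_smul_one]
  exact h2.symm

/-- `L^∞(X)`, acting on `L²(ℛ, m)` by `(f ξ)(x, y) = f(x) ξ(x, y)`. -/
noncomputable def diagonalAlgebra : StarSubalgebra ℂ (OrbitL2 Γ μ →L[ℂ] OrbitL2 Γ μ) where
  carrier := {T | ∃ (f : X → ℂ) (hf : BddMeasurable f),
    T = mulOp (orbitMeasure Γ μ) (hf.comp measurable_fst)}
  mul_mem' := by
    rintro _ _ ⟨f, hf, rfl⟩ ⟨g, hg, rfl⟩
    exact ⟨f * g, hf.mul hg, mulOp_mul _ _ _⟩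
  add_mem' := by
    rintro _ _ ⟨f, hf, rfl⟩ ⟨g, hg, rfl⟩
    exact ⟨f + g, hf.add hg, mulOp_add _ _ _⟩
  algebraMap_mem' := fun c => ⟨fun _ => c, bddMeasurable_const c, (mulOp_const _ c).symm⟩
  star_mem' := by
    rintro _ ⟨f, hf, rfl⟩
    exact ⟨star f, hf.star, star_mulOp _ _⟩

/-- The generators of `L(ℛ)`: the functions in `L^∞(X)` and the canonical unitaries `u_g`. -/
def orbitGenerators : Set (OrbitL2 Γ μ →L[ℂ] OrbitL2 Γ μ) :=
  (diagonalAlgebra Γ μ : Set _) ∪ Set.range (leftShift Γ μ)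

theorem orbitGenerators_star {s : OrbitL2 Γ μ →L[ℂ] OrbitL2 Γ μ}
    (hs : s ∈ orbitGenerators Γ μ) : star s ∈ orbitGenerators Γ μ := by
  rcases hs with hs | ⟨g, rfl⟩
  · exact Or.inl (star_mem (SetLike.mem_coe.1 hs))
  · exact Or.inr ⟨g⁻¹, (star_leftShift Γ μ g).symm⟩

variable [MeasurableEq X]

variable [IsProbabilityMeasure μ]

/-- The indicator function of the diagonal, as a vector of `L²(ℛ, m)`. -/
noncomputable def diagonalVector : OrbitL2 Γ μ :=
  indicatorConstLp 2 (measurableSet_diagonal (α := X))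
    (by rw [orbitMeasure_diagonal]; exact ENNReal.one_ne_top) (1 : ℂ)

theorem norm_diagonalVector : ‖diagonalVector Γ μ‖ = 1 := by
  rw [diagonalVector, norm_indicatorConstLp (by simp) (by simp), Measure.real,
    orbitMeasure_diagonal]
  simp

theorem diagonalVector_coe : diagonalVector Γ μ =ᵐ[orbitMeasure Γ μ]
    (Set.diagonal X).indicator fun _ => (1 : ℂ) :=
  indicatorConstLp_coeFn

theorem mulOp_diagonalVector {f : X → ℂ} (hf : BddMeasurable f) :
    mulOp (orbitMeasure Γ μ) (hf.comp measurable_fst) (diagonalVector Γ μ) =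
      mulOp (orbitMeasure Γ μ) (hf.comp measurable_snd) (diagonalVector Γ μ) := by
  apply Lp.ext
  filter_upwards [mulOp_coe (orbitMeasure Γ μ) (hf.comp measurable_fst) (diagonalVector Γ μ),
    mulOp_coe (orbitMeasure Γ μ) (hf.comp measurable_snd) (diagonalVector Γ μ),
    diagonalVector_coe Γ μ] with z h1 h2 h3
  rw [h1, h2, h3]
  by_cases hz : z ∈ Set.diagonal X
  · have hz' : z.1 = z.2 := hz
    simp [hz']
  · simp [hz]

theorem leftShift_diagonalVector (g : Γ) :
    leftShift Γ μ g (diagonalVector Γ μ) = rightShift Γ μ g⁻¹ (diagonalVector Γ μ) := by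
  apply Lp.ext
  have h1 := (measurePreserving_smul_fst Γ μ g⁻¹).quasiMeasurePreserving.ae_eq_comp
    (diagonalVector_coe Γ μ)
  have h2 := (measurePreserving_smul_snd Γ μ g⁻¹⁻¹).quasiMeasurePreserving.ae_eq_comp
    (diagonalVector_coe Γ μ)
  filter_upwards [leftShift_coe Γ μ g (diagonalVector Γ μ),
    rightShift_coe Γ μ g⁻¹ (diagonalVector Γ μ), h1, h2] with z k1 k2 k3 k4
  rw [k1, k2]
  refine k3.trans (Eq.trans ?_ k4.symm)
  have h : ((g⁻¹ • z.1, z.2) ∈ Set.diagonal X) = ((z.1, g⁻¹⁻¹ • z.2) ∈ Set.diagonal X) := by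
    rw [Set.mem_diagonal_iff, Set.mem_diagonal_iff, inv_inv]
    exact propext inv_smul_eq_iff
  simp only [Function.comp, Set.indicator]
  by_cases hz : (g⁻¹ • z.1, z.2) ∈ Set.diagonal X
  · rw [if_pos hz, if_pos (h ▸ hz)]
  · rw [if_neg hz, if_neg (h ▸ hz)]

/-- Left and right operators commute, and a generator acts on the diagonal vector as a
right operator does. -/
theorem orbitGenerators_right {s : OrbitL2 Γ μ →L[ℂ] OrbitL2 Γ μ}
    (hs : s ∈ orbitGenerators Γ μ) :
    ∃ r ∈ (orbitGenerators Γ μ).centralizer,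
      s (diagonalVector Γ μ) = r (diagonalVector Γ μ) ∧
      star s (diagonalVector Γ μ) = star r (diagonalVector Γ μ) := by
  rcases hs with ⟨f, hf, rfl⟩ | ⟨g, rfl⟩
  · refine ⟨mulOp (orbitMeasure Γ μ) (hf.comp measurable_snd), ?_,
      mulOp_diagonalVector Γ μ hf, ?_⟩
    · rintro _ (⟨k, hk, rfl⟩ | ⟨g, rfl⟩)
      · rw [mulOp_mul, mulOp_mul]
        congr 1
        exact mul_comm _ _
      · ext1 ξ
        apply Lp.ext
        have h1 := (measurePreserving_smul_fst Γ μ g⁻¹).quasiMeasurePreserving.ae_eq_comp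
          (mulOp_coe (orbitMeasure Γ μ) (hf.comp measurable_snd) ξ)
        filter_upwards [leftShift_coe Γ μ g
          (mulOp (orbitMeasure Γ μ) (hf.comp measurable_snd) ξ), h1,
          mulOp_coe (orbitMeasure Γ μ) (hf.comp measurable_snd) (leftShift Γ μ g ξ),
          leftShift_coe Γ μ g ξ] with z k1 k2 k3 k4
        refine k1.trans (k2.trans (Eq.trans ?_ k3.symm))
        rw [k4]
        rfl
    · rw [star_mulOp, star_mulOp]
      exact mulOp_diagonalVector Γ μ hf.star
  · refine ⟨rightShift Γ μ g⁻¹, ?_, leftShift_diagonalVector Γ μ g, ?_⟩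
    · rintro _ (⟨k, hk, rfl⟩ | ⟨h, rfl⟩)
      · ext1 ξ
        apply Lp.ext
        have h1 := (measurePreserving_smul_snd Γ μ g⁻¹⁻¹).quasiMeasurePreserving.ae_eq_comp
          (mulOp_coe (orbitMeasure Γ μ) (hk.comp measurable_fst) ξ)
        filter_upwards [rightShift_coe Γ μ g⁻¹
          (mulOp (orbitMeasure Γ μ) (hk.comp measurable_fst) ξ), h1,
          mulOp_coe (orbitMeasure Γ μ) (hk.comp measurable_fst) (rightShift Γ μ g⁻¹ ξ),
          rightShift_coe Γ μ g⁻¹ ξ] with z k1 k2 k3 k4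
        refine k3.trans (Eq.trans ?_ (k1.trans k2).symm)
        rw [k4]
        rfl
      · ext1 ξ
        apply Lp.ext
        have h1 := (measurePreserving_smul_fst Γ μ h⁻¹).quasiMeasurePreserving.ae_eq_comp
          (rightShift_coe Γ μ g⁻¹ ξ)
        have h2 := (measurePreserving_smul_snd Γ μ g⁻¹⁻¹).quasiMeasurePreserving.ae_eq_comp
          (leftShift_coe Γ μ h ξ)
        filter_upwards [leftShift_coe Γ μ h (rightShift Γ μ g⁻¹ ξ), h1,
          rightShift_coe Γ μ g⁻¹ (leftShift Γ μ h ξ), h2] with z k1 k2 k3 k4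
        exact (k1.trans k2).trans (k3.trans k4).symm
    · rw [star_leftShift, star_rightShift]
      exact leftShift_diagonalVector Γ μ g⁻¹

end Orbit

/-! ### The Cartan inclusion of a pmp action -/

section Cartan

variable (Γ : Type*) [Group Γ] {X : Type*} [MeasurableSpace X] [MulAction Γ X]
  [MeasurableConstSMul Γ X] (μ : Measure X) [SMulInvariantMeasure Γ X μ] [MeasurableEq X]
  [IsProbabilityMeasure μ]

/-- The von Neumann algebra `L(ℛ)` of the orbit equivalence relation, acting on `L²(ℛ, m)`,
with its canonical trace. -/
noncomputable def orbitVNA : TracialVNA (OrbitL2 Γ μ) where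
  alg := vonNeumannGenerated (orbitGenerators Γ μ)
  vec := diagonalVector Γ μ
  norm_vec := norm_diagonalVector Γ μ
  tracial := fun _ hx _ hy => tracial_of_right (fun _ => orbitGenerators_star Γ μ) _
    (fun _ => orbitGenerators_right Γ μ) hx hy

/-- The Cartan subalgebra `L^∞(X) ⊂ L(ℛ)`. -/
noncomputable def cartan : StarSubalgebra ℂ (orbitVNA Γ μ).Carrier :=
  (diagonalAlgebra Γ μ).comap (orbitVNA Γ μ).alg.toStarSubalgebra.subtype

/-- The canonical unitary `u_g` in `L(ℛ)`. -/
noncomputable def canonicalUnitary (g : Γ) : (orbitVNA Γ μ).Carrier :=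
  ⟨leftShift Γ μ g, subset_vonNeumannGenerated _ (Or.inr ⟨g, rfl⟩)⟩

theorem canonicalUnitary_mul_inv (g : Γ) :
    canonicalUnitary Γ μ g * canonicalUnitary Γ μ g⁻¹ = 1 :=
  Subtype.ext (leftShift_mul_inv Γ μ g)

theorem star_canonicalUnitary (g : Γ) :
    star (canonicalUnitary Γ μ g) = canonicalUnitary Γ μ g⁻¹ :=
  Subtype.ext (star_leftShift Γ μ g)

/-- `u_g f u_g* = f(g⁻¹ ·)`. -/
theorem leftShift_mul_mulOp (g : Γ) {f : X → ℂ} (hf : BddMeasurable f) :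
    leftShift Γ μ g * mulOp (orbitMeasure Γ μ) (hf.comp measurable_fst) * leftShift Γ μ g⁻¹ =
      mulOp (orbitMeasure Γ μ)
        ((hf.comp (measurable_const_smul g⁻¹)).comp measurable_fst) := by
  ext1 ξ
  apply Lp.ext
  have h1 := (measurePreserving_smul_fst Γ μ g⁻¹).quasiMeasurePreserving.ae_eq_comp
    (mulOp_coe (orbitMeasure Γ μ) (hf.comp measurable_fst) (leftShift Γ μ g⁻¹ ξ))
  have h2 := (measurePreserving_smul_fst Γ μ g⁻¹).quasiMeasurePreserving.ae_eq_comp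
    (leftShift_coe Γ μ g⁻¹ ξ)
  filter_upwards [leftShift_coe Γ μ g
    (mulOp (orbitMeasure Γ μ) (hf.comp measurable_fst) (leftShift Γ μ g⁻¹ ξ)), h1, h2,
    mulOp_coe (orbitMeasure Γ μ)
      ((hf.comp (measurable_const_smul g⁻¹)).comp measurable_fst) ξ] with z k1 k2 k3 k4
  refine (k1.trans k2).trans (Eq.trans ?_ k4.symm)
  simp only [Function.comp] at k3 ⊢
  rw [k3]
  simp

theorem canonicalUnitary_conj_mem (g : Γ) {a : (orbitVNA Γ μ).Carrier} (ha : a ∈ cartan Γ μ) :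
    canonicalUnitary Γ μ g * a * canonicalUnitary Γ μ g⁻¹ ∈ cartan Γ μ := by
  obtain ⟨f, hf, h⟩ := ha
  refine ⟨_, hf.comp (measurable_const_smul g⁻¹), ?_⟩
  have h' : (a : OrbitL2 Γ μ →L[ℂ] OrbitL2 Γ μ) =
      mulOp (orbitMeasure Γ μ) (hf.comp measurable_fst) := h
  refine Eq.trans ?_ (leftShift_mul_mulOp Γ μ g hf)
  rw [← h']
  rfl

end Cartan

/-! ### Isomorphisms, partial isomorphisms and their Hilbert distance -/

section Iso

/-- A trace preserving isomorphism between `*`-algebras with traces. -/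
structure TraceIso {A B : Type*} [Ring A] [StarRing A] [Algebra ℂ A] [Ring B] [StarRing B]
    [Algebra ℂ B] (τ : A → ℂ) (τ' : B → ℂ) extends A ≃⋆ₐ[ℂ] B where
  trace_map : ∀ a, τ' (toFun a) = τ a

namespace TraceIso

variable {A B C : Type*} [Ring A] [StarRing A] [Algebra ℂ A] [Ring B] [StarRing B]
  [Algebra ℂ B] [Ring C] [StarRing C] [Algebra ℂ C] {τ : A → ℂ} {τ' : B → ℂ} {τ'' : C → ℂ}

instance : CoeFun (TraceIso τ τ') fun _ => A → B := ⟨fun θ => θ.toStarAlgEquiv⟩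

/-- The inverse isomorphism. -/
def symm (θ : TraceIso τ τ') : TraceIso τ' τ where
  toStarAlgEquiv := θ.toStarAlgEquiv.symm
  trace_map := fun b => by
    have h := θ.trace_map (θ.toStarAlgEquiv.symm b)
    exact h.symm.trans (congrArg τ' (θ.toStarAlgEquiv.apply_symm_apply b))

/-- The composition, first `θ` and then `η`. -/
def trans (θ : TraceIso τ τ') (η : TraceIso τ' τ'') : TraceIso τ τ'' where
  toStarAlgEquiv := θ.toStarAlgEquiv.trans η.toStarAlgEquiv
  trace_map := fun a => (η.trace_map (θ a)).trans (θ.trace_map a)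

/-- `θ α θ⁻¹`. -/
def conj (θ : TraceIso τ τ') (α : TraceIso τ τ) : TraceIso τ' τ' :=
  (θ.symm.trans α).trans θ

end TraceIso

/-- A trace preserving partial isomorphism `φ : A p ≃ A q`, with `p`, `q` projections, of an
abelian algebra `A`. It is encoded by its right support `p` and the map `a ↦ φ(a p)`; the left
support is `q = φ(p)`. -/
structure PartialIso {A : Type*} [Ring A] [StarRing A] [Algebra ℂ A] (τ : A → ℂ) where
  /-- the right support -/
  supp : A
  /-- the map `a ↦ φ(a p)` -/
  map : A →⋆ₙₐ[ℂ] A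
  isProj : IsStarProjection supp
  map_supp_mul : ∀ a, map (supp * a) = map a
  injOn : ∀ a, map a = 0 → supp * a = 0
  surjOn : ∀ b, ∃ a, map a = map supp * b
  trace_map : ∀ a, τ (map a) = τ (supp * a)

namespace PartialIso

variable {A : Type*} [Ring A] [StarRing A] [Algebra ℂ A] {τ : A → ℂ}

/-- A trace preserving automorphism, as a partial isomorphism. -/
def ofAut (α : TraceIso τ τ) : PartialIso τ where
  supp := 1
  map :=
    { toFun := α
      map_smul' := fun c a => map_smul α.toStarAlgEquiv c a
      map_zero' := map_zero α.toStarAlgEquiv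
      map_add' := map_add α.toStarAlgEquiv
      map_mul' := map_mul α.toStarAlgEquiv
      map_star' := map_star α.toStarAlgEquiv }
  isProj := IsStarProjection.one A
  map_supp_mul := fun a => by rw [one_mul]
  injOn := fun a h => by
    rw [one_mul]
    exact (map_eq_zero_iff α.toStarAlgEquiv α.toStarAlgEquiv.injective).1 h
  surjOn := fun b => ⟨α.toStarAlgEquiv.symm b, by
    change α.toStarAlgEquiv (α.toStarAlgEquiv.symm b) = α.toStarAlgEquiv 1 * b
    rw [α.toStarAlgEquiv.apply_symm_apply, map_one, one_mul]⟩
  trace_map := fun a => by rw [one_mul]; exact α.trace_map a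

/-- `τ(p)` for the largest projection `p` under both right supports such that `φ` and `ψ`
coincide on `A p`; in other words `p` is the largest projection on which `φ⁻¹ψ` acts as the
identity. -/
noncomputable def agreement (φ ψ : PartialIso τ) : ℝ :=
  sSup {t | ∃ p : A, IsStarProjection p ∧ φ.supp * p = p ∧ ψ.supp * p = p ∧
    (∀ a, φ.map (p * a) = ψ.map (p * a)) ∧ t = (τ p).re}

/-- The distance `‖φ - ψ‖₂ = (τ(R(φ)) + τ(R(ψ)) - 2 τ(p_{φ⁻¹ψ}))^{1/2}`. -/
noncomputable def dist2 (φ ψ : PartialIso τ) : ℝ :=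
  Real.sqrt ((τ φ.supp).re + (τ ψ.supp).re - 2 * agreement φ ψ)

/-- `φ = ⊕_i (α i)|_{A (p i)}`: the right support of `φ` is the supremum of the projections
`p i`, and `φ` coincides with `α i` on `A (p i)`. -/
def IsDirectSum {ι : Type*} (φ : PartialIso τ) (α : ι → TraceIso τ τ) (p : ι → A) : Prop :=
  (∀ i, φ.supp * p i = p i) ∧
  (∀ e : A, IsStarProjection e → (∀ i, e * p i = p i) → e * φ.supp = φ.supp) ∧
  ∀ i a, φ.map (p i * a) = α i (p i * a)

end PartialIso

/-- The `p i` are mutually orthogonal projections, and so are their images `α i (p i)`. -/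
def DisjointProjections {A ι : Type*} [Ring A] [StarRing A] [Algebra ℂ A] {τ : A → ℂ}
    (α : ι → TraceIso τ τ) (p : ι → A) : Prop :=
  (∀ i, IsStarProjection (p i)) ∧
  Pairwise (fun i j => p i * p j = 0) ∧
  Pairwise (fun i j => α i (p i) * α j (p j) = 0)

end Iso

section Action

variable (Γ : Type*) [Group Γ] {X : Type*} [MeasurableSpace X] [MulAction Γ X]
  [MeasurableConstSMul Γ X] (μ : Measure X) [SMulInvariantMeasure Γ X μ] [MeasurableEq X]
  [IsProbabilityMeasure μ]

/-- The trace of `L^∞(X)`, restricted from `L(ℛ)`. -/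
noncomputable abbrev cartanTr : cartan Γ μ → ℂ := (orbitVNA Γ μ).trOn (cartan Γ μ)

theorem canonicalUnitary_inv_mul (g : Γ) :
    canonicalUnitary Γ μ g⁻¹ * canonicalUnitary Γ μ g = 1 := by
  have h := canonicalUnitary_mul_inv Γ μ g⁻¹
  rwa [inv_inv] at h

/-- The action of `g` on `L^∞(X)`, `a ↦ u_g a u_g*`, that is `f ↦ f(g⁻¹ ·)`. -/
noncomputable def actionAut (g : Γ) : TraceIso (cartanTr Γ μ) (cartanTr Γ μ) where
  toFun a := ⟨canonicalUnitary Γ μ g * a * canonicalUnitary Γ μ g⁻¹,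
    canonicalUnitary_conj_mem Γ μ g a.2⟩
  invFun a := ⟨canonicalUnitary Γ μ g⁻¹ * a * canonicalUnitary Γ μ g⁻¹⁻¹,
    canonicalUnitary_conj_mem Γ μ g⁻¹ a.2⟩
  left_inv a := Subtype.ext <| by
    simp only [inv_inv]
    rw [← mul_assoc, ← mul_assoc, canonicalUnitary_inv_mul, one_mul, mul_assoc,
      canonicalUnitary_inv_mul, mul_one]
  right_inv a := Subtype.ext <| by
    simp only [inv_inv]
    rw [← mul_assoc, ← mul_assoc, canonicalUnitary_mul_inv, one_mul, mul_assoc,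
      canonicalUnitary_mul_inv, mul_one]
  map_mul' a b := Subtype.ext <| by
    change canonicalUnitary Γ μ g * ((a : (orbitVNA Γ μ).Carrier) * b) *
        canonicalUnitary Γ μ g⁻¹ =
      canonicalUnitary Γ μ g * a * canonicalUnitary Γ μ g⁻¹ *
        (canonicalUnitary Γ μ g * b * canonicalUnitary Γ μ g⁻¹)
    have h := canonicalUnitary_inv_mul Γ μ g
    calc _ = canonicalUnitary Γ μ g * a * 1 * (b * canonicalUnitary Γ μ g⁻¹) := by
            simp only [mul_one, mul_assoc]
      _ = _ := by rw [← h]; simp only [mul_assoc]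
  map_add' a b := Subtype.ext <| by
    change canonicalUnitary Γ μ g * ((a : (orbitVNA Γ μ).Carrier) + b) *
        canonicalUnitary Γ μ g⁻¹ = _
    rw [mul_add, add_mul]; rfl
  map_star' a := Subtype.ext <| by
    change canonicalUnitary Γ μ g * star (a : (orbitVNA Γ μ).Carrier) *
        canonicalUnitary Γ μ g⁻¹ =
      star (canonicalUnitary Γ μ g * a * canonicalUnitary Γ μ g⁻¹)
    rw [star_mul, star_mul, star_canonicalUnitary, star_canonicalUnitary, inv_inv, mul_assoc]
  map_smul' c a := Subtype.ext <| by
    change canonicalUnitary Γ μ g * (c • (a : (orbitVNA Γ μ).Carrier)) *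
        canonicalUnitary Γ μ g⁻¹ = _
    rw [mul_smul_comm, smul_mul_assoc]; rfl
  trace_map a := by
    change (orbitVNA Γ μ).tr (canonicalUnitary Γ μ g * a * canonicalUnitary Γ μ g⁻¹) =
      (orbitVNA Γ μ).tr a
    rw [(orbitVNA Γ μ).tr_mul_comm, ← mul_assoc, canonicalUnitary_inv_mul, one_mul]

end Action

/-! ### The two kinds of isomorphisms to be compared -/

section Main

variable {H K : Type*} [NormedAddCommGroup H] [InnerProductSpace ℂ H] [CompleteSpace H]
  [NormedAddCommGroup K] [InnerProductSpace ℂ K] [CompleteSpace K]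

/-- There is an isomorphism of tracial Cartan inclusions
`(A^ω ⊂ M(ω)) ≃ (B^ω ⊂ N(ω))` whose restriction to `A^ω` is of ultraproduct form
`(a n) ↦ (θ_n (a n))`, with trace preserving isomorphisms `θ_n : A ≃ B`. -/
def UltraproductIso (M : TracialVNA H) (A : StarSubalgebra ℂ M.Carrier) (N : TracialVNA K)
    (B : StarSubalgebra ℂ N.Carrier) (ω : Ultrafilter ℕ) : Prop :=
  ∃ Θ : TraceIso (fun x : M.ultraCartan A ω => M.ultraTr ω x)
      (fun y : N.ultraCartan B ω => N.ultraTr ω y),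
    (∀ x : M.ultraCartan A ω, (x : M.Ultra ω) ∈ M.ultraSub A ω ↔ (Θ x : N.Ultra ω) ∈ N.ultraSub B ω) ∧
    ∃ θ : ℕ → TraceIso (M.trOn A) (N.trOn B),
      ∀ (a : ℕ →ᵇ M.Carrier) (b : ℕ →ᵇ N.Carrier) (ha : ∀ n, a n ∈ A),
        (∀ n, b n = θ n ⟨a n, ha n⟩) →
        ∀ x : M.ultraCartan A ω, (x : M.Ultra ω) = M.ultraMk ω a →
          (Θ x : N.Ultra ω) = N.ultraMk ω b

end Main

end AppOE

set_option linter.unusedSectionVars false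

namespace AppOE

/-! ### Polynomial functional calculus of positive operators -/

section PolynomialCalculus

open Polynomial

variable {H : Type*} [NormedAddCommGroup H] [InnerProductSpace ℂ H] [CompleteSpace H]

/-! A trace preserving isomorphism θ_n : A ≃ B is composition with a point isomorphism π_n, so for φ
∈ Γ the automorphism θ_n φ θ_n⁻¹ is composition with a map S_n of Y (`PointIso.conj`). Everything
turns on one condition, `Tight`: up to measure ε, and for all n along the filter, S_n agrees
piecewise with ψ⁻¹ for ψ in a finite set F ⊂ Λ that does not depend on n. Conditions (c) and (d)
both express tightness in the two directions: mass bounded by weights of total 1 cannot escape to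
infinity in the group.

From an isomorphism to tightness. If Θ is of ultraproduct form, v = Θ(u_φ) is a unitary of N(ω) with
v w = (w ∘ S_n) v for w ∈ B^ω. By `mem_ultraCartan_iff` it is ‖·‖₂-close to a finite sum y of terms
b u_ψ, ψ ∈ F. Where S_n and ψ⁻¹ disagree, functions with values ±1 separate them, and this makes v
orthogonal to b u_ψ for b supported there (`exists_sign`, `ultraTr_eq_zero_of_intertwines`). Hence
the projection K onto the points where S_n agrees with no ψ ∈ F satisfies τ(K) = τ((K(v - y))* v),
which is small (`exists_finset_measureReal_lt`). The limits along ω of the measures of disjoint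
cells of agreement are the weights of (c), and the cells are trimmed to them by
`eventually_exists_subset_measureReal`. Conversely, weights of sum 1 force the projections in (c) to
have almost these traces (`Approximable.sub_le`), so a diagonal choice yields (d).

From tightness to an isomorphism. Condition (d) gives tightness along `atTop`, hence along every
free ultrafilter, which is why the choice of ω is immaterial. Let v_{φ,n} be the sum of 1_cell u_ψ
over the first n elements ψ. In the ultrapower the classes v_φ form a unitary representation of Γ,
implement the maps S_n, and lie in N(ω) by tightness. The trace of a u_φ is the integral of a over
the fixed points of φ, so it depends only on the point map and τ(a u_φ) = τ(θ(a) v_φ). This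
identity, rather than freeness, makes a u_φ ↦ θ(a) v_φ well defined: the pairs span a trace
preserving graph. Tightness of the inverses makes its second components dense in N(ω).

It remains to pass to ‖·‖₂-closures (`exists_traceIso_of_graph`). As in Kaplansky's density theorem,
a polynomial truncation applied to both components of a pair makes the approximants uniformly
bounded (`exists_truncated_pair`); bounded sequences that converge fast have a limit in the
ultrapower by a diagonal choice (`exists_ultra_limit`). -/

theorem spectrum_star_mul_self_subset {z : H →L[ℂ] H} {K : ℝ} (hK : ‖z‖ ≤ K) :
    spectrum ℝ (star z * z) ⊆ Set.Icc 0 (K ^ 2) := by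
  intro t ht
  refine ⟨spectrum_star_mul_self_nonneg t ht, ?_⟩
  have h1 : ‖t‖ ≤ ‖star z * z‖ := by
    rcases subsingleton_or_nontrivial (H →L[ℂ] H) with h | h
    · exact absurd ht (by simp [spectrum.of_subsingleton])
    · exact spectrum.norm_le_norm_of_mem ht
  rw [CStarRing.norm_star_mul_self] at h1
  calc t ≤ ‖t‖ := Real.le_norm_self t
    _ ≤ ‖z‖ * ‖z‖ := h1
    _ ≤ K ^ 2 := by rw [sq]; exact mul_self_le_mul_self (norm_nonneg _) hK

theorem re_inner_self_complex (v : H) : (⟪v, v⟫_ℂ).re = ‖v‖ ^ 2 :=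
  inner_self_eq_norm_sq (𝕜 := ℂ) v

theorem inner_star_right (T : H →L[ℂ] H) (v w : H) : ⟪v, star T w⟫_ℂ = ⟪T v, w⟫_ℂ := by
  rw [ContinuousLinearMap.star_eq_adjoint, ContinuousLinearMap.adjoint_inner_right]

theorem re_inner_aeval_nonneg {z : H →L[ℂ] H} {K : ℝ} (hK : ‖z‖ ≤ K) {q : ℝ[X]}
    (hq : ∀ t ∈ Set.Icc 0 (K ^ 2), 0 ≤ q.eval t) (v : H) :
    0 ≤ (⟪v, aeval (star z * z) q v⟫_ℂ).re := by
  have h : 0 ≤ aeval (star z * z) q := by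
    rw [← cfc_polynomial q (star z * z) (IsSelfAdjoint.star_mul_self z)]
    exact cfc_nonneg fun t ht => hq t (spectrum_star_mul_self_subset hK ht)
  exact ((ContinuousLinearMap.nonneg_iff_isPositive _).1 h).re_inner_nonneg_right v

theorem norm_aeval_le {z : H →L[ℂ] H} {K : ℝ} (hK : ‖z‖ ≤ K) {q : ℝ[X]} {c : ℝ} (hc : 0 ≤ c)
    (hq : ∀ t ∈ Set.Icc 0 (K ^ 2), |q.eval t| ≤ c) :
    ‖aeval (star z * z) q‖ ≤ c := by
  rw [← cfc_polynomial q (star z * z) (IsSelfAdjoint.star_mul_self z)]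
  exact norm_cfc_le hc fun t ht => hq t (spectrum_star_mul_self_subset hK ht)

theorem star_aeval_star_mul_self (z : H →L[ℂ] H) (q : ℝ[X]) :
    star (aeval (star z * z) q) = aeval (star z * z) q := by
  rw [← cfc_polynomial q (star z * z) (IsSelfAdjoint.star_mul_self z)]
  exact (cfc_predicate _ _ : IsSelfAdjoint _).star_eq

theorem norm_sq_aeval_apply (z : H →L[ℂ] H) (q : ℝ[X]) (v : H) :
    ‖aeval (star z * z) q v‖ ^ 2 = (⟪v, aeval (star z * z) (q ^ 2) v⟫_ℂ).re := by
  have h : aeval (star z * z) (q ^ 2) v =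
      star (aeval (star z * z) q) (aeval (star z * z) q v) := by
    rw [star_aeval_star_mul_self, sq, map_mul]; rfl
  rw [h, inner_star_right, re_inner_self_complex]

theorem norm_sq_mul_aeval_apply (z : H →L[ℂ] H) (q : ℝ[X]) (v : H) :
    ‖z (aeval (star z * z) q v)‖ ^ 2 = (⟪v, aeval (star z * z) (X * q ^ 2) v⟫_ℂ).re := by
  have h : aeval (star z * z) (X * q ^ 2) v =
      star (aeval (star z * z) q) (star z (z (aeval (star z * z) q v))) := by
    rw [star_aeval_star_mul_self, show X * q ^ 2 = q * X * q by ring, map_mul, map_mul, aeval_X]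
    rfl
  rw [h, inner_star_right, inner_star_right, re_inner_self_complex]

/-- The square of ‖z q(z*z) v‖ is the value at v of the quadratic form of (X q²)(z*z), and c² - X q²
is nonnegative on an interval containing the spectrum. -/
theorem norm_mul_aeval_le {z : H →L[ℂ] H} {K : ℝ} (hK : ‖z‖ ≤ K) {q : ℝ[X]} {c : ℝ}
    (hc : 0 ≤ c) (hq : ∀ t ∈ Set.Icc 0 (K ^ 2), t * q.eval t ^ 2 ≤ c ^ 2) :
    ‖z * aeval (star z * z) q‖ ≤ c := by
  refine ContinuousLinearMap.opNorm_le_bound _ hc fun v => ?_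
  refine abs_le_of_sq_le_sq' ?_ (by positivity) |>.2
  change ‖z (aeval (star z * z) q v)‖ ^ 2 ≤ _
  rw [norm_sq_mul_aeval_apply]
  have h := re_inner_aeval_nonneg hK (q := C (c ^ 2) - X * q ^ 2)
    (fun t ht => by simpa using hq t ht) v
  rw [map_sub, aeval_C, Algebra.algebraMap_eq_smul_one] at h
  simp only [sub_apply, smul_apply, one_apply_eq_self,
    inner_sub_right, Complex.sub_re, inner_smul_right_eq_smul, Complex.smul_re, smul_eq_mul,
    re_inner_self_complex] at h
  rw [mul_pow]
  linarith

/-- A polynomial that truncates `z ↦ z q(z* z)` at norm about `2 c`, close to the identity on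
the operators of norm at most `2 c`. -/
theorem exists_truncation {c K η : ℝ} (hc : 0 < c) (hη : 0 < η) (hη1 : η ≤ 1) (hK : 1 ≤ K) :
    ∃ q : ℝ[X], (∀ t ∈ Set.Icc 0 (K ^ 2), t * q.eval t ^ 2 ≤ (2 * c + 1) ^ 2) ∧
      (∀ t ∈ Set.Icc 0 (K ^ 2), |(1 - q.eval t)| ≤ 2) ∧
      ∀ t ∈ Set.Icc 0 (K ^ 2),
        0 ≤ (t - 4 * c ^ 2) * (1 - q.eval t) ^ 2 + 4 * c ^ 2 * η ^ 2 := by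
  have hK0 : 0 < K := by linarith
  set L := 4 * c ^ 2 with hL
  have hL0 : 0 < L := by positivity
  -- The target function is 1 on [0, 4c²] and 4c²/t beyond, so √t times it is at most 2c. The
  -- precision η/K is at most η as K ≥ 1, and it costs at most 1 after multiplication by √t ≤ K.
  obtain ⟨q, hq⟩ := exists_polynomial_near_of_continuousOn 0 (K ^ 2)
    (fun t => L / max t L) (by
      refine Continuous.continuousOn ?_
      exact continuous_const.div (continuous_id.max continuous_const)
        fun t => (lt_of_lt_of_le hL0 (le_max_right _ _)).ne') (η / K) (by positivity)
  have hηK : η / K ≤ η := div_le_self hη.le hK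
  refine ⟨q, fun t ht => ?_, fun t ht => ?_, fun t ht => ?_⟩
  · have h1 : |q.eval t| ≤ L / max t L + η / K := by
      have := abs_sub_abs_le_abs_sub (q.eval t) (L / max t L)
      have h2 : |L / max t L| = L / max t L := abs_of_nonneg (by positivity)
      linarith [hq t ht]
    have hs : √t ≤ K := by
      rw [← Real.sqrt_sq hK0.le]; exact Real.sqrt_le_sqrt ht.2
    have hst : √t * √t = t := Real.mul_self_sqrt ht.1
    have hs0 : 0 ≤ √t := Real.sqrt_nonneg t
    have h3 : √t * |q.eval t| ≤ 2 * c + 1 := by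
      have h4 : √t * (L / max t L) ≤ 2 * c := by
        rw [mul_div_assoc', div_le_iff₀ (lt_of_lt_of_le hL0 (le_max_right _ _))]
        rcases le_total (√t) (2 * c) with h | h
        · exact mul_le_mul h (le_max_right _ _) hL0.le (by positivity)
        · refine le_trans ?_ (mul_le_mul_of_nonneg_left (le_max_left _ _) (by positivity))
          have e : 2 * c * t - √t * L = 2 * c * (√t * (√t - 2 * c)) := by
            rw [hL]; linear_combination (2 * c) * hst.symm
          have := mul_nonneg (mul_nonneg zero_le_two hc.le) (mul_nonneg hs0 (sub_nonneg.2 h))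
          linarith
      have h5 : √t * (η / K) ≤ 1 := by
        rw [mul_div_assoc', div_le_one hK0]; nlinarith
      calc √t * |q.eval t| ≤ √t * (L / max t L + η / K) := by gcongr
        _ ≤ _ := by rw [mul_add]; linarith
    calc t * q.eval t ^ 2 = (√t * |q.eval t|) ^ 2 := by
          rw [mul_pow, sq_abs, Real.sq_sqrt ht.1]
      _ ≤ _ := by gcongr
  · have h0 : 0 ≤ L / max t L := by positivity
    have h1 : L / max t L ≤ 1 := div_le_one_of_le₀ (le_max_right _ _) (by positivity)
    have := abs_lt.1 (hq t ht)
    rw [abs_le]; constructor <;> linarith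
  · rcases le_total t L with h | h
    · have h2 := hq t ht
      rw [max_eq_right h, div_self hL0.ne', abs_sub_comm] at h2
      have h3 : (1 - q.eval t) ^ 2 ≤ η ^ 2 := by
        rw [← sq_abs]; gcongr; linarith
      nlinarith [ht.1, sq_nonneg (1 - q.eval t)]
    · have := mul_nonneg (sub_nonneg.2 h) (sq_nonneg (1 - q.eval t))
      positivity

end PolynomialCalculus

/-! ### Truncation and the Hilbert norm -/

namespace TracialVNA

open Polynomial

variable {H : Type*} [NormedAddCommGroup H] [InnerProductSpace ℂ H] [CompleteSpace H]
  (M : TracialVNA H)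

/-- The estimates use real polynomials of a self-adjoint operator, whereas the algebras at hand are
complex; this moves between the two. -/
theorem coe_aeval (b : M.Carrier) (q : ℝ[X]) :
    ((aeval b (q.map (algebraMap ℝ ℂ)) : M.Carrier) : H →L[ℂ] H) =
      aeval (b : H →L[ℂ] H) q := by
  have h := Polynomial.aeval_algHom_apply M.alg.toStarSubalgebra.subtype.toAlgHom b
    (q.map (algebraMap ℝ ℂ))
  refine h.symm.trans ?_
  rw [aeval_map_algebraMap]; rfl

theorem norm_truncation_le {c K : ℝ} (hc : 0 < c) {q : ℝ[X]}
    (h1 : ∀ t ∈ Set.Icc 0 (K ^ 2), t * q.eval t ^ 2 ≤ (2 * c + 1) ^ 2) (y : M.Carrier)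
    (hy : ‖y‖ ≤ K) : ‖y * aeval (star y * y) (q.map (algebraMap ℝ ℂ))‖ ≤ 2 * c + 1 := by
  refine le_trans (le_of_eq ?_) (norm_mul_aeval_le hy (by positivity) h1)
  change ‖(y : H →L[ℂ] H) * ((aeval (star y * y) (q.map (algebraMap ℝ ℂ)) : M.Carrier) :
    H →L[ℂ] H)‖ = _
  rw [coe_aeval]; rfl

/-- Truncating `y` moves it in `‖·‖₂` by at most a multiple of its distance to the elements of
norm at most `c`. -/
theorem norm2_sub_truncation_le {c K η : ℝ} (hc : 0 < c) (hη : 0 < η) {q : ℝ[X]}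
    (h2 : ∀ t ∈ Set.Icc 0 (K ^ 2), |(1 - q.eval t)| ≤ 2)
    (h3 : ∀ t ∈ Set.Icc 0 (K ^ 2),
      0 ≤ (t - 4 * c ^ 2) * (1 - q.eval t) ^ 2 + 4 * c ^ 2 * η ^ 2)
    (x y : M.Carrier) (hx : ‖x‖ ≤ c) (hy : ‖y‖ ≤ K) :
    M.norm2 (x - y * aeval (star y * y) (q.map (algebraMap ℝ ℂ))) ≤
      5 * M.norm2 (x - y) + 2 * c * η := by
  set m : M.Carrier := 1 - aeval (star y * y) (q.map (algebraMap ℝ ℂ)) with hm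
  have hmc : (m : H →L[ℂ] H) = aeval (star (y : H →L[ℂ] H) * y) (1 - q) := by
    rw [map_sub, map_one]
    change (1 : H →L[ℂ] H) - ((aeval (star y * y) (q.map (algebraMap ℝ ℂ)) : M.Carrier) :
      H →L[ℂ] H) = _
    rw [coe_aeval]; rfl
  have hmn : ‖m‖ ≤ 2 := by
    change ‖(m : H →L[ℂ] H)‖ ≤ 2
    rw [hmc]
    exact norm_aeval_le hy (by norm_num) fun t ht => by simpa using h2 t ht
  -- The third property of the truncating polynomial, integrated against the spectral measure of y*y
  -- in the trace vector. It says that m = 1 - q(y*y) lives mostly where y*y ≥ 4c².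
  have hkey : 4 * c ^ 2 * M.norm2 m ^ 2 ≤ M.norm2 (y * m) ^ 2 + 4 * c ^ 2 * η ^ 2 := by
    have e1 : M.norm2 m ^ 2 = (⟪M.vec, aeval (star (y : H →L[ℂ] H) * y) ((1 - q) ^ 2)
        M.vec⟫_ℂ).re := by
      rw [← norm_sq_aeval_apply, ← hmc]; rfl
    have e2 : M.norm2 (y * m) ^ 2 = (⟪M.vec, aeval (star (y : H →L[ℂ] H) * y)
        (X * (1 - q) ^ 2) M.vec⟫_ℂ).re := by
      rw [← norm_sq_mul_aeval_apply, ← hmc]; rfl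
    have h := re_inner_aeval_nonneg (z := (y : H →L[ℂ] H)) hy
      (q := X * (1 - q) ^ 2 - (4 * c ^ 2) • (1 - q) ^ 2 + C (4 * c ^ 2 * η ^ 2))
      (fun t ht => by
        have := h3 t ht
        simp only [eval_add, eval_sub, eval_mul, eval_X, eval_pow, eval_one, eval_smul, eval_C,
          smul_eq_mul]
        linarith) M.vec
    rw [map_add, map_sub, map_smul, aeval_C, Algebra.algebraMap_eq_smul_one] at h
    simp only [add_apply, sub_apply, smul_apply, one_apply_eq_self, inner_sub_right,
      inner_add_right, Complex.add_re,
      Complex.sub_re, inner_smul_right_eq_smul, Complex.smul_re, smul_eq_mul,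
      re_inner_self_complex, M.norm_vec] at h
    rw [e1, e2]
    linarith
  have hn0 := M.norm2_nonneg m
  have hn1 := M.norm2_nonneg (y * m)
  have hkey' : 2 * c * M.norm2 m ≤ M.norm2 (y * m) + 2 * c * η := by
    refine abs_le_of_sq_le_sq' ?_ (by positivity) |>.2
    nlinarith [mul_nonneg hn1 (mul_nonneg hc.le hη.le)]
  have ha : M.norm2 (x * m) ≤ c * M.norm2 m :=
    (M.norm2_mul_le x m).trans (mul_le_mul_of_nonneg_right hx hn0)
  have hb : M.norm2 ((x - y) * m) ≤ 2 * M.norm2 (x - y) :=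
    (M.norm2_mul_le' _ _).trans (mul_le_mul_of_nonneg_right hmn (M.norm2_nonneg _))
  have hb' : M.norm2 (y * m) ≤ M.norm2 (x * m) + M.norm2 ((x - y) * m) := by
    have e : ((y * m : M.Carrier) : H →L[ℂ] H) M.vec =
        ((x * m : M.Carrier) : H →L[ℂ] H) M.vec -
          (((x - y) * m : M.Carrier) : H →L[ℂ] H) M.vec := by
      rw [sub_mul]
      exact (sub_sub_cancel (((x * m : M.Carrier) : H →L[ℂ] H) M.vec) _).symm
    change ‖_‖ ≤ ‖_‖ + ‖_‖
    rw [e]; exact norm_sub_le _ _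
  -- From 2c‖m‖₂ ≤ ‖ym‖₂ + 2cη and ‖ym‖₂ ≤ c‖m‖₂ + 2‖x - y‖₂ one gets ‖ym‖₂ ≤ 4‖x - y‖₂ + 2cη; the
  -- remaining summand x - y brings the constant to 5.
  have e : x - y * aeval (star y * y) (q.map (algebraMap ℝ ℂ)) = (x - y) + y * m := by
    rw [hm, mul_sub, mul_one]; abel
  rw [e]
  have := M.norm2_add_le (x - y) (y * m)
  linarith

end TracialVNA

/-! ### Tracial ultrapowers -/

namespace TracialVNA

variable {H : Type*} [NormedAddCommGroup H] [InnerProductSpace ℂ H] [CompleteSpace H]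
  (M : TracialVNA H)

theorem tr_add (x y : M.Carrier) : M.tr (x + y) = M.tr x + M.tr y :=
  inner_add_right M.vec ((x : H →L[ℂ] H) M.vec) ((y : H →L[ℂ] H) M.vec)

theorem tr_smul (c : ℂ) (x : M.Carrier) : M.tr (c • x) = c * M.tr x :=
  inner_smul_right M.vec ((x : H →L[ℂ] H) M.vec) c

theorem norm2_zero : M.norm2 0 = 0 := norm_zero

theorem norm2_sub_le (x y z : M.Carrier) :
    M.norm2 (x - z) ≤ M.norm2 (x - y) + M.norm2 (y - z) := by
  rw [← sub_add_sub_cancel x y z]; exact M.norm2_add_le _ _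

variable (ω : Ultrafilter ℕ)

/-- The quotient map from bounded sequences to the ultrapower. -/
noncomputable def ultraMkHom : (ℕ →ᵇ M.Carrier) →⋆ₐ[ℂ] M.Ultra ω where
  toFun := M.ultraMk ω
  map_one' := rfl
  map_mul' := M.ultraMk_mul ω
  map_zero' := rfl
  map_add' := M.ultraMk_add ω
  commutes' := M.ultraMk_algebraMap ω
  map_star' x := (M.star_ultraMk ω x).symm

theorem ultraMk_surjective : Function.Surjective (M.ultraMk ω) :=
  Ideal.Quotient.mk_surjective

theorem ultraMk_sub (x y : ℕ →ᵇ M.Carrier) :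
    M.ultraMk ω (x - y) = M.ultraMk ω x - M.ultraMk ω y := map_sub (M.ultraMkHom ω) x y

theorem ultraMk_one : M.ultraMk ω 1 = 1 := rfl

theorem ultraMk_eq_iff {x y : ℕ →ᵇ M.Carrier} :
    M.ultraMk ω x = M.ultraMk ω y ↔ Tendsto (fun n => M.norm2 (x n - y n)) ω (𝓝 0) :=
  Ideal.Quotient.mk_eq_mk_iff_sub_mem x y

variable {M}

/-- Bounded scalars converge along an ultrafilter, so the `limUnder` defining `ultraTr` is a genuine
limit and not a default value. All identities for `ultraTr` follow by passing to the limit. -/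
theorem tendsto_tr (x : ℕ →ᵇ M.Carrier) :
    Tendsto (fun n => M.tr (x n)) ω (𝓝 (M.ultraTr ω (M.ultraMk ω x))) := by
  obtain ⟨z, -, hz⟩ := (isCompact_closedBall (0 : ℂ) ‖x‖).ultrafilter_le_nhds
    (ω.map fun n => M.tr (x n)) (by
      refine le_principal_iff.2 (Filter.mem_map.2 (Filter.univ_mem' fun n => ?_))
      exact mem_closedBall_zero_iff.2
        (((M.norm_tr_le _).trans (M.norm2_le_norm _)).trans (x.norm_coe_le_norm n)))
  exact tendsto_nhds_limUnder ⟨z, hz⟩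

theorem tendsto_norm2 (x : ℕ →ᵇ M.Carrier) :
    Tendsto (fun n => M.norm2 (x n)) ω (𝓝 (M.ultraNorm2 ω (M.ultraMk ω x))) := by
  have h := (Real.continuous_sqrt.tendsto _).comp
    ((Complex.continuous_re.tendsto _).comp (tendsto_tr ω (star x * x)))
  refine h.congr fun n => ?_
  change √(M.tr (star (x n) * x n)).re = _
  rw [M.tr_star_mul_self, Complex.ofReal_re, Real.sqrt_sq (M.norm2_nonneg _)]

variable {ω}

theorem ultraNorm2_nonneg (x : M.Ultra ω) : 0 ≤ M.ultraNorm2 ω x := Real.sqrt_nonneg _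

theorem ultraNorm2_star (x : M.Ultra ω) : M.ultraNorm2 ω (star x) = M.ultraNorm2 ω x := by
  obtain ⟨x, rfl⟩ := M.ultraMk_surjective ω x
  rw [star_ultraMk]
  exact tendsto_nhds_unique (tendsto_norm2 ω _)
    ((tendsto_norm2 ω x).congr fun n => (M.norm2_star (x n)).symm)

theorem ultraNorm2_zero : M.ultraNorm2 ω 0 = 0 :=
  tendsto_nhds_unique (tendsto_norm2 ω 0) (tendsto_const_nhds.congr fun _ => M.norm2_zero.symm)

theorem ultraNorm2_neg (x : M.Ultra ω) : M.ultraNorm2 ω (-x) = M.ultraNorm2 ω x := by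
  unfold ultraNorm2; rw [star_neg, neg_mul_neg]

theorem ultraNorm2_sub_comm (x y : M.Ultra ω) :
    M.ultraNorm2 ω (x - y) = M.ultraNorm2 ω (y - x) := by
  rw [← neg_sub, ultraNorm2_neg]

theorem ultraNorm2_add_le (x y : M.Ultra ω) :
    M.ultraNorm2 ω (x + y) ≤ M.ultraNorm2 ω x + M.ultraNorm2 ω y := by
  obtain ⟨x, rfl⟩ := M.ultraMk_surjective ω x
  obtain ⟨y, rfl⟩ := M.ultraMk_surjective ω y
  exact le_of_tendsto_of_tendsto' (tendsto_norm2 ω (x + y))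
    ((tendsto_norm2 ω x).add (tendsto_norm2 ω y)) fun n => M.norm2_add_le _ _

theorem ultraNorm2_sub_le (x y z : M.Ultra ω) :
    M.ultraNorm2 ω (x - z) ≤ M.ultraNorm2 ω (x - y) + M.ultraNorm2 ω (y - z) := by
  rw [← sub_add_sub_cancel x y z]; exact ultraNorm2_add_le _ _

/-- `Ultra` is given no operator norm; the supremum norm of a representing sequence takes its place
in the estimates of products. -/
theorem ultraNorm2_mk_mul_le (x : ℕ →ᵇ M.Carrier) (y : M.Ultra ω) :
    M.ultraNorm2 ω (M.ultraMk ω x * y) ≤ ‖x‖ * M.ultraNorm2 ω y := by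
  obtain ⟨y, rfl⟩ := M.ultraMk_surjective ω y
  exact le_of_tendsto_of_tendsto' (tendsto_norm2 ω (x * y))
    ((tendsto_norm2 ω y).const_mul ‖x‖) fun n => (M.norm2_mul_le _ _).trans
      (mul_le_mul_of_nonneg_right (x.norm_coe_le_norm n) (M.norm2_nonneg _))

theorem ultraNorm2_mul_mk_le (x : M.Ultra ω) (y : ℕ →ᵇ M.Carrier) :
    M.ultraNorm2 ω (x * M.ultraMk ω y) ≤ ‖y‖ * M.ultraNorm2 ω x := by
  obtain ⟨x, rfl⟩ := M.ultraMk_surjective ω x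
  exact le_of_tendsto_of_tendsto' (tendsto_norm2 ω (x * y))
    ((tendsto_norm2 ω x).const_mul ‖y‖) fun n => (M.norm2_mul_le' _ _).trans
      (mul_le_mul_of_nonneg_right (y.norm_coe_le_norm n) (M.norm2_nonneg _))

theorem eq_of_ultraNorm2_sub_eq_zero {x y : M.Ultra ω} (h : M.ultraNorm2 ω (x - y) = 0) :
    x = y := by
  obtain ⟨x, rfl⟩ := M.ultraMk_surjective ω x
  obtain ⟨y, rfl⟩ := M.ultraMk_surjective ω y
  refine (M.ultraMk_eq_iff ω).2 ?_
  rw [← h]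
  exact tendsto_norm2 ω (x - y)

theorem ultraTr_add (x y : M.Ultra ω) :
    M.ultraTr ω (x + y) = M.ultraTr ω x + M.ultraTr ω y := by
  obtain ⟨x, rfl⟩ := M.ultraMk_surjective ω x
  obtain ⟨y, rfl⟩ := M.ultraMk_surjective ω y
  exact tendsto_nhds_unique (tendsto_tr ω (x + y))
    (((tendsto_tr ω x).add (tendsto_tr ω y)).congr fun n => (M.tr_add _ _).symm)

theorem ultraTr_smul (c : ℂ) (x : M.Ultra ω) : M.ultraTr ω (c • x) = c * M.ultraTr ω x := by
  obtain ⟨x, rfl⟩ := M.ultraMk_surjective ω x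
  exact tendsto_nhds_unique (tendsto_tr ω (c • x))
    (((tendsto_tr ω x).const_mul c).congr fun n => (M.tr_smul _ _).symm)

theorem ultraTr_sub (x y : M.Ultra ω) :
    M.ultraTr ω (x - y) = M.ultraTr ω x - M.ultraTr ω y := by
  rw [eq_sub_iff_add_eq, ← ultraTr_add, sub_add_cancel]

theorem norm_ultraTr_le (x : M.Ultra ω) : ‖M.ultraTr ω x‖ ≤ M.ultraNorm2 ω x := by
  obtain ⟨x, rfl⟩ := M.ultraMk_surjective ω x
  exact le_of_tendsto_of_tendsto' (tendsto_tr ω x).norm (tendsto_norm2 ω x)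
    fun n => M.norm_tr_le _

/-- Bounded sets of `M^ω` are complete in `‖·‖₂`, along sequences that converge fast. -/
theorem exists_ultra_limit (hω : (ω : Filter ℕ) ≤ cofinite) {C : ℝ} (t : ℕ → ℕ →ᵇ M.Carrier)
    (hC : ∀ k n, ‖t k n‖ ≤ C)
    (ht : ∀ k, M.ultraNorm2 ω (M.ultraMk ω (t k) - M.ultraMk ω (t (k + 1))) < (1 / 2) ^ k) :
    ∃ s : ℕ →ᵇ M.Carrier,
      ∀ k, M.ultraNorm2 ω (M.ultraMk ω (t k) - M.ultraMk ω s) ≤ 2 * (1 / 2) ^ k := by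
  classical
  let P : ℕ → ℕ → Prop := fun n k => ∀ j < k, M.norm2 (t j n - t (j + 1) n) < (1 / 2) ^ j
  have hP : ∀ k, ∀ᶠ n in (ω : Filter ℕ), P n k := by
    intro k
    refine (Set.finite_lt_nat k).eventually_all.2 fun j _ => ?_
    have h := tendsto_norm2 ω (t j - t (j + 1))
    rw [ultraMk_sub] at h
    exact h.eventually_lt_const (ht j)
  -- At index n the diagonal sequence uses the largest k ≤ n for which the first k estimates already
  -- hold at n. Since ω is free, k ≤ n for ω-almost every n, so κ exceeds every fixed k along ω.
  let κ : ℕ → ℕ := fun n => Nat.findGreatest (P n) n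
  refine ⟨BoundedContinuousFunction.ofNormedAddCommGroupDiscrete (fun n => t (κ n) n) C
    fun n => hC _ _, fun k => ?_⟩
  rw [← ultraMk_sub]
  refine le_of_tendsto (tendsto_norm2 ω _) ?_
  have hk : ∀ᶠ n in (ω : Filter ℕ), k ≤ n :=
    hω (by rw [Nat.cofinite_eq_atTop]; exact eventually_ge_atTop k)
  filter_upwards [hP k, hk] with n h1 h2
  have hκ : k ≤ κ n := Nat.le_findGreatest h2 h1
  have hPκ : P n (κ n) := Nat.findGreatest_spec (P := P n) h2 h1
  -- The right side is the geometric sum of (1/2)^j over k ≤ j < l.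
  have key : ∀ l, k ≤ l → l ≤ κ n →
      M.norm2 (t k n - t l n) ≤ 2 * (1 / 2) ^ k - 2 * (1 / 2) ^ l := by
    intro l hl
    induction l, hl using Nat.le_induction with
    | base => intro _; simp [norm2_zero]
    | succ l hl ih =>
      intro hlκ
      have h := M.norm2_sub_le (t k n) (t l n) (t (l + 1) n)
      have h' := hPκ l (by omega)
      have e : (2 : ℝ) * (1 / 2) ^ (l + 1) = (1 / 2) ^ l := by rw [pow_succ]; ring
      have := ih (by omega)
      linarith
  refine (key _ hκ le_rfl).trans ?_
  have : (0 : ℝ) ≤ (1 / 2) ^ κ n := by positivity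
  linarith

end TracialVNA


/-! ### Extending trace preserving isomorphisms to the `‖·‖₂`-closure -/

section Extension

open TracialVNA Polynomial

variable {H K : Type*} [NormedAddCommGroup H] [InnerProductSpace ℂ H] [CompleteSpace H]
  [NormedAddCommGroup K] [InnerProductSpace ℂ K] [CompleteSpace K]
  {M : TracialVNA H} {N : TracialVNA K} {ω : Ultrafilter ℕ}

/-- Evaluation of bounded sequences at an index. -/
noncomputable def evalSeq (M : TracialVNA H) (n : ℕ) : (ℕ →ᵇ M.Carrier) →ₐ[ℂ] M.Carrier where
  toFun x := x n
  map_one' := rfl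
  map_mul' _ _ := rfl
  map_zero' := rfl
  map_add' _ _ := rfl
  commutes' _ := rfl

theorem truncation_apply (y : ℕ →ᵇ M.Carrier) (q : ℂ[X]) (n : ℕ) :
    (y * aeval (star y * y) q) n = y n * aeval (star (y n) * y n) q :=
  congrArg (y n * ·) (Polynomial.aeval_algHom_apply (evalSeq M n) (star y * y) q).symm

theorem ultraMk_truncation (y : ℕ →ᵇ M.Carrier) (q : ℂ[X]) :
    M.ultraMk ω (y * aeval (star y * y) q) =
      M.ultraMk ω y * aeval (star (M.ultraMk ω y) * M.ultraMk ω y) q := by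
  rw [ultraMk_mul, star_ultraMk, ← ultraMk_mul]
  exact congrArg (M.ultraMk ω y * ·)
    (Polynomial.aeval_algHom_apply (M.ultraMkHom ω) (star y * y) q).symm

/-- The truncation of a pair of elements by one polynomial. -/
theorem exists_truncated_pair (G : StarSubalgebra ℂ (M.Ultra ω × N.Ultra ω))
    {c : ℝ} (hc : 0 < c) (x : ℕ →ᵇ M.Carrier) (hx : ∀ n, ‖x n‖ ≤ c)
    {p : M.Ultra ω × N.Ultra ω} (hp : p ∈ G) {δ : ℝ} (hδ : 0 < δ)
    (hxp : M.ultraNorm2 ω (M.ultraMk ω x - p.1) < δ) :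
    ∃ (r : M.Ultra ω) (w : ℕ →ᵇ N.Carrier), (r, N.ultraMk ω w) ∈ G ∧
      (∀ n, ‖w n‖ ≤ 2 * c + 1) ∧ M.ultraNorm2 ω (M.ultraMk ω x - r) ≤ 6 * δ := by
  obtain ⟨y, hy⟩ := M.ultraMk_surjective ω p.1
  obtain ⟨z, hz⟩ := N.ultraMk_surjective ω p.2
  set L := max 1 (max ‖y‖ ‖z‖) with hL
  -- With this η the truncation error 5δ + 2cη is at most 6δ.
  have hη : 0 < min 1 (δ / (2 * c)) := by positivity
  obtain ⟨q, h1, h2, h3⟩ := exists_truncation (c := c) (K := L) hc hη (min_le_left _ _)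
    (le_max_left _ _)
  set Q := q.map (algebraMap ℝ ℂ)
  have hyL : ∀ n, ‖y n‖ ≤ L := fun n => (y.norm_coe_le_norm n).trans
    ((le_max_left _ _).trans (le_max_right _ _))
  have hzL : ∀ n, ‖z n‖ ≤ L := fun n => (z.norm_coe_le_norm n).trans
    ((le_max_right _ _).trans (le_max_right _ _))
  have hcη : 2 * c * min 1 (δ / (2 * c)) ≤ δ := by
    calc 2 * c * min 1 (δ / (2 * c)) ≤ 2 * c * (δ / (2 * c)) := by
          gcongr; exact min_le_right _ _
      _ = δ := by field_simp
  refine ⟨M.ultraMk ω (y * aeval (star y * y) Q), z * aeval (star z * z) Q, ?_, fun n => ?_, ?_⟩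
  -- The same polynomial truncates both components, so the truncated pair is a polynomial expression
  -- in p and star p and stays in G.
  · have hQ : p * aeval (star p * p) Q ∈ G := by
      refine mul_mem hp ?_
      exact Algebra.adjoin_le (S := G.toSubalgebra)
        (Set.singleton_subset_iff.2 (show star p * p ∈ G from mul_mem (star_mem hp) hp))
        (Polynomial.aeval_mem_adjoin_singleton ℂ (star p * p))
    have e1 := (Polynomial.aeval_algHom_apply (AlgHom.fst ℂ (M.Ultra ω) (N.Ultra ω))
      (star p * p) Q).symm
    have e2 := (Polynomial.aeval_algHom_apply (AlgHom.snd ℂ (M.Ultra ω) (N.Ultra ω))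
      (star p * p) Q).symm
    convert hQ using 1
    rw [ultraMk_truncation, ultraMk_truncation, hy, hz]
    exact Prod.ext (congrArg (p.1 * ·) e1.symm) (congrArg (p.2 * ·) e2.symm)
  · rw [truncation_apply]
    exact norm_truncation_le N hc h1 (z n) (hzL n)
  · rw [← ultraMk_sub]
    have hy' : Tendsto (fun n => 5 * M.norm2 (x n - y n) + 2 * c * min 1 (δ / (2 * c))) ω
        (𝓝 (5 * M.ultraNorm2 ω (M.ultraMk ω (x - y)) + 2 * c * min 1 (δ / (2 * c)))) :=
      ((tendsto_norm2 ω (x - y)).const_mul 5).add_const _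
    refine (le_of_tendsto_of_tendsto' (tendsto_norm2 ω _) hy' fun n => ?_).trans ?_
    · rw [BoundedContinuousFunction.sub_apply, truncation_apply]
      exact norm2_sub_truncation_le M hc hη h2 h3 (x n) (y n) (hx n) (hyL n)
    · rw [ultraMk_sub, hy]; linarith

/-- The pairs that are `‖·‖₂`-limits of pairs in `G`. -/
noncomputable def closureRel (G : StarSubalgebra ℂ (M.Ultra ω × N.Ultra ω)) :
    StarSubalgebra ℂ (M.Ultra ω × N.Ultra ω) where
  carrier := {p | ∀ ε > 0, ∃ r ∈ G, M.ultraNorm2 ω (p.1 - r.1) < ε ∧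
    N.ultraNorm2 ω (p.2 - r.2) < ε}
  mul_mem' := by
    intro p p' hp hp' ε hε
    obtain ⟨x, hx⟩ := M.ultraMk_surjective ω p.1
    obtain ⟨z, hz⟩ := N.ultraMk_surjective ω p.2
    -- Multiplication is ‖·‖₂-continuous only against bounded factors: r' is chosen first, against
    -- representatives of p, and r afterwards, against representatives of r'.
    obtain ⟨r', hr', h1, h2⟩ := hp' (ε / (2 * (‖x‖ + ‖z‖ + 1))) (by positivity)
    obtain ⟨x', hx'⟩ := M.ultraMk_surjective ω r'.1
    obtain ⟨z', hz'⟩ := N.ultraMk_surjective ω r'.2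
    obtain ⟨r, hr, h3, h4⟩ := hp (ε / (2 * (‖x'‖ + ‖z'‖ + 1))) (by positivity)
    have est : ∀ {a b t : ℝ}, 0 ≤ a → 0 ≤ b → t < ε / (2 * (a + b + 1)) →
        a * t < ε / 2 ∧ b * t < ε / 2 := by
      intro a b t ha hb ht
      rw [lt_div_iff₀ (by positivity)] at ht
      have hε' : (0 : ℝ) < ε := hε
      constructor
      · rcases le_or_gt t 0 with h | h
        · nlinarith
        · nlinarith
      · rcases le_or_gt t 0 with h | h
        · nlinarith
        · nlinarith
    refine ⟨r * r', mul_mem hr hr', ?_, ?_⟩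
    · rw [Prod.fst_mul, Prod.fst_mul,
        show p.1 * p'.1 - r.1 * r'.1 = p.1 * (p'.1 - r'.1) + (p.1 - r.1) * r'.1 by
          rw [mul_sub, sub_mul]; abel]
      refine (ultraNorm2_add_le _ _).trans_lt ?_
      rw [← hx]
      nth_rewrite 2 [← hx']
      have e1 := ultraNorm2_mk_mul_le x (p'.1 - r'.1)
      have e2 := ultraNorm2_mul_mk_le (M.ultraMk ω x - r.1) x'
      rw [← hx] at h3
      linarith [(est (norm_nonneg _) (norm_nonneg _) h1).1,
        (est (norm_nonneg _) (norm_nonneg _) h3).1]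
    · rw [Prod.snd_mul, Prod.snd_mul,
        show p.2 * p'.2 - r.2 * r'.2 = p.2 * (p'.2 - r'.2) + (p.2 - r.2) * r'.2 by
          rw [mul_sub, sub_mul]; abel]
      refine (ultraNorm2_add_le _ _).trans_lt ?_
      rw [← hz]
      nth_rewrite 2 [← hz']
      have e1 := ultraNorm2_mk_mul_le z (p'.2 - r'.2)
      have e2 := ultraNorm2_mul_mk_le (N.ultraMk ω z - r.2) z'
      rw [← hz] at h4
      linarith [(est (norm_nonneg _) (norm_nonneg _) h2).2,
        (est (norm_nonneg _) (norm_nonneg _) h4).2]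
  add_mem' := by
    intro p p' hp hp' ε hε
    obtain ⟨r, hr, h1, h2⟩ := hp (ε / 2) (half_pos hε)
    obtain ⟨r', hr', h3, h4⟩ := hp' (ε / 2) (half_pos hε)
    refine ⟨r + r', add_mem hr hr', ?_, ?_⟩
    · rw [Prod.fst_add, Prod.fst_add, add_sub_add_comm]
      linarith [ultraNorm2_add_le (p.1 - r.1) (p'.1 - r'.1)]
    · rw [Prod.snd_add, Prod.snd_add, add_sub_add_comm]
      linarith [ultraNorm2_add_le (p.2 - r.2) (p'.2 - r'.2)]
  algebraMap_mem' := fun c ε hε => ⟨algebraMap ℂ _ c, G.algebraMap_mem c, by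
    rwa [sub_self, ultraNorm2_zero], by rwa [sub_self, ultraNorm2_zero]⟩
  star_mem' := by
    intro p hp ε hε
    obtain ⟨r, hr, h1, h2⟩ := hp ε hε
    refine ⟨star r, star_mem hr, ?_, ?_⟩
    · rwa [Prod.fst_star, Prod.fst_star, ← star_sub, ultraNorm2_star]
    · rwa [Prod.snd_star, Prod.snd_star, ← star_sub, ultraNorm2_star]

theorem le_closureRel (G : StarSubalgebra ℂ (M.Ultra ω × N.Ultra ω)) : G ≤ closureRel G :=
  fun p hp ε hε => ⟨p, hp, by rwa [sub_self, ultraNorm2_zero],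
    by rwa [sub_self, ultraNorm2_zero]⟩

variable {G : StarSubalgebra ℂ (M.Ultra ω × N.Ultra ω)}

theorem ultraTr_eq_of_mem_closureRel (hG : ∀ p ∈ G, M.ultraTr ω p.1 = N.ultraTr ω p.2)
    {p : M.Ultra ω × N.Ultra ω} (hp : p ∈ closureRel G) :
    M.ultraTr ω p.1 = N.ultraTr ω p.2 := by
  rw [← sub_eq_zero, ← norm_le_zero_iff]
  refine le_of_forall_pos_le_add fun ε hε => ?_
  obtain ⟨r, hr, h1, h2⟩ := hp (ε / 2) (half_pos hε)
  have e : M.ultraTr ω p.1 - N.ultraTr ω p.2 =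
      M.ultraTr ω (p.1 - r.1) - N.ultraTr ω (p.2 - r.2) := by
    rw [ultraTr_sub, ultraTr_sub, hG r hr]; ring
  rw [e]
  have := norm_sub_le (M.ultraTr ω (p.1 - r.1)) (N.ultraTr ω (p.2 - r.2))
  have := norm_ultraTr_le (p.1 - r.1)
  have := norm_ultraTr_le (p.2 - r.2)
  linarith

theorem ultraNorm2_eq_of_mem_closureRel (hG : ∀ p ∈ G, M.ultraTr ω p.1 = N.ultraTr ω p.2)
    {p : M.Ultra ω × N.Ultra ω} (hp : p ∈ closureRel G) :
    M.ultraNorm2 ω p.1 = N.ultraNorm2 ω p.2 := by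
  have h := ultraTr_eq_of_mem_closureRel hG (mul_mem (star_mem hp) hp)
  unfold ultraNorm2
  rw [show star p.1 * p.1 = (star p * p).1 from rfl, h]
  rfl

/-- Preservation of the trace makes the relation isometric for ‖·‖₂, and the pair (0, y - y')
belongs to it. Together with the mirror statement, the closure of a trace preserving graph is the
graph of a bijection. -/
theorem closureRel_right_unique (hG : ∀ p ∈ G, M.ultraTr ω p.1 = N.ultraTr ω p.2)
    {x : M.Ultra ω} {y y' : N.Ultra ω} (h : (x, y) ∈ closureRel G)
    (h' : (x, y') ∈ closureRel G) : y = y' := by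
  have h1 := ultraNorm2_eq_of_mem_closureRel hG (sub_mem h h')
  refine eq_of_ultraNorm2_sub_eq_zero ?_
  rw [Prod.mk_sub_mk, sub_self, ultraNorm2_zero] at h1
  exact h1.symm

theorem closureRel_left_unique (hG : ∀ p ∈ G, M.ultraTr ω p.1 = N.ultraTr ω p.2)
    {x x' : M.Ultra ω} {y : N.Ultra ω} (h : (x, y) ∈ closureRel G)
    (h' : (x', y) ∈ closureRel G) : x = x' := by
  have h1 := ultraNorm2_eq_of_mem_closureRel hG (sub_mem h h')
  refine eq_of_ultraNorm2_sub_eq_zero ?_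
  rw [Prod.mk_sub_mk, sub_self, ultraNorm2_zero] at h1
  exact h1

/-- Every `‖·‖₂`-limit of first components of `G` is a first component of `closureRel G`. -/
theorem exists_mem_closureRel (hω : (ω : Filter ℕ) ≤ cofinite)
    (hG : ∀ p ∈ G, M.ultraTr ω p.1 = N.ultraTr ω p.2) {x : M.Ultra ω}
    (hx : ∀ ε > 0, ∃ p ∈ G, M.ultraNorm2 ω (x - p.1) < ε) :
    ∃ y, (x, y) ∈ closureRel G := by
  obtain ⟨x, rfl⟩ := M.ultraMk_surjective ω x
  have h : ∀ k : ℕ, ∃ (r : M.Ultra ω) (w : ℕ →ᵇ N.Carrier), (r, N.ultraMk ω w) ∈ G ∧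
      (∀ n, ‖w n‖ ≤ 2 * (‖x‖ + 1) + 1) ∧
      M.ultraNorm2 ω (M.ultraMk ω x - r) ≤ (1 / 2) * ((1 / 2) * (1 / 2) ^ k) := by
    intro k
    -- Truncation multiplies the error by 6, giving (1/4)(1/2)^k; two consecutive errors then add up
    -- to less than (1/2)^k, as `exists_ultra_limit` requires. The bounds on the w k do not depend
    -- on k.
    obtain ⟨p, hp, hxp⟩ := hx ((1 / 24) * (1 / 2) ^ k) (by positivity)
    obtain ⟨r, w, h1, h2, h3⟩ := exists_truncated_pair G (c := ‖x‖ + 1) (by positivity) x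
      (fun n => (x.norm_coe_le_norm n).trans (by linarith)) hp (by positivity) hxp
    exact ⟨r, w, h1, h2, h3.trans (by linarith)⟩
  choose r w h1 h2 h3 using h
  obtain ⟨s, hs⟩ := exists_ultra_limit hω w h2 (fun k => by
    have e := ultraNorm2_eq_of_mem_closureRel hG
      (le_closureRel G (sub_mem (h1 k) (h1 (k + 1))))
    change M.ultraNorm2 ω (r k - r (k + 1)) = _ at e
    change N.ultraNorm2 ω ((r k, N.ultraMk ω (w k)) - (r (k + 1), N.ultraMk ω (w (k + 1)))).2 < _
    rw [← e]
    have := ultraNorm2_sub_le (r k) (M.ultraMk ω x) (r (k + 1))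
    rw [ultraNorm2_sub_comm (r k) (M.ultraMk ω x)] at this
    have h4 := h3 k
    have h5 := h3 (k + 1)
    rw [pow_succ] at h5
    have : (0 : ℝ) < (1 / 2) ^ k := by positivity
    linarith)
  refine ⟨N.ultraMk ω s, fun ε hε => ?_⟩
  obtain ⟨k, hk⟩ := exists_pow_lt_of_lt_one (half_pos hε) (by norm_num : (1 / 2 : ℝ) < 1)
  have hk0 : (0 : ℝ) < (1 / 2) ^ k := by positivity
  refine ⟨_, h1 k, ?_, ?_⟩
  · have := h3 k
    change M.ultraNorm2 ω (M.ultraMk ω x - r k) < ε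
    linarith
  · have := hs k
    change N.ultraNorm2 ω (N.ultraMk ω s - N.ultraMk ω (w k)) < ε
    rw [ultraNorm2_sub_comm]
    linarith

/-- The coordinate swap of a subalgebra of a product. -/
noncomputable def swapSubalgebra (G : StarSubalgebra ℂ (M.Ultra ω × N.Ultra ω)) :
    StarSubalgebra ℂ (N.Ultra ω × M.Ultra ω) :=
  G.comap ((StarAlgHom.snd ℂ (N.Ultra ω) (M.Ultra ω)).prod
    (StarAlgHom.fst ℂ (N.Ultra ω) (M.Ultra ω)))

theorem exists_mem_closureRel' (hω : (ω : Filter ℕ) ≤ cofinite)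
    (hG : ∀ p ∈ G, M.ultraTr ω p.1 = N.ultraTr ω p.2) {y : N.Ultra ω}
    (hy : ∀ ε > 0, ∃ p ∈ G, N.ultraNorm2 ω (y - p.2) < ε) :
    ∃ x, (x, y) ∈ closureRel G := by
  obtain ⟨x, hx⟩ := exists_mem_closureRel (G := swapSubalgebra G) hω
    (fun p hp => (hG _ hp).symm) (x := y) (fun ε hε => by
      obtain ⟨p, hp, h⟩ := hy ε hε
      exact ⟨(p.2, p.1), hp, h⟩)
  refine ⟨x, fun ε hε => ?_⟩
  obtain ⟨r, hr, h1, h2⟩ := hx ε hε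
  exact ⟨(r.2, r.1), hr, h2, h1⟩

/-- A trace preserving `*`-isomorphism between `*`-subalgebras of two ultrapowers, given by its
graph `G`, extends to the `‖·‖₂`-closures. -/
theorem exists_traceIso_of_graph (hω : (ω : Filter ℕ) ≤ cofinite)
    (hG : ∀ p ∈ G, M.ultraTr ω p.1 = N.ultraTr ω p.2)
    (C : StarSubalgebra ℂ (M.Ultra ω)) (D : StarSubalgebra ℂ (N.Ultra ω))
    (hC : ∀ x, x ∈ C ↔ ∀ ε > 0, ∃ p ∈ G, M.ultraNorm2 ω (x - p.1) < ε)
    (hD : ∀ y, y ∈ D ↔ ∀ ε > 0, ∃ p ∈ G, N.ultraNorm2 ω (y - p.2) < ε) :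
    ∃ Θ : TraceIso (fun x : C => M.ultraTr ω x) (fun y : D => N.ultraTr ω y),
      ∀ (x : C) (y : N.Ultra ω), ((x : M.Ultra ω), y) ∈ G → (Θ x : N.Ultra ω) = y := by
  have hf : ∀ x : C, ∃ y : D, ((x : M.Ultra ω), (y : N.Ultra ω)) ∈ closureRel G := by
    intro x
    obtain ⟨y, hy⟩ := exists_mem_closureRel hω hG ((hC x).1 x.2)
    exact ⟨⟨y, (hD y).2 fun ε hε => (hy ε hε).imp fun _ h => ⟨h.1, h.2.2⟩⟩, hy⟩
  have hg : ∀ y : D, ∃ x : C, ((x : M.Ultra ω), (y : N.Ultra ω)) ∈ closureRel G := by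
    intro y
    obtain ⟨x, hx⟩ := exists_mem_closureRel' hω hG ((hD y).1 y.2)
    exact ⟨⟨x, (hC x).2 fun ε hε => (hx ε hε).imp fun _ h => ⟨h.1, h.2.1⟩⟩, hx⟩
  choose f hf using hf
  choose g hg using hg
  -- As `closureRel G` is a *-subalgebra of the product, every algebraic identity for f reduces to
  -- uniqueness of the second component.
  have huniq : ∀ (x : C) (y : D), ((x : M.Ultra ω), (y : N.Ultra ω)) ∈ closureRel G →
      f x = y := fun x y h => Subtype.ext (closureRel_right_unique hG (hf x) h)
  have hmul : ∀ x y, f (x * y) = f x * f y := fun x y => huniq _ _ (by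
    have h := mul_mem (hf x) (hf y)
    rwa [Prod.mk_mul_mk] at h)
  have hadd : ∀ x y, f (x + y) = f x + f y := fun x y => huniq _ _ (by
    have h := add_mem (hf x) (hf y)
    rwa [Prod.mk_add_mk] at h)
  have hstar : ∀ x, f (star x) = star (f x) := fun x => huniq _ _ (star_mem (hf x))
  have hsmul : ∀ (c : ℂ) x, f (c • x) = c • f x := fun c x => huniq _ _ (by
    have h := (closureRel G).smul_mem (hf x) c
    rwa [Prod.smul_mk] at h)
  refine ⟨{
    toFun := f
    invFun := g
    left_inv := fun x => Subtype.ext (closureRel_left_unique hG (hg (f x)) (hf x))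
    right_inv := fun y => huniq _ _ (hg y)
    map_mul' := hmul
    map_add' := hadd
    map_star' := hstar
    map_smul' := hsmul
    trace_map := fun x => (ultraTr_eq_of_mem_closureRel hG (hf x)).symm }, fun x y h => ?_⟩
  exact closureRel_right_unique hG (hf x) (le_closureRel G h)

end Extension


/-! ### Functions and canonical unitaries in the von Neumann algebra of an orbit relation -/

theorem bddMeasurable_indicator {Z : Type*} [MeasurableSpace Z] {s : Set Z}
    (hs : MeasurableSet s) : BddMeasurable (s.indicator fun _ => (1 : ℂ)) :=
  ⟨measurable_const.indicator hs, 1, fun z => by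
    by_cases h : z ∈ s <;> simp [h]⟩

theorem BddMeasurable.smul {Z : Type*} [MeasurableSpace Z] {F : Z → ℂ} (hF : BddMeasurable F)
    (c : ℂ) : BddMeasurable (c • F) :=
  (bddMeasurable_const c).mul hF

theorem BddMeasurable.sub {Z : Type*} [MeasurableSpace Z] {F G : Z → ℂ} (hF : BddMeasurable F)
    (hG : BddMeasurable G) : BddMeasurable (F - G) := by
  have h := hF.add (hG.smul (-1))
  rwa [neg_one_smul, ← sub_eq_add_neg] at h

theorem BddMeasurable.integrable {Z : Type*} [MeasurableSpace Z] {F : Z → ℂ}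
    (hF : BddMeasurable F) (m : Measure Z) [IsFiniteMeasure m] : Integrable F m :=
  (hF.memLp m).integrable le_top

section OrbitAlgebra

variable (Γ : Type*) [Group Γ] {X : Type*} [MeasurableSpace X] [MulAction Γ X]
  (μ : Measure X) [MeasurableConstSMul Γ X]

theorem map_graph_le_orbitMeasure (g : Γ) :
    (μ.map fun x => (x, g • x)) ≤ orbitMeasure Γ μ :=
  le_iSup (fun g : Γ => μ.map fun x => (x, g • x)) g

theorem measurableSet_graph [MeasurableEq X] (g : Γ) :
    MeasurableSet {z : X × X | z.2 = g • z.1} :=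
  (measurable_snd.prodMk (measurable_fst.const_smul g)) (measurableSet_diagonal (α := X))

/-- The images of μ under the graph maps agree wherever two graphs meet, so on the graph of g the
image under g dominates all the others. Inner products of vectors carried by one graph thereby
become integrals over X. -/
theorem restrict_orbitMeasure_graph [MeasurableEq X] (g : Γ) :
    (orbitMeasure Γ μ).restrict {z : X × X | z.2 = g • z.1} = μ.map fun x => (x, g • x) := by
  have hD := measurableSet_graph (X := X) Γ g
  have hle : orbitMeasure Γ μ ≤ (μ.map fun x => (x, g • x)) +
      (orbitMeasure Γ μ).restrict {z : X × X | z.2 = g • z.1}ᶜ := by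
    refine iSup_le fun h => ?_
    rw [← Measure.restrict_add_restrict_compl (μ := μ.map fun x => (x, h • x)) hD]
    refine add_le_add ?_ (Measure.restrict_mono le_rfl (map_graph_le_orbitMeasure Γ μ h))
    refine Measure.le_iff.2 fun C hC => ?_
    rw [Measure.restrict_apply hC, Measure.map_apply (measurable_graph Γ h) (hC.inter hD),
      Measure.map_apply (measurable_graph Γ g) hC]
    refine measure_mono ?_
    rintro x ⟨hx, hx'⟩
    have hx'' : h • x = g • x := hx'
    change (x, g • x) ∈ C
    rw [← hx'']; exact hx
  refine le_antisymm ?_ ?_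
  · refine Measure.le_iff.2 fun C hC => ?_
    rw [Measure.restrict_apply hC]
    refine (hle _).trans ?_
    rw [Measure.add_apply, Measure.restrict_apply (hC.inter hD)]
    rw [Set.inter_assoc, Set.inter_compl_self, Set.inter_empty, measure_empty, add_zero]
    exact measure_mono Set.inter_subset_left
  · refine Measure.le_iff.2 fun C hC => ?_
    rw [Measure.restrict_apply hC]
    refine le_trans (le_of_eq ?_) (map_graph_le_orbitMeasure Γ μ g _)
    rw [Measure.map_apply (measurable_graph Γ g) hC,
      Measure.map_apply (measurable_graph Γ g) (hC.inter hD)]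
    congr 1
    ext x
    simp

/-- The supremum defining the measure is dominated by the sum over the countable group, so null sets
can be tested one graph at a time. -/
theorem ae_orbitMeasure [Countable Γ] {p : X × X → Prop} (hp : MeasurableSet {z | p z})
    (h : ∀ g : Γ, ∀ᵐ x ∂μ, p (x, g • x)) : ∀ᵐ z ∂orbitMeasure Γ μ, p z := by
  have hle : orbitMeasure Γ μ ≤ Measure.sum fun g : Γ => μ.map fun x => (x, g • x) :=
    iSup_le fun g => Measure.le_sum _ g
  refine (Measure.absolutelyContinuous_of_le hle).ae_le ?_
  refine Measure.ae_sum_iff.2 fun g => ?_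
  exact (ae_map_iff (measurable_graph Γ g).aemeasurable hp).2 (h g)

theorem quasiMeasurePreserving_fst_orbitMeasure [Countable Γ] :
    Measure.QuasiMeasurePreserving Prod.fst (orbitMeasure Γ μ) μ := by
  refine ⟨measurable_fst, Measure.AbsolutelyContinuous.mk fun s hs h0 => ?_⟩
  rw [Measure.map_apply measurable_fst hs]
  have h : ∀ᵐ z ∂orbitMeasure Γ μ, z.1 ∉ s :=
    ae_orbitMeasure Γ μ (measurable_fst hs.compl) fun _ => measure_eq_zero_iff_ae_notMem.1 h0
  exact measure_eq_zero_iff_ae_notMem.2 h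

variable [SMulInvariantMeasure Γ X μ]

theorem leftShift_mul (g h : Γ) :
    leftShift Γ μ g * leftShift Γ μ h = leftShift Γ μ (g * h) := by
  ext1 ξ
  apply Lp.ext
  have h1 := (measurePreserving_smul_fst Γ μ g⁻¹).quasiMeasurePreserving.ae_eq_comp
    (leftShift_coe Γ μ h ξ)
  refine (leftShift_coe Γ μ g _).trans (h1.trans ?_)
  refine EventuallyEq.trans (Eventually.of_forall fun z => ?_) (leftShift_coe Γ μ (g * h) ξ).symm
  simp [Function.comp, mul_smul]

theorem leftShift_one : leftShift Γ μ 1 = 1 := by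
  ext1 ξ
  apply Lp.ext
  refine (leftShift_coe Γ μ 1 _).trans (Eventually.of_forall fun z => ?_)
  simp

/-- The algebra of the relation sees group elements only as point maps: f u_g depends on g only
through x ↦ g⁻¹x on the support of f. This is what permits non-free actions and replacing one group
element by another on a piece of the space. -/
theorem mulOp_fst_mul_leftShift_congr [Countable Γ] {f f' : X → ℂ} (hf : BddMeasurable f)
    (hf' : BddMeasurable f') {g h : Γ}
    (H : ∀ᵐ x ∂μ, f x = f' x ∧ (f x ≠ 0 → g⁻¹ • x = h⁻¹ • x)) :
    mulOp (orbitMeasure Γ μ) (hf.comp measurable_fst) * leftShift Γ μ g =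
      mulOp (orbitMeasure Γ μ) (hf'.comp measurable_fst) * leftShift Γ μ h := by
  ext1 ξ
  apply Lp.ext
  filter_upwards [(quasiMeasurePreserving_fst_orbitMeasure Γ μ).ae H,
    mulOp_coe (orbitMeasure Γ μ) (hf.comp measurable_fst) (leftShift Γ μ g ξ),
    mulOp_coe (orbitMeasure Γ μ) (hf'.comp measurable_fst) (leftShift Γ μ h ξ),
    leftShift_coe Γ μ g ξ, leftShift_coe Γ μ h ξ] with z h0 h1 h2 h3 h4
  refine h1.trans (Eq.trans ?_ h2.symm)
  rw [h3, h4]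
  simp only [Function.comp]
  rw [← h0.1]
  by_cases hz : f z.1 = 0
  · simp [hz]
  · rw [h0.2 hz]

variable [MeasurableEq X] [IsProbabilityMeasure μ]

variable {Γ μ}

/-- A bounded measurable function, as an element of the Cartan subalgebra. -/
noncomputable def fn {f : X → ℂ} (hf : BddMeasurable f) : cartan Γ μ :=
  ⟨⟨mulOp (orbitMeasure Γ μ) (hf.comp measurable_fst),
    subset_vonNeumannGenerated _ (Or.inl ⟨f, hf, rfl⟩)⟩, ⟨f, hf, rfl⟩⟩

theorem exists_eq_fn (a : cartan Γ μ) : ∃ (f : X → ℂ) (hf : BddMeasurable f), a = fn hf := by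
  obtain ⟨a, f, hf, h⟩ := a
  exact ⟨f, hf, Subtype.ext (Subtype.ext h)⟩

theorem fn_mul {f g : X → ℂ} (hf : BddMeasurable f) (hg : BddMeasurable g) :
    (fn (hf.mul hg) : cartan Γ μ) = fn hf * fn hg :=
  Subtype.ext (Subtype.ext (mulOp_mul _ (hf.comp measurable_fst) (hg.comp measurable_fst)).symm)

theorem fn_add {f g : X → ℂ} (hf : BddMeasurable f) (hg : BddMeasurable g) :
    (fn (hf.add hg) : cartan Γ μ) = fn hf + fn hg :=
  Subtype.ext (Subtype.ext (mulOp_add _ (hf.comp measurable_fst) (hg.comp measurable_fst)).symm)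

theorem fn_const (c : ℂ) : (fn (bddMeasurable_const c) : cartan Γ μ) = algebraMap ℂ _ c :=
  Subtype.ext (Subtype.ext (mulOp_const _ _))

theorem fn_star {f : X → ℂ} (hf : BddMeasurable f) :
    (fn hf.star : cartan Γ μ) = star (fn hf) :=
  Subtype.ext (Subtype.ext (star_mulOp _ (hf.comp measurable_fst)).symm)

theorem cartan_mul_comm (a b : cartan Γ μ) : a * b = b * a := by
  obtain ⟨f, hf, rfl⟩ := exists_eq_fn a
  obtain ⟨g, hg, rfl⟩ := exists_eq_fn b
  rw [← fn_mul, ← fn_mul]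
  congr 1
  exact mul_comm f g

theorem canonicalUnitary_mul (g h : Γ) :
    canonicalUnitary Γ μ g * canonicalUnitary Γ μ h = canonicalUnitary Γ μ (g * h) :=
  Subtype.ext (leftShift_mul Γ μ g h)

theorem canonicalUnitary_one : canonicalUnitary Γ μ 1 = 1 :=
  Subtype.ext (leftShift_one Γ μ)

theorem fn_comp_inv {f : X → ℂ} (hf : BddMeasurable f) (g : Γ) :
    ((fn (hf.comp (measurable_const_smul g⁻¹)) : cartan Γ μ) : (orbitVNA Γ μ).Carrier) =
      canonicalUnitary Γ μ g * (fn hf : cartan Γ μ) * canonicalUnitary Γ μ g⁻¹ :=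
  Subtype.ext (leftShift_mul_mulOp Γ μ g hf).symm

theorem canonicalUnitary_mul_fn {f : X → ℂ} (hf : BddMeasurable f) (g : Γ) :
    canonicalUnitary Γ μ g * (fn hf : cartan Γ μ) =
      (fn (hf.comp (measurable_const_smul g⁻¹)) : cartan Γ μ) * canonicalUnitary Γ μ g := by
  rw [fn_comp_inv, mul_assoc _ (canonicalUnitary Γ μ g⁻¹), canonicalUnitary_inv_mul, mul_one]

theorem actionAut_fn {f : X → ℂ} (hf : BddMeasurable f) (g : Γ) :
    actionAut Γ μ g (fn hf) = fn (hf.comp (measurable_const_smul g⁻¹)) :=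
  Subtype.ext (fn_comp_inv hf g).symm

theorem measurableSet_fixed (g : Γ) : MeasurableSet {x : X | g⁻¹ • x = x} :=
  ((measurable_const_smul g⁻¹).prodMk measurable_id) (measurableSet_diagonal (α := X))

/-- The vector f u_g ξ is carried by the graph of g⁻¹, which meets the diagonal exactly over the
fixed points of g. -/
theorem tr_fn_mul_canonicalUnitary {f : X → ℂ} (hf : BddMeasurable f) (g : Γ) :
    (orbitVNA Γ μ).tr ((fn hf : cartan Γ μ) * canonicalUnitary Γ μ g) =
      ∫ x in {x : X | g⁻¹ • x = x}, f x ∂μ := by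
  have e : (orbitVNA Γ μ).tr ((fn hf : cartan Γ μ) * canonicalUnitary Γ μ g) =
      ∫ z, (Set.diagonal X).indicator
        (fun z => ({x : X | g⁻¹ • x = x}.indicator f) z.1) z ∂orbitMeasure Γ μ := by
    refine (L2.inner_def _ _).trans (integral_congr_ae ?_)
    have h1 := (measurePreserving_smul_fst Γ μ g⁻¹).quasiMeasurePreserving.ae_eq_comp
      (diagonalVector_coe Γ μ)
    filter_upwards [diagonalVector_coe Γ μ, mulOp_coe (orbitMeasure Γ μ) (hf.comp measurable_fst)
      (leftShift Γ μ g (diagonalVector Γ μ)), leftShift_coe Γ μ g (diagonalVector Γ μ), h1]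
      with z k1 k2 k3 k4
    change inner ℂ (diagonalVector Γ μ z) (mulOp (orbitMeasure Γ μ) (hf.comp measurable_fst)
      (leftShift Γ μ g (diagonalVector Γ μ)) z) = _
    simp only [Function.comp] at k4
    rw [k1, k2, k3, k4]
    by_cases hz : z ∈ Set.diagonal X
    · have hz' : z.1 = z.2 := hz
      by_cases hg : g⁻¹ • z.1 = z.1
      · simp [Set.indicator, hz', hz' ▸ hg]
      · have hg' : ¬ g⁻¹ • z.2 = z.2 := hz' ▸ hg
        simp [Set.indicator, hz', hg']
    · simp [hz]
  have hd : Set.diagonal X = {z : X × X | z.2 = (1 : Γ) • z.1} := by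
    ext z; simp [Set.mem_diagonal_iff, eq_comm]
  have hm : Measurable fun z : X × X => ({x : X | g⁻¹ • x = x}.indicator f) z.1 :=
    (hf.1.indicator (measurableSet_fixed g)).comp measurable_fst
  rw [e, integral_indicator measurableSet_diagonal, hd, restrict_orbitMeasure_graph,
    integral_map (measurable_graph Γ 1).aemeasurable hm.aestronglyMeasurable,
    ← integral_indicator (measurableSet_fixed g)]

theorem tr_fn {f : X → ℂ} (hf : BddMeasurable f) :
    (orbitVNA Γ μ).tr (fn hf : cartan Γ μ) = ∫ x, f x ∂μ := by
  have h := tr_fn_mul_canonicalUnitary (Γ := Γ) (μ := μ) hf 1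
  rw [canonicalUnitary_one, mul_one] at h
  simpa using h

theorem cartanTr_fn {f : X → ℂ} (hf : BddMeasurable f) :
    cartanTr Γ μ (fn hf) = ∫ x, f x ∂μ := tr_fn hf

theorem norm2_sq_fn {f : X → ℂ} (hf : BddMeasurable f) :
    (orbitVNA Γ μ).norm2 (fn hf : cartan Γ μ) ^ 2 = ∫ x, ‖f x‖ ^ 2 ∂μ := by
  have h := (orbitVNA Γ μ).tr_star_mul_self (fn hf : cartan Γ μ)
  have e : star ((fn hf : cartan Γ μ) : (orbitVNA Γ μ).Carrier) * (fn hf : cartan Γ μ) =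
      (fn (hf.star.mul hf) : cartan Γ μ) := by
    rw [fn_mul hf.star hf, fn_star]; rfl
  rw [e, tr_fn (hf.star.mul hf)] at h
  have e2 : ∫ x, (star f * f) x ∂μ = ((∫ x, ‖f x‖ ^ 2 ∂μ : ℝ) : ℂ) := by
    rw [← integral_complex_ofReal]
    refine integral_congr_ae (Eventually.of_forall fun x => ?_)
    simp only [Pi.mul_apply, Pi.star_apply]
    rw [RCLike.star_def, RCLike.conj_mul]
    norm_cast
  rw [e2] at h
  exact_mod_cast h.symm

variable [Countable Γ]

theorem fn_mul_canonicalUnitary_congr {f f' : X → ℂ} (hf : BddMeasurable f)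
    (hf' : BddMeasurable f') {g h : Γ}
    (H : ∀ᵐ x ∂μ, f x = f' x ∧ (f x ≠ 0 → g⁻¹ • x = h⁻¹ • x)) :
    (fn hf : cartan Γ μ) * canonicalUnitary Γ μ g =
      (fn hf' : cartan Γ μ) * canonicalUnitary Γ μ h :=
  Subtype.ext (mulOp_fst_mul_leftShift_congr Γ μ hf hf' H)

theorem fn_eq_fn_iff {f g : X → ℂ} (hf : BddMeasurable f) (hg : BddMeasurable g) :
    (fn hf : cartan Γ μ) = fn hg ↔ f =ᵐ[μ] g := by
  constructor
  · intro h
    have e : (fn (hf.sub hg) : cartan Γ μ) = 0 := by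
      have h1 := fn_add (Γ := Γ) (μ := μ) (hf.sub hg) hg
      have h2 : (fn ((hf.sub hg).add hg) : cartan Γ μ) = fn hf := by
        congr 1; exact sub_add_cancel f g
      rw [h2, h] at h1
      exact right_eq_add.1 h1
    have h3 := norm2_sq_fn (Γ := Γ) (μ := μ) (hf.sub hg)
    rw [e] at h3
    have h4 : (orbitVNA Γ μ).norm2 ((0 : cartan Γ μ) : (orbitVNA Γ μ).Carrier) = 0 :=
      (orbitVNA Γ μ).norm2_zero
    rw [h4, zero_pow two_ne_zero, eq_comm, integral_eq_zero_iff_of_nonneg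
      (fun x => by positivity)] at h3
    · filter_upwards [h3] with x hx
      have : ‖(f - g) x‖ ^ 2 = 0 := hx
      rw [sq_eq_zero_iff, norm_eq_zero, Pi.sub_apply, sub_eq_zero] at this
      exact this
    · obtain ⟨C, hC⟩ := (hf.sub hg).2
      refine Integrable.of_bound ((hf.sub hg).1.norm.pow_const 2).aestronglyMeasurable (C ^ 2)
        (Eventually.of_forall fun x => ?_)
      rw [Real.norm_of_nonneg (by positivity)]
      have := hC x
      gcongr
  · intro h
    have := fn_mul_canonicalUnitary_congr (Γ := Γ) (μ := μ) hf hg (g := 1) (h := 1)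
      (h.mono fun x hx => ⟨hx, fun _ => rfl⟩)
    rw [canonicalUnitary_one, mul_one, mul_one] at this
    exact Subtype.ext this

theorem norm_fn_le {f : X → ℂ} (hf : BddMeasurable f) {C : ℝ} (hC0 : 0 ≤ C)
    (hC : ∀ᵐ x ∂μ, ‖f x‖ ≤ C) :
    ‖(fn hf : cartan Γ μ)‖ ≤ C := by
  refine ContinuousLinearMap.opNorm_le_bound _ hC0 fun ξ => ?_
  refine Lp.norm_le_mul_norm_of_ae_le_mul ?_
  filter_upwards [mulOp_coe (orbitMeasure Γ μ) (hf.comp measurable_fst) ξ,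
    (quasiMeasurePreserving_fst_orbitMeasure Γ μ).ae hC] with z h1 h2
  change ‖mulOp (orbitMeasure Γ μ) (hf.comp measurable_fst) ξ z‖ ≤ _
  rw [h1, norm_mul]
  exact mul_le_mul_of_nonneg_right h2 (norm_nonneg _)

/-- On D = {|f| > C} the operator bound tested on 1_D reads ∫_D |f|² ≤ C² μ(D), which forces D to be
null. -/
theorem ae_norm_le_of_norm_fn_le {f : X → ℂ} (hf : BddMeasurable f) {C : ℝ}
    (hC : ‖(fn hf : cartan Γ μ)‖ ≤ C) : ∀ᵐ x ∂μ, ‖f x‖ ≤ C := by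
  have hC0 : 0 ≤ C := (norm_nonneg _).trans hC
  set D := {x | C < ‖f x‖}
  have hD : MeasurableSet D := measurableSet_lt measurable_const hf.1.norm
  have hi := bddMeasurable_indicator hD
  have h := (orbitVNA Γ μ).norm2_mul_le (fn hf : cartan Γ μ) (fn hi : cartan Γ μ)
  have h' : (orbitVNA Γ μ).norm2 (fn (hf.mul hi) : cartan Γ μ) ^ 2 ≤
      C ^ 2 * (orbitVNA Γ μ).norm2 (fn hi : cartan Γ μ) ^ 2 := by
    rw [← mul_pow, fn_mul]
    refine pow_le_pow_left₀ ((orbitVNA Γ μ).norm2_nonneg _) (h.trans ?_) 2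
    exact mul_le_mul_of_nonneg_right hC ((orbitVNA Γ μ).norm2_nonneg _)
  have hint : ∀ {k : X → ℂ}, BddMeasurable k → Integrable (fun x => ‖k x‖ ^ 2) μ := by
    intro k hk
    obtain ⟨B, hB⟩ := hk.2
    refine Integrable.of_bound (hk.1.norm.pow_const 2).aestronglyMeasurable (B ^ 2)
      (Eventually.of_forall fun x => ?_)
    rw [Real.norm_of_nonneg (by positivity)]
    have := hB x
    gcongr
  rw [norm2_sq_fn, norm2_sq_fn, ← integral_const_mul, ← sub_nonneg,
    ← integral_sub ((hint hi).const_mul _) (hint (hf.mul hi))] at h'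
  have hle : ∀ x, C ^ 2 * ‖D.indicator (fun _ => (1 : ℂ)) x‖ ^ 2 -
      ‖(f * D.indicator fun _ => (1 : ℂ)) x‖ ^ 2 ≤ 0 := by
    intro x
    by_cases hx : x ∈ D
    · have hx' : C < ‖f x‖ := hx
      simp only [Pi.mul_apply, Set.indicator_of_mem hx, norm_one, mul_one, one_pow]
      nlinarith
    · simp [hx]
  have h0 : ∫ x, -(C ^ 2 * ‖D.indicator (fun _ => (1 : ℂ)) x‖ ^ 2 -
      ‖(f * D.indicator fun _ => (1 : ℂ)) x‖ ^ 2) ∂μ = 0 := by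
    refine le_antisymm ?_ (integral_nonneg fun x => by simpa using hle x)
    rw [integral_neg]; linarith
  rw [integral_eq_zero_iff_of_nonneg (fun x => by simpa using hle x)
    (by exact (((hint hi).const_mul _).sub (hint (hf.mul hi))).neg)] at h0
  filter_upwards [h0] with x hx
  by_contra hlt
  have hxD : x ∈ D := not_le.1 hlt
  have hx' : C < ‖f x‖ := hxD
  simp only [Pi.zero_apply, Pi.mul_apply, Set.indicator_of_mem hxD, norm_one, mul_one, one_pow]
    at hx
  nlinarith

end OrbitAlgebra


/-! ### Density of the span of `L^∞(X) u_g` -/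

/-- The span of a self-adjoint multiplicative set, as a `*`-subalgebra. -/
def spanStarSubalgebra {R : Type*} [Ring R] [StarRing R] [Algebra ℂ R] [StarModule ℂ R]
    (T : Set R) (hone : (1 : R) ∈ T) (hmul : ∀ x ∈ T, ∀ y ∈ T, x * y ∈ T)
    (hstar : ∀ x ∈ T, star x ∈ T) : StarSubalgebra ℂ R where
  carrier := Submodule.span ℂ T
  mul_mem' := by
    intro x y hx hy
    induction hx using Submodule.span_induction with
    | mem x hx =>
      induction hy using Submodule.span_induction with
      | mem y hy => exact Submodule.subset_span (hmul x hx y hy)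
      | zero => rw [mul_zero]; exact zero_mem _
      | add y z _ _ h1 h2 => rw [mul_add]; exact add_mem h1 h2
      | smul c y _ h => rw [mul_smul_comm]; exact Submodule.smul_mem _ c h
    | zero => rw [zero_mul]; exact zero_mem _
    | add x z _ _ h1 h2 => rw [add_mul]; exact add_mem h1 h2
    | smul c x _ h => rw [smul_mul_assoc]; exact Submodule.smul_mem _ c h
  add_mem' := fun hx hy => add_mem hx hy
  algebraMap_mem' := fun c => by
    rw [Algebra.algebraMap_eq_smul_one]
    exact Submodule.smul_mem _ c (Submodule.subset_span hone)
  star_mem' := by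
    intro x hx
    change x ∈ Submodule.span ℂ T at hx
    change star x ∈ Submodule.span ℂ T
    induction hx using Submodule.span_induction with
    | mem x hx => exact Submodule.subset_span (hstar x hx)
    | zero => rw [star_zero]; exact zero_mem _
    | add x z _ _ h1 h2 => rw [star_add]; exact add_mem h1 h2
    | smul c x _ h => rw [star_smul]; exact Submodule.smul_mem _ _ h

namespace TracialVNA

variable {H : Type*} [NormedAddCommGroup H] [InnerProductSpace ℂ H] [CompleteSpace H]
  {M : TracialVNA H} {ω : Ultrafilter ℕ}

/-- The constant sequences. -/
noncomputable def ultraConst (ω : Ultrafilter ℕ) : M.Carrier →⋆ₐ[ℂ] M.Ultra ω where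
  toFun x := M.ultraMk ω (BoundedContinuousFunction.const ℕ x)
  map_one' := rfl
  map_mul' _ _ := rfl
  map_zero' := rfl
  map_add' _ _ := rfl
  commutes' _ := rfl
  map_star' _ := rfl

theorem ultraNorm2_ultraConst (x : M.Carrier) : M.ultraNorm2 ω (ultraConst ω x) = M.norm2 x :=
  tendsto_nhds_unique (tendsto_norm2 ω _) tendsto_const_nhds

/-- The `‖·‖₂`-closure of a `*`-subalgebra of `M^ω`. -/
noncomputable def ultraClosure (S : StarSubalgebra ℂ (M.Ultra ω)) : StarSubalgebra ℂ (M.Ultra ω) :=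
  (closureRel (S.map ((StarAlgHom.id ℂ (M.Ultra ω)).prod (StarAlgHom.id ℂ (M.Ultra ω))))).comap
    ((StarAlgHom.id ℂ (M.Ultra ω)).prod (StarAlgHom.id ℂ (M.Ultra ω)))

theorem mem_ultraClosure {S : StarSubalgebra ℂ (M.Ultra ω)} {x : M.Ultra ω} :
    x ∈ ultraClosure S ↔ ∀ ε > 0, ∃ y ∈ S, M.ultraNorm2 ω (x - y) < ε := by
  constructor
  · intro h ε hε
    obtain ⟨_, ⟨y, hy, rfl⟩, h1, -⟩ := h ε hε
    exact ⟨y, hy, h1⟩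
  · intro h ε hε
    obtain ⟨y, hy, h1⟩ := h ε hε
    exact ⟨_, ⟨y, hy, rfl⟩, h1, h1⟩

theorem ultraGenerated_eq_ultraClosure {T : Set (M.Ultra ω)} {S : StarSubalgebra ℂ (M.Ultra ω)}
    (h1 : ∀ x ∈ T, x ∈ ultraClosure S)
    (h2 : ∀ N : StarSubalgebra ℂ (M.Ultra ω), T ⊆ N → S ≤ N) :
    M.ultraGenerated ω T = ultraClosure S := by
  refine le_antisymm (sInf_le ⟨h1, fun x hx => mem_ultraClosure.2 fun ε hε => ?_⟩)
    (le_sInf fun N hN x hx => hN.2 x fun ε hε => ?_)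
  · obtain ⟨y, hy, hxy⟩ := hx (ε / 2) (half_pos hε)
    obtain ⟨z, hz, hyz⟩ := mem_ultraClosure.1 hy (ε / 2) (half_pos hε)
    exact ⟨z, hz, (ultraNorm2_sub_le x y z).trans_lt (by linarith)⟩
  · obtain ⟨y, hy, hxy⟩ := mem_ultraClosure.1 hx ε hε
    exact ⟨y, h2 N hN.1 hy, hxy⟩

end TracialVNA

section OrbitDensity

open TracialVNA

variable {Γ : Type*} [Group Γ] {X : Type*} [MeasurableSpace X] [MulAction Γ X]
  {μ : Measure X} [MeasurableConstSMul Γ X] [SMulInvariantMeasure Γ X μ] [MeasurableEq X]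
  [IsProbabilityMeasure μ]

variable (Γ μ) in
/-- The span of the elements `a u_g` with `a ∈ L^∞(X)`. -/
noncomputable def orbitSpan : Submodule ℂ (orbitVNA Γ μ).Carrier :=
  Submodule.span ℂ {x | ∃ (a : cartan Γ μ) (g : Γ), x = a * canonicalUnitary Γ μ g}

/-- The vector f u_g ξ is the function f(x) on the graph of g⁻¹ and zero elsewhere, so pairing with
it reads off the values of η on that graph. -/
theorem inner_fn_mul_canonicalUnitary {f : X → ℂ} (hf : BddMeasurable f) (g : Γ)
    (η : OrbitL2 Γ μ) :
    ⟪(((fn hf : cartan Γ μ) * canonicalUnitary Γ μ g : (orbitVNA Γ μ).Carrier) :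
      OrbitL2 Γ μ →L[ℂ] OrbitL2 Γ μ) (orbitVNA Γ μ).vec, η⟫_ℂ =
      ∫ x, star (f x) * η (x, g⁻¹ • x) ∂μ := by
  have hG := measurableSet_graph (X := X) Γ g⁻¹
  have e : ⟪(((fn hf : cartan Γ μ) * canonicalUnitary Γ μ g : (orbitVNA Γ μ).Carrier) :
      OrbitL2 Γ μ →L[ℂ] OrbitL2 Γ μ) (orbitVNA Γ μ).vec, η⟫_ℂ =
      ∫ z, {z : X × X | z.2 = g⁻¹ • z.1}.indicator (fun z => star (f z.1) * η z) z
        ∂orbitMeasure Γ μ := by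
    refine (L2.inner_def _ _).trans (integral_congr_ae ?_)
    have h1 := (measurePreserving_smul_fst Γ μ g⁻¹).quasiMeasurePreserving.ae_eq_comp
      (diagonalVector_coe Γ μ)
    filter_upwards [mulOp_coe (orbitMeasure Γ μ) (hf.comp measurable_fst)
      (leftShift Γ μ g (diagonalVector Γ μ)), leftShift_coe Γ μ g (diagonalVector Γ μ), h1]
      with z k2 k3 k4
    change inner ℂ (mulOp (orbitMeasure Γ μ) (hf.comp measurable_fst)
      (leftShift Γ μ g (diagonalVector Γ μ)) z) (η z) = _
    simp only [Function.comp] at k4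
    rw [k2, k3, k4]
    by_cases hz : z.2 = g⁻¹ • z.1
    · have hz' : (g⁻¹ • z.1, z.2) ∈ Set.diagonal X := hz.symm
      rw [Set.indicator_of_mem hz', Set.indicator_of_mem (s := {z : X × X | z.2 = g⁻¹ • z.1}) hz]
      simp [mul_comm]
    · have hz' : (g⁻¹ • z.1, z.2) ∉ Set.diagonal X := fun h => hz (Eq.symm h)
      rw [Set.indicator_of_notMem hz', Set.indicator_of_notMem (s := {z : X × X | z.2 = g⁻¹ • z.1}) hz]
      simp
  have hm : Measurable fun z : X × X => star (f z.1) * η z :=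
    (continuous_star.measurable.comp (hf.1.comp measurable_fst)).mul
      (Lp.stronglyMeasurable η).measurable
  rw [e, integral_indicator hG, restrict_orbitMeasure_graph,
    integral_map (measurable_graph Γ g⁻¹).aemeasurable hm.aestronglyMeasurable]

theorem integrable_comp_graph (η : OrbitL2 Γ μ) (g : Γ) :
    Integrable (fun x => η (x, g • x)) μ := by
  have h : MemLp (fun z => η z) 2 (μ.map fun x => (x, g • x)) :=
    (Lp.memLp η).mono_measure (map_graph_le_orbitMeasure Γ μ g)
  have h2 := (memLp_map_measure_iff (Lp.stronglyMeasurable η).aestronglyMeasurable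
    (measurable_graph Γ g).aemeasurable).1 h
  exact h2.integrable one_le_two

variable [Countable Γ]

/-- Since ‖x - y‖₂ is the distance of two vectors of L²(ℛ), it suffices that the vectors a u_g ξ
span a dense subspace; no approximation of operators is involved. -/
theorem exists_orbitSpan_norm2_sub_lt (x : (orbitVNA Γ μ).Carrier) {ε : ℝ} (hε : 0 < ε) :
    ∃ y ∈ orbitSpan Γ μ, (orbitVNA Γ μ).norm2 (x - y) < ε := by
  let L : (orbitVNA Γ μ).Carrier →ₗ[ℂ] OrbitL2 Γ μ :=
    { toFun := fun y => (y : OrbitL2 Γ μ →L[ℂ] OrbitL2 Γ μ) (orbitVNA Γ μ).vec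
      map_add' := fun _ _ => rfl
      map_smul' := fun _ _ => rfl }
  have hd : ((orbitSpan Γ μ).map L).topologicalClosure = ⊤ := by
    rw [Submodule.topologicalClosure_eq_top_iff, Submodule.eq_bot_iff]
    intro η hη
    -- A vector orthogonal to all 1_s u_{g⁻¹} ξ has zero integral over every part of the graph of g,
    -- hence vanishes on that graph; countably many graphs exhaust the relation.
    have h0 : ∀ g : Γ, ∀ᵐ x ∂μ, η (x, g • x) = 0 := by
      intro g
      refine (integrable_comp_graph η g).ae_eq_zero_of_forall_setIntegral_eq_zero
        fun s hs _ => ?_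
      have h1 := hη (L ((fn (bddMeasurable_indicator hs) : cartan Γ μ) *
        canonicalUnitary Γ μ g⁻¹)) ⟨_, Submodule.subset_span ⟨_, _, rfl⟩, rfl⟩
      have h2 := inner_fn_mul_canonicalUnitary (Γ := Γ) (μ := μ) (bddMeasurable_indicator hs)
        g⁻¹ η
      have h3 := h1.symm.trans h2
      rw [inv_inv] at h3
      rw [← integral_indicator hs, h3]
      refine integral_congr_ae (Eventually.of_forall fun x => ?_)
      by_cases hx : x ∈ s <;> simp [hx]
    rw [Lp.eq_zero_iff_ae_eq_zero]
    exact ae_orbitMeasure Γ μ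
      ((Lp.stronglyMeasurable η).measurable (measurableSet_singleton (0 : ℂ))) h0
  have hx : L x ∈ closure ((orbitSpan Γ μ).map L : Set (OrbitL2 Γ μ)) := by
    have : L x ∈ ((orbitSpan Γ μ).map L).topologicalClosure := hd ▸ Submodule.mem_top
    exact this
  obtain ⟨_, ⟨y, hy, rfl⟩, h⟩ := Metric.mem_closure_iff.1 hx ε hε
  refine ⟨y, hy, ?_⟩
  rw [dist_eq_norm, ← map_sub] at h
  exact h

theorem canonicalUnitary_mem_normalizer (g : Γ) :
    canonicalUnitary Γ μ g ∈ (orbitVNA Γ μ).normalizer (cartan Γ μ) := by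
  refine ⟨?_, ?_⟩
  · rw [Unitary.mem_iff, star_canonicalUnitary]
    exact ⟨canonicalUnitary_inv_mul Γ μ g, canonicalUnitary_mul_inv Γ μ g⟩
  · ext a
    simp only [star_canonicalUnitary]
    constructor
    · rintro ⟨b, hb, rfl⟩
      exact canonicalUnitary_conj_mem Γ μ g hb
    · intro ha
      refine ⟨_, canonicalUnitary_conj_mem Γ μ g⁻¹ ha, ?_⟩
      simp only [inv_inv]
      rw [← mul_assoc, ← mul_assoc, canonicalUnitary_mul_inv, one_mul, mul_assoc,
        canonicalUnitary_mul_inv, mul_one]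

variable (ω : Ultrafilter ℕ)

theorem ultraConst_mul_ultraMk (a : ℕ →ᵇ (orbitVNA Γ μ).Carrier)
    (g : Γ) : ∃ b : ℕ →ᵇ (orbitVNA Γ μ).Carrier,
      (∀ n (hn : a n ∈ cartan Γ μ), b n = actionAut Γ μ g ⟨a n, hn⟩) ∧
      ultraConst ω (canonicalUnitary Γ μ g) * (orbitVNA Γ μ).ultraMk ω a =
        (orbitVNA Γ μ).ultraMk ω b * ultraConst ω (canonicalUnitary Γ μ g) := by
  refine ⟨BoundedContinuousFunction.const ℕ (canonicalUnitary Γ μ g) * a *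
    BoundedContinuousFunction.const ℕ (canonicalUnitary Γ μ g⁻¹), fun n hn => rfl, ?_⟩
  rw [ultraMk_mul, ultraMk_mul]
  change _ = ultraConst ω (canonicalUnitary Γ μ g) * _ * ultraConst ω (canonicalUnitary Γ μ g⁻¹) *
    ultraConst ω (canonicalUnitary Γ μ g)
  rw [mul_assoc _ (ultraConst ω (canonicalUnitary Γ μ g⁻¹)), ← map_mul, canonicalUnitary_inv_mul,
    map_one, mul_one]

variable (Γ μ) in
/-- The span of the elements `a u_g` of the ultrapower, with `a ∈ A^ω`. -/
noncomputable def ultraOrbitSpan : StarSubalgebra ℂ ((orbitVNA Γ μ).Ultra ω) :=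
  spanStarSubalgebra {x | ∃ (a : (orbitVNA Γ μ).Ultra ω) (g : Γ),
      a ∈ (orbitVNA Γ μ).ultraSub (cartan Γ μ) ω ∧ x = a * ultraConst ω (canonicalUnitary Γ μ g)}
    ⟨1, 1, one_mem _, by rw [canonicalUnitary_one, map_one, mul_one]⟩
    (by
      rintro _ ⟨a, g, ha, rfl⟩ _ ⟨_, h, ⟨b, hb, rfl⟩, rfl⟩
      obtain ⟨c, hc, e⟩ := ultraConst_mul_ultraMk ω b g
      refine ⟨a * (orbitVNA Γ μ).ultraMk ω c, g * h,
        mul_mem ha ⟨c, fun n => (hc n (hb n)) ▸ Subtype.coe_prop _, rfl⟩, ?_⟩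
      rw [← canonicalUnitary_mul, map_mul, mul_assoc, ← mul_assoc _ ((orbitVNA Γ μ).ultraMk ω b),
        e]
      simp only [mul_assoc])
    (by
      rintro _ ⟨_, g, ha, rfl⟩
      obtain ⟨b, hb, e0⟩ := star_mem ha
      obtain ⟨c, hc, e⟩ := ultraConst_mul_ultraMk ω b g⁻¹
      refine ⟨(orbitVNA Γ μ).ultraMk ω c, g⁻¹, ⟨c, fun n => (hc n (hb n)) ▸ Subtype.coe_prop _, rfl⟩,
        ?_⟩
      rw [star_mul, ← map_star, star_canonicalUnitary, ← e0, e])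

theorem mul_mem_ultraOrbitSpan {a : (orbitVNA Γ μ).Ultra ω}
    (ha : a ∈ (orbitVNA Γ μ).ultraSub (cartan Γ μ) ω) (g : Γ) :
    a * ultraConst ω (canonicalUnitary Γ μ g) ∈ ultraOrbitSpan Γ μ ω :=
  Submodule.subset_span ⟨a, g, ha, rfl⟩

theorem ultraConst_mem_ultraSub (a : cartan Γ μ) :
    ultraConst ω (a : (orbitVNA Γ μ).Carrier) ∈ (orbitVNA Γ μ).ultraSub (cartan Γ μ) ω :=
  ⟨_, fun _ => a.2, rfl⟩

theorem ultraConst_mem_ultraOrbitSpan {y : (orbitVNA Γ μ).Carrier} (hy : y ∈ orbitSpan Γ μ) :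
    ultraConst ω y ∈ ultraOrbitSpan Γ μ ω := by
  induction hy using Submodule.span_induction with
  | mem y hy =>
    obtain ⟨a, g, rfl⟩ := hy
    rw [map_mul]
    exact mul_mem_ultraOrbitSpan ω (ultraConst_mem_ultraSub ω a) g
  | zero => rw [map_zero]; exact zero_mem _
  | add x y _ _ h1 h2 => rw [map_add]; exact add_mem h1 h2
  | smul c x _ h => rw [map_smul]; exact (ultraOrbitSpan Γ μ ω).smul_mem h c

/-- `M(ω)` is the `‖·‖₂`-closure of the span of `A^ω u_g`, `g ∈ Γ`. -/
theorem ultraCartan_eq_ultraClosure :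
    (orbitVNA Γ μ).ultraCartan (cartan Γ μ) ω = ultraClosure (ultraOrbitSpan Γ μ ω) := by
  refine ultraGenerated_eq_ultraClosure ?_ ?_
  · rintro _ (hx | ⟨u, hu, rfl⟩)
    · refine mem_ultraClosure.2 fun ε hε => ⟨_, ?_, by rwa [sub_self, ultraNorm2_zero]⟩
      have h := mul_mem_ultraOrbitSpan ω hx 1
      rwa [canonicalUnitary_one, map_one, mul_one] at h
    · refine mem_ultraClosure.2 fun ε hε => ?_
      -- An arbitrary element of the normalizer is a ‖·‖₂-limit from the span of the a u_g, so the
      -- group unitaries generate the same algebra as the whole normalizer.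
      obtain ⟨y, hy, h⟩ := exists_orbitSpan_norm2_sub_lt u hε
      refine ⟨ultraConst ω y, ultraConst_mem_ultraOrbitSpan ω hy, ?_⟩
      change (orbitVNA Γ μ).ultraNorm2 ω (ultraConst ω u - ultraConst ω y) < ε
      rwa [← map_sub, ultraNorm2_ultraConst]
  · intro N hN x hx
    refine (Submodule.span_le (p := N.toSubalgebra.toSubmodule)).2 ?_ hx
    rintro _ ⟨a, g, ha, rfl⟩
    exact N.mul_mem' (hN (Or.inl ha)) (hN (Or.inr ⟨_, canonicalUnitary_mem_normalizer g, rfl⟩))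

theorem mem_ultraCartan_iff {x : (orbitVNA Γ μ).Ultra ω} :
    x ∈ (orbitVNA Γ μ).ultraCartan (cartan Γ μ) ω ↔
      ∀ ε > 0, ∃ y ∈ ultraOrbitSpan Γ μ ω, (orbitVNA Γ μ).ultraNorm2 ω (x - y) < ε := by
  rw [ultraCartan_eq_ultraClosure, mem_ultraClosure]

end OrbitDensity


/-! ### Point realizations of trace preserving isomorphisms -/

/-- A measure space isomorphism, up to null sets. -/
structure PointIso {X Y : Type*} [MeasurableSpace X] [MeasurableSpace Y] (μ : Measure X)
    (ν : Measure Y) where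
  /-- the map from `Y` to `X` -/
  fwd : Y → X
  /-- the map from `X` to `Y` -/
  inv : X → Y
  mp_fwd : MeasurePreserving fwd ν μ
  mp_inv : MeasurePreserving inv μ ν
  inv_fwd : ∀ᵐ y ∂ν, inv (fwd y) = y
  fwd_inv : ∀ᵐ x ∂μ, fwd (inv x) = x

/-- The inverse of a measure space isomorphism. -/
def PointIso.symm {X Y : Type*} [MeasurableSpace X] [MeasurableSpace Y] {μ : Measure X}
    {ν : Measure Y} (π : PointIso μ ν) : PointIso ν μ where
  fwd := π.inv
  inv := π.fwd
  mp_fwd := π.mp_inv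
  mp_inv := π.mp_fwd
  inv_fwd := π.fwd_inv
  fwd_inv := π.inv_fwd

namespace TraceIso

variable {A B : Type*} [Ring A] [StarRing A] [Algebra ℂ A] [Ring B] [StarRing B]
  [Algebra ℂ B] {τ : A → ℂ} {τ' : B → ℂ} (θ : TraceIso τ τ')

theorem apply_mul (a b : A) : θ (a * b) = θ a * θ b := map_mul θ.toStarAlgEquiv a b

theorem apply_sub (a b : A) : θ (a - b) = θ a - θ b := map_sub θ.toStarAlgEquiv a b

theorem apply_one : θ 1 = 1 := map_one θ.toStarAlgEquiv

theorem apply_zero : θ 0 = 0 := map_zero θ.toStarAlgEquiv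

theorem trace_apply (a : A) : τ' (θ a) = τ a := θ.trace_map a

theorem apply_symm_apply (b : B) : θ (θ.symm b) = b := θ.toStarAlgEquiv.apply_symm_apply b

theorem symm_apply_apply (a : A) : θ.symm (θ a) = a := θ.toStarAlgEquiv.symm_apply_apply a

end TraceIso

section Realization

variable {Γ : Type*} [Group Γ] [Countable Γ] {X : Type*} [MeasurableSpace X] [MulAction Γ X]
  {μ : Measure X} [MeasurableConstSMul Γ X] [SMulInvariantMeasure Γ X μ] [MeasurableEq X]
  [IsProbabilityMeasure μ]
  {Λ : Type*} [Group Λ] [Countable Λ] {Y : Type*} [MeasurableSpace Y] [MulAction Λ Y]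
  {ν : Measure Y} [MeasurableConstSMul Λ Y] [SMulInvariantMeasure Λ Y ν] [MeasurableEq Y]
  [IsProbabilityMeasure ν]

theorem integral_indicator_one_complex {Z : Type*} [MeasurableSpace Z] (m : Measure Z)
    {s : Set Z} (hs : MeasurableSet s) :
    ∫ z, s.indicator (fun _ => (1 : ℂ)) z ∂m = (m.real s : ℂ) := by
  rw [integral_indicator hs]; simp

theorem indicator_one_mul {Z : Type*} (s t : Set Z) :
    s.indicator (fun _ => (1 : ℂ)) * t.indicator (fun _ => (1 : ℂ)) =
      (s ∩ t).indicator fun _ => (1 : ℂ) := by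
  ext z
  by_cases h1 : z ∈ s <;> by_cases h2 : z ∈ t <;> simp [h1, h2]

theorem mul_indicator_one {Z : Type*} (k : Z → ℂ) (s : Set Z) :
    (k * s.indicator fun _ => (1 : ℂ)) = s.indicator k := by
  ext z
  by_cases hz : z ∈ s <;> simp [hz]

/-- The projection of `L^∞(X)` given by a measurable set. -/
noncomputable def proj {s : Set X} (hs : MeasurableSet s) : cartan Γ μ :=
  fn (bddMeasurable_indicator hs)

theorem cartanTr_proj {s : Set X} (hs : MeasurableSet s) :
    cartanTr Γ μ (proj hs) = (μ.real s : ℂ) := by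
  rw [proj, cartanTr_fn, integral_indicator_one_complex μ hs]

theorem proj_mul {s t : Set X} (hs : MeasurableSet s) (ht : MeasurableSet t) :
    (proj hs * proj ht : cartan Γ μ) = proj (hs.inter ht) := by
  unfold proj
  rw [← fn_mul]
  congr 1
  exact indicator_one_mul s t

theorem star_proj {s : Set X} (hs : MeasurableSet s) :
    star (proj hs : cartan Γ μ) = proj hs := by
  unfold proj
  rw [← fn_star]
  congr 1
  ext z
  by_cases h : z ∈ s <;> simp [h]

theorem isStarProjection_proj {s : Set X} (hs : MeasurableSet s) :
    IsStarProjection (proj hs : cartan Γ μ) :=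
  ⟨(proj_mul hs hs).trans (by congr 1; exact Set.inter_self s), star_proj hs⟩

theorem proj_empty : (proj MeasurableSet.empty : cartan Γ μ) = 0 := by
  have h := fn_const (Γ := Γ) (μ := μ) 0
  rw [map_zero] at h
  rw [← h]
  unfold proj
  congr 1
  ext z; simp

theorem proj_univ : (proj MeasurableSet.univ : cartan Γ μ) = 1 := by
  have h := fn_const (Γ := Γ) (μ := μ) 1
  rw [map_one] at h
  rw [← h]
  unfold proj
  congr 1
  ext z; simp

theorem proj_compl {s : Set X} (hs : MeasurableSet s) :
    (proj hs.compl : cartan Γ μ) = 1 - proj hs := by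
  rw [eq_sub_iff_add_eq, ← proj_univ]
  unfold proj
  rw [← fn_add]
  congr 1
  ext z
  by_cases h : z ∈ s <;> simp [h]

theorem proj_eq_proj_iff {s t : Set X} (hs : MeasurableSet s) (ht : MeasurableSet t) :
    (proj hs : cartan Γ μ) = proj ht ↔ s =ᵐ[μ] t := by
  rw [proj, proj, fn_eq_fn_iff]
  constructor
  · intro h
    filter_upwards [h] with x hx
    refine propext ?_
    change x ∈ s ↔ x ∈ t
    by_cases h1 : x ∈ s <;> by_cases h2 : x ∈ t <;> simp_all
  · intro h
    filter_upwards [h] with x hx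
    have : x ∈ s ↔ x ∈ t := iff_of_eq hx
    by_cases h1 : x ∈ s <;> simp_all

theorem exists_eq_proj {a : cartan Γ μ} (ha : a * a = a) :
    ∃ (s : Set X) (hs : MeasurableSet s), a = proj hs := by
  obtain ⟨f, hf, rfl⟩ := exists_eq_fn a
  rw [← fn_mul, fn_eq_fn_iff] at ha
  refine ⟨{x | f x = 1}, hf.1 (measurableSet_singleton 1), (fn_eq_fn_iff _ _).2 ?_⟩
  filter_upwards [ha] with x hx
  rw [Pi.mul_apply] at hx
  by_cases h : f x = 1
  · simp [h]
  · rw [Set.indicator_of_notMem (by simpa using h)]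
    by_contra h0
    exact h ((mul_eq_left₀ h0).1 hx)

/-- The sets `C ⊂ X` and `D ⊂ Y` whose projections correspond to each other under `θ`. -/
def Corr (θ : TraceIso (cartanTr Γ μ) (cartanTr Λ ν)) (C : Set X) (D : Set Y) : Prop :=
  ∃ (hC : MeasurableSet C) (hD : MeasurableSet D), θ (proj hC) = proj hD

namespace Corr

variable {θ : TraceIso (cartanTr Γ μ) (cartanTr Λ ν)} {C C' : Set X} {D D' : Set Y}

theorem exists_right (θ : TraceIso (cartanTr Γ μ) (cartanTr Λ ν)) (hC : MeasurableSet C) :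
    ∃ D, Corr θ C D := by
  have h : θ (proj hC) * θ (proj hC) = θ (proj hC) := by
    rw [← θ.apply_mul]
    exact congrArg θ (isStarProjection_proj hC).1
  obtain ⟨D, hD, h⟩ := exists_eq_proj h
  exact ⟨D, hC, hD, h⟩

theorem symm (h : Corr θ C D) : Corr θ.symm D C := by
  obtain ⟨hC, hD, h⟩ := h
  refine ⟨hD, hC, ?_⟩
  rw [← h]
  exact θ.symm_apply_apply _

theorem exists_left (θ : TraceIso (cartanTr Γ μ) (cartanTr Λ ν)) (hD : MeasurableSet D) :
    ∃ C, Corr θ C D := by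
  obtain ⟨C, h⟩ := exists_right θ.symm hD
  exact ⟨C, h.symm⟩

theorem measure_eq (h : Corr θ C D) : ν D = μ C := by
  obtain ⟨hC, hD, h⟩ := h
  have h1 := θ.trace_map (proj hC)
  rw [show θ.toFun (proj hC) = proj hD from h, cartanTr_proj, cartanTr_proj] at h1
  have h2 : ν.real D = μ.real C := by exact_mod_cast h1
  exact (measureReal_eq_measureReal_iff).1 h2

theorem ae_unique (h : Corr θ C D) (h' : Corr θ C D') : D =ᵐ[ν] D' := by
  obtain ⟨hC, hD, h⟩ := h
  obtain ⟨hC, hD', h'⟩ := h'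
  exact (proj_eq_proj_iff hD hD').1 (h.symm.trans h')

theorem congr_right (h : Corr θ C D) (hD' : MeasurableSet D') (e : D =ᵐ[ν] D') :
    Corr θ C D' := by
  obtain ⟨hC, hD, h⟩ := h
  exact ⟨hC, hD', h.trans ((proj_eq_proj_iff hD hD').2 e)⟩

theorem inter (h : Corr θ C D) (h' : Corr θ C' D') : Corr θ (C ∩ C') (D ∩ D') := by
  obtain ⟨hC, hD, h⟩ := h
  obtain ⟨hC', hD', h'⟩ := h'
  refine ⟨hC.inter hC', hD.inter hD', ?_⟩
  rw [← proj_mul hC hC', ← proj_mul hD hD', ← h, ← h']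
  exact θ.apply_mul _ _

theorem compl (h : Corr θ C D) : Corr θ Cᶜ Dᶜ := by
  obtain ⟨hC, hD, h⟩ := h
  refine ⟨hC.compl, hD.compl, ?_⟩
  rw [proj_compl hC, proj_compl hD, ← h, θ.apply_sub, θ.apply_one]

theorem empty : Corr θ (∅ : Set X) (∅ : Set Y) :=
  ⟨MeasurableSet.empty, MeasurableSet.empty, by
    rw [proj_empty, proj_empty]; exact θ.apply_zero⟩

/-- Normality of θ is not assumed; it follows from preservation of the trace. The set E
corresponding to the union contains every D k almost everywhere, and both E and the union of the D k
have measure Σ μ(C k). -/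
theorem iUnion {C : ℕ → Set X} {D : ℕ → Set Y} (h : ∀ k, Corr θ (C k) (D k))
    (hC : Pairwise (Function.onFun Disjoint C)) (hD : Pairwise (Function.onFun Disjoint D)) :
    Corr θ (⋃ k, C k) (⋃ k, D k) := by
  have hCm : ∀ k, MeasurableSet (C k) := fun k => (h k).1
  have hDm : ∀ k, MeasurableSet (D k) := fun k => (h k).2.1
  obtain ⟨E, hE⟩ := exists_right θ (MeasurableSet.iUnion hCm)
  refine hE.congr_right (MeasurableSet.iUnion hDm) ?_
  have hsub : ∀ k, D k ≤ᵐ[ν] E := by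
    intro k
    have h1 := (h k).inter hE
    rw [Set.inter_eq_left.2 (Set.subset_iUnion C k)] at h1
    filter_upwards [(h k).ae_unique h1] with y hy hyD
    exact ((iff_of_eq (show (y ∈ D k) = (y ∈ D k ∩ E) from hy)).1 hyD).2
  have hsub' : (⋃ k, D k) ≤ᵐ[ν] E := by
    filter_upwards [ae_all_iff.2 hsub] with y hy hyD
    obtain ⟨k, hk⟩ := Set.mem_iUnion.1 hyD
    exact hy k hk
  refine (ae_eq_of_ae_subset_of_measure_ge hsub' ?_ ?_ (measure_ne_top _ _)).symm
  · rw [hE.measure_eq, measure_iUnion hC hCm, measure_iUnion hD hDm]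
    exact le_of_eq (tsum_congr fun k => ((h k).measure_eq).symm)
  · exact (MeasurableSet.iUnion hDm).nullMeasurableSet

end Corr

variable [StandardBorelSpace X]

/-- A standard Borel space embeds in the space of binary sequences. The sets of Y that correspond to
the coordinate sets of X are the bits of a map from Y to binary sequences, and decoding gives the
point map. -/
theorem exists_corr_preimage (θ : TraceIso (cartanTr Γ μ) (cartanTr Λ ν)) :
    ∃ T : Y → X, Measurable T ∧ ∀ C, MeasurableSet C → Corr θ C (T ⁻¹' C) := by
  classical
  obtain ⟨c, hc, hinj⟩ := MeasurableSpace.measurable_injection_nat_bool_of_countablySeparated X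
  have hemb : MeasurableEmbedding c := hc.measurableEmbedding hinj
  have hCi : ∀ i, MeasurableSet {x | c x i = true} := fun i =>
    ((measurable_pi_apply i).comp hc) (measurableSet_singleton true)
  choose D hD using fun i => Corr.exists_right θ (hCi i)
  let d : Y → ℕ → Bool := fun y i => decide (y ∈ D i)
  have hdi : ∀ i, {y | d y i = true} = D i := fun i => by ext y; simp [d]
  have hne : Nonempty X := nonempty_of_isProbabilityMeasure μ
  -- The decoder r is a measurable left inverse of c, defined also at the binary sequences that are
  -- not codes.
  obtain ⟨r, hr, hrc⟩ := hemb.exists_measurable_extend measurable_id fun _ => hne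
  have hd : Measurable d := measurable_pi_iff.2 fun i => measurable_to_bool <| by
    change MeasurableSet {y | d y i = true}
    rw [hdi]
    exact (hD i).2.1
  -- The sets whose preimages correspond form a Dynkin system stable under intersections, hence a
  -- σ-algebra; it contains the coordinate sets, so all measurable sets.
  let 𝒟 : MeasurableSpace.DynkinSystem (ℕ → Bool) :=
    { Has := fun E => Corr θ (c ⁻¹' E) (d ⁻¹' E)
      has_empty := Corr.empty
      has_compl := fun h => h.compl
      has_iUnion_nat := fun {E} hE h => by
        simp only [Set.preimage_iUnion]
        exact Corr.iUnion h (fun i j hij => (hE hij).preimage c)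
          (fun i j hij => (hE hij).preimage d) }
  let m := 𝒟.toMeasurableSpace fun _ _ h h' => h.inter h'
  have hm : (MeasurableSpace.pi : MeasurableSpace (ℕ → Bool)) ≤ m := by
    refine iSup_le fun i => ?_
    rw [← measurable_iff_comap_le]
    refine measurable_to_bool ?_
    change Corr θ {x | c x i = true} {y | d y i = true}
    rw [hdi]
    exact hD i
  refine ⟨r ∘ d, hr.comp hd, fun C hC => ?_⟩
  have h : Corr θ (c ⁻¹' (r ⁻¹' C)) (d ⁻¹' (r ⁻¹' C)) := hm _ (hr hC)
  rw [← Set.preimage_comp, hrc] at h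
  exact h

/-- `θ` is given by composition with the point map of `π`. -/
def Realizes (π : PointIso μ ν) (θ : TraceIso (cartanTr Γ μ) (cartanTr Λ ν)) : Prop :=
  ∀ (f : X → ℂ) (hf : BddMeasurable f), θ (fn hf) = fn (hf.comp π.mp_fwd.measurable)

omit [StandardBorelSpace X] in
theorem Realizes.symm {π : PointIso μ ν} {θ : TraceIso (cartanTr Γ μ) (cartanTr Λ ν)}
    (h : Realizes π θ) : Realizes π.symm θ.symm := by
  intro f hf
  have h1 := h _ (hf.comp π.mp_inv.measurable)
  have h2 : (fn ((hf.comp π.mp_inv.measurable).comp π.mp_fwd.measurable) : cartan Λ ν) = fn hf := by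
    refine (fn_eq_fn_iff _ _).2 ?_
    filter_upwards [π.inv_fwd] with y hy
    simp only [Function.comp, hy]
  rw [h2] at h1
  rw [← h1]
  exact θ.toStarAlgEquiv.symm_apply_apply _

/-- Functions are identified through their integrals over all sets B: choosing C with projection
corresponding to 1_B, the integral of θ(f) over B is τ(f 1_C) by preservation of the trace, and so
is the integral of f ∘ T over T⁻¹C, which equals B almost everywhere. -/
theorem exists_point_map (θ : TraceIso (cartanTr Γ μ) (cartanTr Λ ν)) :
    ∃ T : Y → X, MeasurePreserving T ν μ ∧ ∀ (f : X → ℂ) (hf : BddMeasurable f)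
      (hfT : BddMeasurable (f ∘ T)), θ (fn hf) = fn hfT := by
  obtain ⟨T, hT, hcorr⟩ := exists_corr_preimage θ
  have hmp : MeasurePreserving T ν μ := ⟨hT, Measure.ext fun C hC => by
    rw [Measure.map_apply hT hC, (hcorr C hC).measure_eq]⟩
  refine ⟨T, hmp, fun f hf hfT => ?_⟩
  obtain ⟨g, hg, hgθ⟩ := exists_eq_fn (θ (fn hf))
  rw [hgθ, fn_eq_fn_iff]
  refine Integrable.ae_eq_of_forall_setIntegral_eq _ _ (hg.integrable ν) (hfT.integrable ν)
    fun B hB _ => ?_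
  obtain ⟨C, hC, hB', hCB⟩ := Corr.exists_left θ hB
  have e := (hcorr C hC).ae_unique ⟨hC, hB', hCB⟩
  have h1 := θ.trace_apply (fn (hf.mul (bddMeasurable_indicator hC)))
  have h2 : θ (fn (hf.mul (bddMeasurable_indicator hC))) =
      fn (hg.mul (bddMeasurable_indicator hB)) := by
    unfold proj at hCB
    rw [fn_mul hf (bddMeasurable_indicator hC), fn_mul hg (bddMeasurable_indicator hB),
      θ.apply_mul, hCB]
    congr 1
  rw [h2, cartanTr_fn (hg.mul (bddMeasurable_indicator hB)),
    cartanTr_fn (hf.mul (bddMeasurable_indicator hC)), mul_indicator_one,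
    mul_indicator_one,
    integral_indicator hB] at h1
  rw [h1, ← setIntegral_congr_set e, ← integral_indicator (hT hC), ← hmp.map_eq,
    integral_map hT.aemeasurable (hf.1.indicator hC).aestronglyMeasurable]
  rfl

omit [StandardBorelSpace X] in
theorem ae_eq_self_of_ae_preimage [StandardBorelSpace X] {S : X → X}
    (h : ∀ C, MeasurableSet C → S ⁻¹' C =ᵐ[μ] C) : ∀ᵐ x ∂μ, S x = x := by
  obtain ⟨c, hc, hinj⟩ := MeasurableSpace.measurable_injection_nat_bool_of_countablySeparated X
  have hCi : ∀ i, MeasurableSet {x | c x i = true} := fun i =>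
    ((measurable_pi_apply i).comp hc) (measurableSet_singleton true)
  filter_upwards [ae_all_iff.2 fun i => h _ (hCi i)] with x hx
  refine hinj (funext fun i => Bool.eq_iff_iff.2 ?_)
  exact iff_of_eq (hx i)

/-- The point maps of θ and of its inverse compose to maps that fix every set up to null sets; a
countable separating family of sets then shows that these are the identity almost everywhere. -/
theorem exists_realization [StandardBorelSpace Y]
    (θ : TraceIso (cartanTr Γ μ) (cartanTr Λ ν)) : ∃ π : PointIso μ ν, Realizes π θ := by
  obtain ⟨T, hT, hθT⟩ := exists_point_map θ
  obtain ⟨S, hS, hθS⟩ := exists_point_map θ.symm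
  refine ⟨⟨T, S, hT, hS, ?_, ?_⟩, fun f hf => hθT f hf _⟩
  · refine ae_eq_self_of_ae_preimage fun C hC => ?_
    refine (proj_eq_proj_iff (Γ := Λ) (hS.measurable.comp hT.measurable hC) hC).1 ?_
    have h1 := hθS _ (bddMeasurable_indicator hC)
      ((bddMeasurable_indicator hC).comp hS.measurable)
    have h2 := hθT _ ((bddMeasurable_indicator hC).comp hS.measurable)
      (((bddMeasurable_indicator hC).comp hS.measurable).comp hT.measurable)
    rw [← h1] at h2
    exact h2.symm.trans (θ.toStarAlgEquiv.apply_symm_apply _)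
  · refine ae_eq_self_of_ae_preimage fun C hC => ?_
    refine (proj_eq_proj_iff (Γ := Γ) (hT.measurable.comp hS.measurable hC) hC).1 ?_
    have h1 := hθT _ (bddMeasurable_indicator hC)
      ((bddMeasurable_indicator hC).comp hT.measurable)
    have h2 := hθS _ ((bddMeasurable_indicator hC).comp hT.measurable)
      (((bddMeasurable_indicator hC).comp hT.measurable).comp hS.measurable)
    rw [← h1] at h2
    exact h2.symm.trans (θ.toStarAlgEquiv.symm_apply_apply _)

end Realization


/-! ### From an isomorphism to tightness -/

section Tightness

variable {X Y : Type*} [MeasurableSpace X] [MeasurableSpace Y] {μ : Measure X} {ν : Measure Y}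

/-- The transport of `x ↦ φ⁻¹ x` to `Y`. -/
def PointIso.conj {Γ : Type*} [Group Γ] [MulAction Γ X] (π : PointIso μ ν) (φ : Γ) : Y → Y :=
  fun y => π.inv (φ⁻¹ • π.fwd y)

theorem PointIso.measurable_conj {Γ : Type*} [Group Γ] [MulAction Γ X] [MeasurableConstSMul Γ X]
    (π : PointIso μ ν) (φ : Γ) : Measurable (π.conj φ) :=
  π.mp_inv.measurable.comp (π.mp_fwd.measurable.const_smul φ⁻¹)

/-- The points at which the transport of `φ⁻¹` agrees with `ψ⁻¹`. -/
def PointIso.matchSet {Γ Λ : Type*} [Group Γ] [Group Λ] [MulAction Γ X] [MulAction Λ Y]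
    (π : PointIso μ ν) (φ : Γ) (ψ : Λ) : Set Y :=
  {y | π.conj φ y = ψ⁻¹ • y}

theorem PointIso.measurableSet_matchSet {Γ Λ : Type*} [Group Γ] [Group Λ] [MulAction Γ X]
    [MulAction Λ Y] [MeasurableConstSMul Γ X] [MeasurableConstSMul Λ Y] [MeasurableEq Y]
    (π : PointIso μ ν) (φ : Γ) (ψ : Λ) : MeasurableSet (π.matchSet φ ψ) :=
  ((π.measurable_conj φ).prodMk (measurable_const_smul ψ⁻¹)) (measurableSet_diagonal (α := Y))

variable (Γ Λ : Type*) [Group Γ] [Group Λ] [MulAction Γ X] [MulAction Λ Y] in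
/-- Along `l`, the transport of each `φ ∈ Γ` agrees, up to small measure, piecewise with finitely
many elements of `Λ` that do not depend on the index. -/
def Tight (l : Filter ℕ) (π : ℕ → PointIso μ ν) : Prop :=
  ∀ (φ : Γ) (ε : ℝ), 0 < ε → ∃ F : Finset Λ,
    ∀ᶠ n in l, 1 - ε ≤ ν.real (⋃ ψ ∈ F, (π n).matchSet φ ψ)

/-- Averaging w(Sy) w(Ry) over the finite products w of coordinate signs converges to the indicator
of {S = R}, where k vanishes. The average of the integrals against k therefore tends to 0, so some w
moves the integral of k by at least half of its size. -/
theorem exists_sign [IsProbabilityMeasure ν] [StandardBorelSpace Y] {S R : Y → Y}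
    (hS : Measurable S) (hR : Measurable R) {k : Y → ℂ} (hk : Integrable k ν)
    (hk0 : ∀ y, S y = R y → k y = 0) :
    ∃ w : Y → ℂ, Measurable w ∧ (∀ y, w y = 1 ∨ w y = -1) ∧
      ‖∫ y, k y ∂ν‖ ≤ 2 * ‖∫ y, k y ∂ν - ∫ y, w (S y) * w (R y) * k y ∂ν‖ := by
  classical
  by_cases hc : ∫ y, k y ∂ν = 0
  · exact ⟨fun _ => 1, measurable_const, fun _ => Or.inl rfl, by simp [hc]⟩
  obtain ⟨c, hcm, hinj⟩ := MeasurableSpace.measurable_injection_nat_bool_of_countablySeparated Y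
  let s : ℕ → Y → ℂ := fun i y => if c y i = true then 1 else -1
  have hs : ∀ i, Measurable (s i) := fun i => Measurable.ite
    (((measurable_pi_apply i).comp hcm) (measurableSet_singleton true))
    measurable_const measurable_const
  have hs1 : ∀ i y, s i y = 1 ∨ s i y = -1 := fun i y => by
    by_cases h : c y i = true <;> simp [s, h]
  -- These are the Walsh functions of the binary code of Y.
  let w : Finset ℕ → Y → ℂ := fun A y => ∏ i ∈ A, s i y
  have hwm : ∀ A, Measurable (w A) := fun A => Finset.measurable_prod A fun i _ => hs i
  have hw1 : ∀ A y, w A y = 1 ∨ w A y = -1 := by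
    intro A y
    induction A using Finset.induction_on with
    | empty => left; simp [w]
    | insert i A hi ih =>
      have : w (insert i A) y = s i y * w A y := Finset.prod_insert hi
      rw [this]
      rcases hs1 i y with h | h <;> rcases ih with h' | h' <;> simp [h, h']
  have hint : ∀ A, Integrable (fun y => w A (S y) * w A (R y) * k y) ν := by
    intro A
    refine hk.bdd_mul (c := 1) (((hwm A).comp hS).mul ((hwm A).comp hR)).aestronglyMeasurable
      (Eventually.of_forall fun y => ?_)
    rcases hw1 A (S y) with h | h <;> rcases hw1 A (R y) with h' | h' <;> simp [h, h']
  -- Each factor is 1 if the i-th bits of Sy and Ry coincide and 0 otherwise. Expanding the product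
  -- gives the average of w A (Sy) w A (Ry) over the 2^N subsets A of the first N indices.
  let g : ℕ → Y → ℂ := fun N y => (∏ i ∈ Finset.range N, (1 + s i (S y) * s i (R y)) / 2) * k y
  have hg : ∀ N, ∫ y, g N y ∂ν =
      (2⁻¹ : ℂ) ^ N * ∑ A ∈ (Finset.range N).powerset, ∫ y, w A (S y) * w A (R y) * k y ∂ν := by
    intro N
    rw [← integral_finsetSum _ fun A _ => hint A, ← integral_const_mul]
    refine integral_congr_ae (Eventually.of_forall fun y => ?_)
    simp only [g, w]
    rw [← Finset.sum_mul, ← mul_assoc]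
    congr 1
    simp_rw [← Finset.prod_mul_distrib]
    rw [← Finset.prod_one_add, Finset.prod_div_distrib]
    simp [div_eq_inv_mul]
  have hfac : ∀ i y, (1 + s i (S y) * s i (R y)) / 2 = 1 ∨
      (1 + s i (S y) * s i (R y)) / 2 = 0 := by
    intro i y
    rcases hs1 i (S y) with h | h <;> rcases hs1 i (R y) with h' | h' <;> simp [h, h']
  have hlim : Tendsto (fun N => ∫ y, g N y ∂ν) atTop (𝓝 (∫ _, (0 : ℂ) ∂ν)) := by
    refine tendsto_integral_of_dominated_convergence (fun y => ‖k y‖) (fun N => ?_) hk.norm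
      (fun N => Eventually.of_forall fun y => ?_) (Eventually.of_forall fun y => ?_)
    · refine AEStronglyMeasurable.mul (Measurable.aestronglyMeasurable ?_) hk.1
      exact Finset.measurable_prod _ fun i _ =>
        (measurable_const.add (((hs i).comp hS).mul ((hs i).comp hR))).div_const 2
    · simp only [g, norm_mul]
      refine mul_le_of_le_one_left (norm_nonneg _) ?_
      rw [norm_prod]
      refine Finset.prod_le_one (fun _ _ => norm_nonneg _) fun i _ => ?_
      rcases hfac i y with h | h <;> simp [h]
    · by_cases hy : S y = R y
      · simp [g, hk0 y hy]
      · obtain ⟨i, hi⟩ : ∃ i, c (S y) i ≠ c (R y) i := by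
          by_contra! h
          exact hy (hinj (funext h))
        have h0 : (1 + s i (S y) * s i (R y)) / 2 = 0 := by
          simp only [s]
          cases h1 : c (S y) i <;> cases h2 : c (R y) i <;> simp_all
        refine tendsto_const_nhds.congr' ?_
        filter_upwards [eventually_gt_atTop i] with N hN
        simp only [g]
        rw [Finset.prod_eq_zero (Finset.mem_range.2 hN) h0, zero_mul]
  rw [integral_zero] at hlim
  have hpos : 0 < ‖∫ y, k y ∂ν‖ := norm_pos_iff.2 hc
  obtain ⟨N, hN⟩ := ((tendsto_order.1 hlim.norm).2 (‖∫ y, k y ∂ν‖ / 2)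
    (by rw [norm_zero]; positivity)).exists
  -- If every sign moved the integral by less than half of its size, so would the average over the
  -- Walsh functions, whose integral has size below ‖I‖/2 for this N.
  by_contra! hcon
  set I := ∫ y, k y ∂ν
  have hsum : ‖∑ A ∈ (Finset.range N).powerset,
      (I - ∫ y, w A (S y) * w A (R y) * k y ∂ν)‖ ≤ 2 ^ N * (‖I‖ / 2) := by
    have h := norm_sum_le_of_le (Finset.range N).powerset
      (f := fun A => I - ∫ y, w A (S y) * w A (R y) * k y ∂ν) (n := fun _ => ‖I‖ / 2) fun A _ => by
        have := hcon (w A) (hwm A) (hw1 A)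
        linarith
    refine h.trans (le_of_eq ?_)
    · rw [Finset.sum_const, Finset.card_powerset, Finset.card_range]; simp
  rw [Finset.sum_sub_distrib, Finset.sum_const, Finset.card_powerset, Finset.card_range] at hsum
  have e : (∑ A ∈ (Finset.range N).powerset, ∫ y, w A (S y) * w A (R y) * k y ∂ν) =
      2 ^ N * ∫ y, g N y ∂ν := by
    rw [hg, ← mul_assoc, ← mul_pow]; norm_num
  rw [e, nsmul_eq_mul] at hsum
  push_cast at hsum
  rw [← mul_sub, norm_mul, norm_pow, Complex.norm_ofNat] at hsum
  have h2 : ‖I - ∫ y, g N y ∂ν‖ ≤ ‖I‖ / 2 := le_of_mul_le_mul_left hsum (by positivity)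
  have h3 := norm_sub_norm_le I (∫ y, g N y ∂ν)
  linarith

/-! ### Orthogonality of intertwiners to the terms b u_ψ -/

section Operators

open TracialVNA

theorem TracialVNA.tr_star_mul {H : Type*} [NormedAddCommGroup H] [InnerProductSpace ℂ H]
    [CompleteSpace H] (M : TracialVNA H) (x y : M.Carrier) :
    M.tr (star x * y) = ⟪(x : H →L[ℂ] H) M.vec, (y : H →L[ℂ] H) M.vec⟫_ℂ :=
  inner_star_right (x : H →L[ℂ] H) M.vec ((y : H →L[ℂ] H) M.vec)

/-- As W² = 1 and W, W' are self-adjoint, traciality makes the difference equal to τ(P*(VW - W'V)W).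
An operator V that almost intertwines W with W' thus has almost the same coefficient against P and
against W'PW. -/
theorem TracialVNA.norm_tr_sub_le {H : Type*} [NormedAddCommGroup H] [InnerProductSpace ℂ H]
    [CompleteSpace H] (M : TracialVNA H) (P V : M.Carrier) {W W' : M.Carrier}
    (hW : star W = W) (hW' : star W' = W') (hWsq : W * W = 1) (hWn : ‖W‖ ≤ 1) :
    ‖M.tr (star P * V) - M.tr (star (W' * P * W) * V)‖ ≤ ‖P‖ * M.norm2 (V * W - W' * V) := by
  have e0 : star (W' * P * W) = W * (star P * W') := by
    rw [star_mul (W' * P) W, star_mul W' P, hW, hW']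
  have e1 : M.tr (star (W' * P * W) * V) = M.tr (star P * (W' * V * W)) := by
    rw [e0, mul_assoc, M.tr_mul_comm]
    simp only [mul_assoc]
  have e2 : star P * V = star P * (V * W * W) := by rw [mul_assoc V, hWsq, mul_one]
  have e3 : M.tr (star P * V) - M.tr (star (W' * P * W) * V) =
      M.tr (star P * (V * W - W' * V) * W) := by
    have e4 : star P * (V * W - W' * V) * W =
        star P * (V * W * W) + (-1 : ℂ) • (star P * (W' * V * W)) := by
      rw [neg_one_smul, ← sub_eq_add_neg, ← mul_sub, mul_assoc, sub_mul]
    rw [e4, M.tr_add, M.tr_smul, e1, e2]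
    ring
  rw [e3]
  refine (M.norm_tr_le _).trans ((M.norm2_mul_le' _ _).trans ?_)
  refine (mul_le_of_le_one_left (M.norm2_nonneg _) hWn).trans ?_
  refine (M.norm2_mul_le _ _).trans_eq ?_
  rw [norm_star]

variable {Λ : Type*} [Group Λ] [Countable Λ] [MulAction Λ Y]
  [MeasurableConstSMul Λ Y] [SMulInvariantMeasure Λ Y ν]
  [IsProbabilityMeasure ν] [StandardBorelSpace Y]

theorem bddMeasurable_of_sign {w : Y → ℂ} (hw : Measurable w) (hw1 : ∀ y, w y = 1 ∨ w y = -1) :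
    BddMeasurable w :=
  ⟨hw, 1, fun y => by rcases hw1 y with h | h <;> simp [h]⟩

/-- If `b` vanishes where `S` agrees with `ψ⁻¹` and `V` intertwines `w` and `w ∘ S` for all signs
`w`, then `V` is orthogonal to `b u_ψ`. -/
theorem exists_sign_norm_tr_le {S : Y → Y} (hS : Measurable S) (ψ : Λ) {b : Y → ℂ}
    (hb : BddMeasurable b) (hb0 : ∀ y, S y = ψ⁻¹ • y → b y = 0) {C : ℝ} (hC : 0 ≤ C)
    (hbC : ∀ y, ‖b y‖ ≤ C) (V : (orbitVNA Λ ν).Carrier) :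
    ∃ (w : Y → ℂ) (hw : BddMeasurable w), (∀ y, w y = 1 ∨ w y = -1) ∧
      ‖(orbitVNA Λ ν).tr (star ((fn hb : cartan Λ ν) * canonicalUnitary Λ ν ψ) * V)‖ ≤
        2 * C * (orbitVNA Λ ν).norm2
          (V * (fn hw : cartan Λ ν) - (fn (hw.comp hS) : cartan Λ ν) * V) := by
  set η : OrbitL2 Λ ν := (V : OrbitL2 Λ ν →L[ℂ] OrbitL2 Λ ν) (orbitVNA Λ ν).vec
  have hint : Integrable (fun y => star (b y) * η (y, ψ⁻¹ • y)) ν :=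
    (integrable_comp_graph η ψ⁻¹).bdd_mul (c := C) hb.star.1.aestronglyMeasurable
      (Eventually.of_forall fun y => by simpa using hbC y)
  -- The coefficient of V against b u_ψ is the integral of conj(b) V ξ over the graph of ψ⁻¹; the
  -- integrand vanishes where S agrees with ψ⁻¹, by the hypothesis on b.
  obtain ⟨w, hwm, hw1, hw2⟩ := exists_sign hS (measurable_const_smul ψ⁻¹) hint
    (fun y hy => by simp [hb0 y hy])
  have hw := bddMeasurable_of_sign hwm hw1
  refine ⟨w, hw, hw1, ?_⟩
  set u := canonicalUnitary Λ ν ψ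
  have hwR := hw.comp (measurable_const_smul (α := Y) ψ⁻¹)
  set P : (orbitVNA Λ ν).Carrier := (fn hb : cartan Λ ν) * u with hP
  set W : (orbitVNA Λ ν).Carrier := ((fn hw : cartan Λ ν) : (orbitVNA Λ ν).Carrier) with hW
  set W' : (orbitVNA Λ ν).Carrier := ((fn (hw.comp hS) : cartan Λ ν) : (orbitVNA Λ ν).Carrier) with hW'
  have hWstar : star W = W := by
    have h := fn_star (Γ := Λ) (μ := ν) hw
    have e : (fn hw.star : cartan Λ ν) = fn hw := by
      congr 1; ext y; rcases hw1 y with h | h <;> simp [h]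
    rw [e] at h
    exact congrArg Subtype.val h.symm
  have hWstar' : star W' = W' := by
    have h := fn_star (Γ := Λ) (μ := ν) (hw.comp hS)
    have e : (fn (hw.comp hS).star : cartan Λ ν) = fn (hw.comp hS) := by
      congr 1; ext y; rcases hw1 (S y) with h | h <;> simp [h]
    rw [e] at h
    exact congrArg Subtype.val h.symm
  have hWsq : W * W = 1 := by
    have h := fn_mul (Γ := Λ) (μ := ν) hw hw
    have e : (fn (hw.mul hw) : cartan Λ ν) = fn (bddMeasurable_const 1) := by
      congr 1; ext y; rcases hw1 y with h | h <;> simp [h]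
    rw [e, fn_const, map_one] at h
    exact congrArg Subtype.val h.symm
  have hPn : ‖P‖ ≤ C := by
    refine (norm_mul_le _ _).trans ?_
    have h1 : ‖u‖ ≤ 1 := ContinuousLinearMap.opNorm_le_bound _ zero_le_one fun ξ => by
      rw [one_mul]; exact (norm_leftShift Λ ν ψ ξ).le
    have h2 : ‖((fn hb : cartan Λ ν) : (orbitVNA Λ ν).Carrier)‖ ≤ C :=
      norm_fn_le hb hC (Eventually.of_forall hbC)
    calc _ ≤ C * 1 := mul_le_mul h2 h1 (norm_nonneg _) hC
      _ = C := mul_one C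
  have hWn : ‖W‖ ≤ 1 := norm_fn_le hw zero_le_one (Eventually.of_forall fun y => by
    rcases hw1 y with h | h <;> simp [h])
  -- the two integrals as traces
  have e1 : (orbitVNA Λ ν).tr (star P * V) = ∫ y, star (b y) * η (y, ψ⁻¹ • y) ∂ν := by
    rw [tr_star_mul]
    exact inner_fn_mul_canonicalUnitary hb ψ η
  have e2 : (orbitVNA Λ ν).tr (star (W' * P * W) * V) =
      ∫ y, w (S y) * w (ψ⁻¹ • y) * (star (b y) * η (y, ψ⁻¹ • y)) ∂ν := by
    -- Moving w to the left across u_ψ turns it into w(ψ⁻¹ ·), so multiplying P by W' and W inserts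
    -- the factor w(Sy) w(ψ⁻¹y) in the integral.
    have h1 : W' * P * W =
        (fn (((hw.comp hS).mul hb).mul hwR) : cartan Λ ν) * u := by
      rw [fn_mul ((hw.comp hS).mul hb) hwR, fn_mul (hw.comp hS) hb, hP]
      have := canonicalUnitary_mul_fn (Γ := Λ) (μ := ν) hw ψ
      change W' * (_ * u) * W = W' * _ * _ * u
      simp only [mul_assoc] at this ⊢
      rw [← this]
    rw [h1, tr_star_mul]
    refine (inner_fn_mul_canonicalUnitary _ ψ η).trans
      (integral_congr_ae (Eventually.of_forall fun y => ?_))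
    simp only [Pi.mul_apply, Function.comp, star_mul']
    rcases hw1 (S y) with h | h <;> rcases hw1 (ψ⁻¹ • y) with h' | h' <;> simp [h, h']
  have e3 := (orbitVNA Λ ν).norm_tr_sub_le P V hWstar hWstar' hWsq hWn
  rw [e1]
  refine hw2.trans ?_
  rw [← e1, ← e2, mul_assoc 2 C]
  refine mul_le_mul_of_nonneg_left (e3.trans ?_) zero_le_two
  exact mul_le_mul_of_nonneg_right hPn ((orbitVNA Λ ν).norm2_nonneg _)

end Operators

end Tightness


/-! ### Bounded sequences of functions in the ultrapower -/

theorem TracialVNA.ultraTr_mul_comm {H : Type*} [NormedAddCommGroup H] [InnerProductSpace ℂ H]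
    [CompleteSpace H] {M : TracialVNA H} {ω : Ultrafilter ℕ} (x y : M.Ultra ω) :
    M.ultraTr ω (x * y) = M.ultraTr ω (y * x) := by
  obtain ⟨x, rfl⟩ := M.ultraMk_surjective ω x
  obtain ⟨y, rfl⟩ := M.ultraMk_surjective ω y
  exact tendsto_nhds_unique (tendsto_tr ω (x * y))
    ((tendsto_tr ω (y * x)).congr fun n => M.tr_mul_comm _ _)

section UltraFn

open TracialVNA

variable {Γ : Type*} [Group Γ] [Countable Γ] {X : Type*} [MeasurableSpace X] [MulAction Γ X]
  {μ : Measure X} [MeasurableConstSMul Γ X] [SMulInvariantMeasure Γ X μ] [MeasurableEq X]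
  [IsProbabilityMeasure μ]

/-- A uniformly bounded sequence of measurable functions. -/
structure FnSeq (X : Type*) [MeasurableSpace X] where
  /-- the functions -/
  toFun : ℕ → X → ℂ
  measurable : ∀ n, Measurable (toFun n)
  /-- a bound -/
  bound : ℝ
  norm_le : ∀ n x, ‖toFun n x‖ ≤ bound

namespace FnSeq

theorem bddMeasurable (f : FnSeq X) (n : ℕ) : BddMeasurable (f.toFun n) :=
  ⟨f.measurable n, f.bound, f.norm_le n⟩

theorem bound_nonneg [Nonempty X] (f : FnSeq X) : 0 ≤ f.bound :=
  (norm_nonneg _).trans (f.norm_le 0 (Classical.arbitrary X))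

/-- The pointwise product. -/
def mul (f g : FnSeq X) : FnSeq X where
  toFun n := f.toFun n * g.toFun n
  measurable n := (f.measurable n).mul (g.measurable n)
  bound := |f.bound| * |g.bound|
  norm_le n x := by
    rw [Pi.mul_apply, norm_mul]
    exact mul_le_mul ((f.norm_le n x).trans (le_abs_self _)) ((g.norm_le n x).trans (le_abs_self _))
      (norm_nonneg _) (abs_nonneg _)

/-- The sequence of compositions with measurable maps. -/
def comp {Z : Type*} [MeasurableSpace Z] (f : FnSeq X) {S : ℕ → Z → X}
    (hS : ∀ n, Measurable (S n)) : FnSeq Z where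
  toFun n := f.toFun n ∘ S n
  measurable n := (f.measurable n).comp (hS n)
  bound := f.bound
  norm_le n z := f.norm_le n (S n z)

/-- The sequence of indicator functions of measurable sets. -/
noncomputable def indicator {s : ℕ → Set X} (hs : ∀ n, MeasurableSet (s n)) : FnSeq X where
  toFun n := (s n).indicator fun _ => 1
  measurable n := measurable_const.indicator (hs n)
  bound := 1
  norm_le n x := by by_cases hx : x ∈ s n <;> simp [hx]

theorem norm_fn_le' (f : FnSeq X) (n : ℕ) :
    ‖((fn (f.bddMeasurable n) : cartan Γ μ) : (orbitVNA Γ μ).Carrier)‖ ≤ f.bound :=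
  haveI := nonempty_of_isProbabilityMeasure μ
  norm_fn_le (f.bddMeasurable n) f.bound_nonneg (Eventually.of_forall (f.norm_le n))

variable (Γ μ) in
/-- The bounded sequence of elements of `L^∞(X)`. -/
noncomputable def seq (f : FnSeq X) : ℕ →ᵇ (orbitVNA Γ μ).Carrier :=
  BoundedContinuousFunction.ofNormedAddCommGroupDiscrete
    (fun n => ((fn (f.bddMeasurable n) : cartan Γ μ) : (orbitVNA Γ μ).Carrier)) f.bound
    (f.norm_fn_le' (Γ := Γ) (μ := μ))

theorem seq_apply (f : FnSeq X) (n : ℕ) :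
    f.seq Γ μ n = (fn (f.bddMeasurable n) : cartan Γ μ) := rfl

theorem seq_mul (f g : FnSeq X) : (f.mul g).seq Γ μ = f.seq Γ μ * g.seq Γ μ :=
  BoundedContinuousFunction.ext fun n =>
    congrArg Subtype.val (fn_mul (Γ := Γ) (μ := μ) (f.bddMeasurable n) (g.bddMeasurable n))

variable (ω : Ultrafilter ℕ)

theorem mk_seq_mem (f : FnSeq X) :
    (orbitVNA Γ μ).ultraMk ω (f.seq Γ μ) ∈ (orbitVNA Γ μ).ultraSub (cartan Γ μ) ω :=
  ⟨f.seq Γ μ, fun n => Subtype.coe_prop (fn (f.bddMeasurable n) : cartan Γ μ), rfl⟩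

theorem const_mul_mk_seq (f : FnSeq X) (g : Γ) :
    ultraConst ω (canonicalUnitary Γ μ g) * (orbitVNA Γ μ).ultraMk ω (f.seq Γ μ) =
      (orbitVNA Γ μ).ultraMk ω
        ((f.comp fun _ => measurable_const_smul (α := X) g⁻¹).seq Γ μ) *
        ultraConst ω (canonicalUnitary Γ μ g) :=
  congrArg ((orbitVNA Γ μ).ultraMk ω) (BoundedContinuousFunction.ext fun n =>
    canonicalUnitary_mul_fn (f.bddMeasurable n) g)

/-- The operator norm bounds a function only almost everywhere, so each function is cut off where it
exceeds the common bound. -/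
theorem exists_eq_seq_of_mem {a : ℕ →ᵇ (orbitVNA Γ μ).Carrier} (ha : ∀ n, a n ∈ cartan Γ μ) :
    ∃ f : FnSeq X, a = f.seq Γ μ := by
  choose f hf e using fun n => exists_eq_fn (⟨a n, ha n⟩ : cartan Γ μ)
  have hle : ∀ n, ∀ᵐ x ∂μ, ‖f n x‖ ≤ ‖a‖ := fun n =>
    ae_norm_le_of_norm_fn_le (Γ := Γ) (hf n) ((e n) ▸ a.norm_coe_le_norm n)
  have hs : ∀ n, MeasurableSet {x | ‖f n x‖ ≤ ‖a‖} := fun n =>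
    measurableSet_le (hf n).1.norm measurable_const
  let F : FnSeq X :=
    { toFun := fun n => {x | ‖f n x‖ ≤ ‖a‖}.indicator (f n)
      measurable := fun n => (hf n).1.indicator (hs n)
      bound := ‖a‖
      norm_le := fun n x => by
        by_cases hx : ‖f n x‖ ≤ ‖a‖
        · rwa [Set.indicator_of_mem (show x ∈ {x | ‖f n x‖ ≤ ‖a‖} from hx)]
        · rw [Set.indicator_of_notMem (show x ∉ {x | ‖f n x‖ ≤ ‖a‖} from hx), norm_zero]
          exact norm_nonneg _ }
  refine ⟨F, BoundedContinuousFunction.ext fun n => ?_⟩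
  rw [seq_apply, show a n = ((⟨a n, ha n⟩ : cartan Γ μ) : (orbitVNA Γ μ).Carrier) from rfl, e n]
  congr 1
  refine (fn_eq_fn_iff _ _).2 ?_
  filter_upwards [hle n] with x hx
  exact (Set.indicator_of_mem (show x ∈ {x | ‖f n x‖ ≤ ‖a‖} from hx) _).symm

theorem exists_eq_seq {x : (orbitVNA Γ μ).Ultra ω}
    (hx : x ∈ (orbitVNA Γ μ).ultraSub (cartan Γ μ) ω) :
    ∃ f : FnSeq X, x = (orbitVNA Γ μ).ultraMk ω (f.seq Γ μ) := by
  obtain ⟨a, ha, rfl⟩ := hx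
  obtain ⟨f, rfl⟩ := exists_eq_seq_of_mem ha
  exact ⟨f, rfl⟩

theorem ultraTr_seq (f : FnSeq X) : Tendsto (fun n => ∫ x, f.toFun n x ∂μ) ω
    (𝓝 ((orbitVNA Γ μ).ultraTr ω ((orbitVNA Γ μ).ultraMk ω (f.seq Γ μ)))) :=
  (tendsto_tr ω (f.seq Γ μ)).congr fun n => tr_fn (f.bddMeasurable n)

theorem star_mk_indicator {s : ℕ → Set X} (hs : ∀ n, MeasurableSet (s n)) :
    star ((orbitVNA Γ μ).ultraMk ω ((indicator hs).seq Γ μ)) =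
      (orbitVNA Γ μ).ultraMk ω ((indicator hs).seq Γ μ) :=
  congrArg ((orbitVNA Γ μ).ultraMk ω) (BoundedContinuousFunction.ext fun n =>
    congrArg Subtype.val (star_proj (Γ := Γ) (μ := μ) (hs n)))

end FnSeq

end UltraFn

/-! ### Tightness of the transported actions -/

section Tightness

open TracialVNA

variable {Γ : Type*} [Group Γ] [Countable Γ] {X : Type*} [MeasurableSpace X] [MulAction Γ X]
  {μ : Measure X} [MeasurableConstSMul Γ X] [SMulInvariantMeasure Γ X μ] [StandardBorelSpace X]
  [IsProbabilityMeasure μ]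
  {Λ : Type*} [Group Λ] [Countable Λ] {Y : Type*} [MeasurableSpace Y] [MulAction Λ Y]
  {ν : Measure Y} [MeasurableConstSMul Λ Y] [SMulInvariantMeasure Λ Y ν] [StandardBorelSpace Y]
  [IsProbabilityMeasure ν] {ω : Ultrafilter ℕ}

theorem ultraConst_canonicalUnitary_mem (g : Γ) :
    ultraConst ω (canonicalUnitary Γ μ g) ∈ (orbitVNA Γ μ).ultraCartan (cartan Γ μ) ω := by
  refine (mem_ultraCartan_iff ω).2 fun ε hε =>
    ⟨1 * ultraConst ω (canonicalUnitary Γ μ g), mul_mem_ultraOrbitSpan ω (one_mem _) g, ?_⟩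
  rwa [one_mul, sub_self, ultraNorm2_zero]

theorem ultraSub_le_ultraCartan :
    (orbitVNA Γ μ).ultraSub (cartan Γ μ) ω ≤ (orbitVNA Γ μ).ultraCartan (cartan Γ μ) ω := by
  refine fun x hx => (mem_ultraCartan_iff ω).2 fun ε hε =>
    ⟨x * ultraConst ω (canonicalUnitary Γ μ 1), mul_mem_ultraOrbitSpan ω hx 1, ?_⟩
  rwa [canonicalUnitary_one, map_one, mul_one, sub_self, ultraNorm2_zero]

/-- If `V` implements the maps `S n` on all sequences of functions, then it is orthogonal to
`b u_ψ` whenever `b n` vanishes on the points where `S n` agrees with `ψ⁻¹`. -/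
theorem ultraTr_eq_zero_of_intertwines {S : ℕ → Y → Y} (hS : ∀ n, Measurable (S n))
    {v : (orbitVNA Λ ν).Ultra ω}
    (hv : ∀ w : FnSeq Y, v * (orbitVNA Λ ν).ultraMk ω (w.seq Λ ν) =
      (orbitVNA Λ ν).ultraMk ω ((w.comp hS).seq Λ ν) * v)
    (b : FnSeq Y) (ψ : Λ) (hb : ∀ n y, S n y = ψ⁻¹ • y → b.toFun n y = 0) :
    (orbitVNA Λ ν).ultraTr ω (star ((orbitVNA Λ ν).ultraMk ω (b.seq Λ ν) *
      ultraConst ω (canonicalUnitary Λ ν ψ)) * v) = 0 := by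
  obtain ⟨V, rfl⟩ := (orbitVNA Λ ν).ultraMk_surjective ω v
  have hne := nonempty_of_isProbabilityMeasure ν
  choose w hw hw1 hwV using fun n => exists_sign_norm_tr_le (hS n) ψ (b.bddMeasurable n) (hb n)
    b.bound_nonneg (b.norm_le n) (V n)
  -- The signs chosen index by index form a single element of the ultraproduct, to which the
  -- intertwining hypothesis applies; it makes the bounds in `hwV` tend to 0.
  let W : FnSeq Y :=
    { toFun := w
      measurable := fun n => (hw n).1
      bound := 1
      norm_le := fun n y => by rcases hw1 n y with h | h <;> simp [h] }
  have h1 := ((orbitVNA Λ ν).ultraMk_eq_iff ω).1 (hv W)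
  have h2 : Tendsto (fun n => (orbitVNA Λ ν).tr
      (star ((fn (b.bddMeasurable n) : cartan Λ ν) * canonicalUnitary Λ ν ψ) * V n)) ω (𝓝 0) := by
    refine squeeze_zero_norm hwV ?_
    have h3 := h1.const_mul (2 * b.bound)
    rw [mul_zero] at h3
    exact h3
  exact tendsto_nhds_unique (tendsto_tr ω (star (b.seq Λ ν *
    BoundedContinuousFunction.const ℕ (canonicalUnitary Λ ν ψ)) * V)) h2

/-- F collects the group elements occurring in an expression of y as a finite sum of terms a u_ψ; by
linearity each term is handled separately. -/
theorem exists_finset_ultraTr_eq_zero {S : ℕ → Y → Y} (hS : ∀ n, Measurable (S n))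
    {v : (orbitVNA Λ ν).Ultra ω}
    (hv : ∀ w : FnSeq Y, v * (orbitVNA Λ ν).ultraMk ω (w.seq Λ ν) =
      (orbitVNA Λ ν).ultraMk ω ((w.comp hS).seq Λ ν) * v)
    {y : (orbitVNA Λ ν).Ultra ω} (hy : y ∈ ultraOrbitSpan Λ ν ω) :
    ∃ F : Finset Λ, ∀ b : FnSeq Y, (∀ n, ∀ ψ ∈ F, ∀ y, S n y = ψ⁻¹ • y → b.toFun n y = 0) →
      (orbitVNA Λ ν).ultraTr ω (star ((orbitVNA Λ ν).ultraMk ω (b.seq Λ ν) * y) * v) = 0 := by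
  classical
  change y ∈ Submodule.span ℂ _ at hy
  induction hy using Submodule.span_induction with
  | mem y hy =>
    obtain ⟨a, ψ, ha, rfl⟩ := hy
    obtain ⟨f, rfl⟩ := FnSeq.exists_eq_seq ω ha
    refine ⟨{ψ}, fun b hb => ?_⟩
    rw [← mul_assoc, ← ultraMk_mul, ← FnSeq.seq_mul]
    refine ultraTr_eq_zero_of_intertwines hS hv _ ψ fun n y h => ?_
    change b.toFun n y * f.toFun n y = 0
    rw [hb n ψ (Finset.mem_singleton_self ψ) y h, zero_mul]
  | zero =>
    refine ⟨∅, fun b _ => ?_⟩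
    have h := ultraTr_smul (0 : ℂ) (0 : (orbitVNA Λ ν).Ultra ω)
    rw [zero_smul, zero_mul] at h
    rwa [mul_zero, star_zero, zero_mul]
  | add y z _ _ h1 h2 =>
    obtain ⟨F, hF⟩ := h1
    obtain ⟨F', hF'⟩ := h2
    refine ⟨F ∪ F', fun b hb => ?_⟩
    rw [mul_add, star_add, add_mul, ultraTr_add,
      hF b fun n ψ h => hb n ψ (Finset.mem_union_left _ h),
      hF' b fun n ψ h => hb n ψ (Finset.mem_union_right _ h), add_zero]
  | smul c y _ h =>
    obtain ⟨F, hF⟩ := h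
    refine ⟨F, fun b hb => ?_⟩
    rw [mul_smul_comm, star_smul, smul_mul_assoc, ultraTr_smul, hF b hb, mul_zero]

/-- An element v of N(ω) is close to a sum y supported on finitely many ψ. Off the points where S n
agrees with one of these, v is orthogonal to y; since v v* = 1, such points can carry little trace.
-/
theorem exists_finset_measureReal_lt {S : ℕ → Y → Y} (hS : ∀ n, Measurable (S n))
    {v : (orbitVNA Λ ν).Ultra ω}
    (hv : ∀ w : FnSeq Y, v * (orbitVNA Λ ν).ultraMk ω (w.seq Λ ν) =
      (orbitVNA Λ ν).ultraMk ω ((w.comp hS).seq Λ ν) * v)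
    (hv1 : v * star v = 1) (hvN : v ∈ (orbitVNA Λ ν).ultraCartan (cartan Λ ν) ω)
    {ε : ℝ} (hε : 0 < ε) :
    ∃ F : Finset Λ, ∀ᶠ n in (ω : Filter ℕ), 1 - ε ≤ ν.real (⋃ ψ ∈ F, {y | S n y = ψ⁻¹ • y}) := by
  obtain ⟨V, hV⟩ := (orbitVNA Λ ν).ultraMk_surjective ω v
  -- The factor v will be bounded by the norm of its representative V; the added 1 keeps the
  -- denominator positive.
  obtain ⟨y, hy, hvy⟩ := (mem_ultraCartan_iff ω).1 hvN (ε / (‖V‖ + 1)) (by positivity)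
  obtain ⟨F, hF⟩ := exists_finset_ultraTr_eq_zero hS hv hy
  have hsm : ∀ n, MeasurableSet (⋃ ψ ∈ F, {y | S n y = ψ⁻¹ • y}) := fun n =>
    Finset.measurableSet_biUnion F fun ψ _ =>
      ((hS n).prodMk (measurable_const_smul ψ⁻¹)) (measurableSet_diagonal (α := Y))
  let b : FnSeq Y := FnSeq.indicator fun n => (hsm n).compl
  have hb : ∀ n, ∀ ψ ∈ F, ∀ y, S n y = ψ⁻¹ • y → b.toFun n y = 0 := fun n ψ hψ y h =>
    have hy : y ∉ (⋃ ψ ∈ F, {y | S n y = ψ⁻¹ • y})ᶜ :=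
      Set.notMem_compl_iff.2 (Set.mem_iUnion₂.2 ⟨ψ, hψ, h⟩)
    Set.indicator_of_notMem hy fun _ => (1 : ℂ)
  set K := (orbitVNA Λ ν).ultraMk ω (b.seq Λ ν) with hK
  have hKstar : star K = K := FnSeq.star_mk_indicator ω fun n => (hsm n).compl
  -- Traciality and v v* = 1 give τ(v* K v) = τ(K), and the term with K y vanishes by the choice of
  -- F.
  have h1 : (orbitVNA Λ ν).ultraTr ω K = (orbitVNA Λ ν).ultraTr ω (star (K * (v - y)) * v) := by
    have e : star (K * (v - y)) * v = star v * (K * v) + (-1 : ℂ) • (star (K * y) * v) := by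
      rw [mul_sub, star_sub, sub_mul, star_mul K v, hKstar, neg_one_smul, ← sub_eq_add_neg,
        mul_assoc]
    rw [e, ultraTr_add, ultraTr_smul, hF b hb, mul_zero, add_zero, ultraTr_mul_comm, mul_assoc,
      hv1, mul_one]
  have hKn : ‖b.seq Λ ν‖ ≤ 1 := (BoundedContinuousFunction.norm_le zero_le_one).2 fun n =>
    b.norm_fn_le' n
  have h2 : ‖(orbitVNA Λ ν).ultraTr ω K‖ < ε := by
    rw [h1]
    refine (norm_ultraTr_le _).trans_lt ?_
    have h3 : (orbitVNA Λ ν).ultraNorm2 ω (K * (v - y)) ≤ ε / (‖V‖ + 1) :=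
      (ultraNorm2_mk_mul_le _ _).trans
        ((mul_le_of_le_one_left (ultraNorm2_nonneg _) hKn).trans hvy.le)
    rw [← hV] at h3 ⊢
    refine (ultraNorm2_mul_mk_le _ _).trans_lt ?_
    rw [ultraNorm2_star]
    refine (mul_le_mul_of_nonneg_left h3 (norm_nonneg _)).trans_lt ?_
    rw [← mul_div_assoc, div_lt_iff₀ (by positivity)]
    nlinarith
  refine ⟨F, ?_⟩
  have h3 := (tendsto_order.1 (FnSeq.ultraTr_seq (Γ := Λ) (μ := ν) ω b).norm).2 ε h2
  filter_upwards [h3] with n hn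
  have e : ∫ x, b.toFun n x ∂ν = ((ν.real (⋃ ψ ∈ F, {y | S n y = ψ⁻¹ • y})ᶜ : ℝ) : ℂ) :=
    integral_indicator_one_complex ν (hsm n).compl
  rw [e, Complex.norm_real, Real.norm_of_nonneg measureReal_nonneg,
    probReal_compl_eq_one_sub (hsm n)] at hn
  linarith

/-- The unitary v = Θ(u_φ) lies in N(ω) and implements the maps `conj φ` on B^ω, because u_φ
implements φ on A^ω and Θ is given there by the θ n. -/
theorem tight_of_ultraproductIso
    (Θ : TraceIso (fun x : (orbitVNA Γ μ).ultraCartan (cartan Γ μ) ω => (orbitVNA Γ μ).ultraTr ω x)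
      (fun y : (orbitVNA Λ ν).ultraCartan (cartan Λ ν) ω => (orbitVNA Λ ν).ultraTr ω y))
    {θ : ℕ → TraceIso (cartanTr Γ μ) (cartanTr Λ ν)}
    (hΘ : ∀ (a : ℕ →ᵇ (orbitVNA Γ μ).Carrier) (b : ℕ →ᵇ (orbitVNA Λ ν).Carrier)
      (ha : ∀ n, a n ∈ cartan Γ μ), (∀ n, b n = θ n ⟨a n, ha n⟩) →
        ∀ x : (orbitVNA Γ μ).ultraCartan (cartan Γ μ) ω,
          (x : (orbitVNA Γ μ).Ultra ω) = (orbitVNA Γ μ).ultraMk ω a →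
          (Θ x : (orbitVNA Λ ν).Ultra ω) = (orbitVNA Λ ν).ultraMk ω b)
    {π : ℕ → PointIso μ ν} (hπ : ∀ n, Realizes (π n) (θ n)) : Tight Γ Λ ω π := by
  intro φ ε hε
  have hS : ∀ n, Measurable ((π n).conj φ) := fun n => (π n).measurable_conj φ
  let u : (orbitVNA Γ μ).ultraCartan (cartan Γ μ) ω :=
    ⟨ultraConst ω (canonicalUnitary Γ μ φ), ultraConst_canonicalUnitary_mem φ⟩
  have hu : u * star u = 1 := Subtype.ext <| by
    change ultraConst ω (canonicalUnitary Γ μ φ) * star (ultraConst ω (canonicalUnitary Γ μ φ)) = 1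
    rw [← map_star, star_canonicalUnitary, ← map_mul, canonicalUnitary_mul_inv, map_one]
  refine exists_finset_measureReal_lt hS (v := Θ u) (fun w => ?_) ?_ (Θ u).2 hε
  -- Pulled back to X, the sequence w becomes a with Θ(a) = w. Then u_φ a = a' u_φ with a' = a ∘
  -- φ⁻¹, and Θ(a') is w composed with the transported maps.
  · let a : FnSeq X := w.comp fun n => (π n).mp_inv.measurable
    let a' : FnSeq X := a.comp fun _ => measurable_const_smul (α := X) φ⁻¹
    let A : (orbitVNA Γ μ).ultraCartan (cartan Γ μ) ω := ⟨_, ultraSub_le_ultraCartan (a.mk_seq_mem ω)⟩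
    let A' : (orbitVNA Γ μ).ultraCartan (cartan Γ μ) ω :=
      ⟨_, ultraSub_le_ultraCartan (a'.mk_seq_mem ω)⟩
    have e : u * A = A' * u := Subtype.ext (a.const_mul_mk_seq ω φ)
    have e1 : (Θ A : (orbitVNA Λ ν).Ultra ω) = (orbitVNA Λ ν).ultraMk ω (w.seq Λ ν) := by
      refine hΘ (a.seq Γ μ) _ (fun n => Subtype.coe_prop _) (fun n => ?_) A rfl
      refine congrArg Subtype.val (Eq.trans ?_ (hπ n _ (a.bddMeasurable n)).symm)
      refine (fn_eq_fn_iff _ _).2 ?_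
      filter_upwards [(π n).inv_fwd] with y hy
      exact (congrArg (w.toFun n) hy).symm
    have e2 : (Θ A' : (orbitVNA Λ ν).Ultra ω) =
        (orbitVNA Λ ν).ultraMk ω ((w.comp hS).seq Λ ν) := by
      refine hΘ (a'.seq Γ μ) _ (fun n => Subtype.coe_prop _) (fun n => ?_) A' rfl
      exact congrArg Subtype.val (hπ n _ (a'.bddMeasurable n)).symm
    have e3 := congrArg Subtype.val (congrArg Θ e)
    rw [Θ.apply_mul, Θ.apply_mul] at e3
    change (Θ u : (orbitVNA Λ ν).Ultra ω) * (Θ A : (orbitVNA Λ ν).Ultra ω) =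
      (Θ A' : (orbitVNA Λ ν).Ultra ω) * (Θ u : (orbitVNA Λ ν).Ultra ω) at e3
    rw [e1, e2] at e3
    exact e3
  · have h1 : Θ u * Θ (star u) = 1 := by
      rw [← Θ.apply_mul, hu, Θ.apply_one]
    rw [map_star Θ.toStarAlgEquiv] at h1
    exact congrArg Subtype.val h1

end Tightness

/-! ### Adjusting the measure of sets along an ultrafilter -/

section Trim

variable {Y : Type*} [MeasurableSpace Y] {ν : Measure Y}

/-- The measure may have atoms, which cannot be cut. By outer regularity each point has an open
neighbourhood that is small once the point is removed, and finitely many of these cover a compact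
set of almost full measure. The index `none` stands for the complement of that set. -/
theorem exists_finite_small_cover [StandardBorelSpace Y] (ν : Measure Y) [IsProbabilityMeasure ν]
    {η : ℝ} (hη : 0 < η) :
    ∃ (A : Finset Y) (P : Option Y → Set Y) (s : Finset (Option Y)),
      (∀ i, MeasurableSet (P i)) ∧ (∀ i ∈ s, ν.real (P i) ≤ η) ∧
      (Set.univ : Set Y) ⊆ A ∪ ⋃ i ∈ s, P i := by
  classical
  let := upgradeStandardBorel Y
  have h1 : ∀ x : Y, ∃ U : Set Y, x ∈ U ∧ IsOpen U ∧ ν.real (U \ {x}) ≤ η := by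
    intro x
    obtain ⟨U, hxU, hU, h⟩ := Set.exists_isOpen_lt_add ({x} : Set Y) (measure_ne_top ν _)
      (ε := ENNReal.ofReal η) (by simpa using hη)
    refine ⟨U, hxU rfl, hU, ?_⟩
    rw [measureReal_sdiff hxU (measurableSet_singleton x)]
    have h2 := ENNReal.toReal_mono (ENNReal.add_ne_top.2 ⟨measure_ne_top ν _, ENNReal.ofReal_ne_top⟩)
      h.le
    rw [ENNReal.toReal_add (measure_ne_top ν _) ENNReal.ofReal_ne_top,
      ENNReal.toReal_ofReal hη.le] at h2
    have h3 : ν.real U = (ν U).toReal := rfl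
    have h4 : ν.real {x} = (ν {x}).toReal := rfl
    linarith
  choose U hxU hUo hUη using h1
  obtain ⟨K, -, hK, hKη⟩ := MeasurableSet.univ.exists_isCompact_lt_add (measure_ne_top ν _)
    (ε := ENNReal.ofReal η) (by simpa using hη)
  obtain ⟨A, hA⟩ := hK.elim_finite_subcover U hUo fun x _ => Set.mem_iUnion.2 ⟨x, hxU x⟩
  have hKη' : ν.real Kᶜ ≤ η := by
    rw [probReal_compl_eq_one_sub hK.measurableSet]
    have h2 := ENNReal.toReal_mono (ENNReal.add_ne_top.2 ⟨measure_ne_top ν _, ENNReal.ofReal_ne_top⟩)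
      hKη.le
    rw [ENNReal.toReal_add (measure_ne_top ν _) ENNReal.ofReal_ne_top,
      ENNReal.toReal_ofReal hη.le, measure_univ, ENNReal.toReal_one] at h2
    have h3 : ν.real K = (ν K).toReal := rfl
    linarith
  refine ⟨A, fun o => o.elim Kᶜ fun x => U x \ {x}, insert none (A.image some), ?_, ?_, ?_⟩
  · rintro (_ | x)
    · exact hK.measurableSet.compl
    · exact (hUo x).measurableSet.diff (measurableSet_singleton x)
  · rintro (_ | x) -
    · exact hKη'
    · exact hUη x
  · intro y _
    by_cases hyA : y ∈ A
    · exact Or.inl hyA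
    refine Or.inr ?_
    by_cases hyK : y ∈ K
    · obtain ⟨x, hx, hyx⟩ := Set.mem_iUnion₂.1 (hA hyK)
      refine Set.mem_iUnion₂.2 ⟨some x, Finset.mem_insert_of_mem (Finset.mem_image_of_mem _ hx), hyx,
        fun h => hyA ?_⟩
      rw [Set.mem_singleton_iff.1 h]
      exact hx
    · exact Set.mem_iUnion₂.2 ⟨none, Finset.mem_insert_self _ _, hyK⟩

/-- A greedy choice: pieces of R are added until the next one would exceed t, and as pieces have
measure at most η the total is then above t - η. If that never happens, all the pieces have been
used. -/
theorem exists_subset_measureReal_le [IsFiniteMeasure ν] {ι : Type*} (s : Finset ι)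
    {P : ι → Set Y} {η t : ℝ} (hP : ∀ i, MeasurableSet (P i)) (hη : ∀ i ∈ s, ν.real (P i) ≤ η)
    {R A : Set Y} (hR : MeasurableSet R) (hA : MeasurableSet A) (ht : ν.real (R ∩ A) ≤ t) :
    ∃ R' ⊆ R, MeasurableSet R' ∧ ν.real R' ≤ t ∧
      (t - η ≤ ν.real R' ∨ R ∩ (A ∪ ⋃ i ∈ s, P i) ⊆ R') := by
  classical
  induction s using Finset.induction_on with
  | empty =>
    exact ⟨R ∩ A, Set.inter_subset_left, hR.inter hA, ht, Or.inr (by simp)⟩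
  | insert i s hi ih =>
    obtain ⟨R', hR', hm, hle, h⟩ := ih fun j hj => hη j (Finset.mem_insert_of_mem hj)
    rcases h with h | h
    · exact ⟨R', hR', hm, hle, Or.inl h⟩
    · by_cases hc : ν.real (R' ∪ R ∩ P i) ≤ t
      · refine ⟨R' ∪ R ∩ P i, Set.union_subset hR' Set.inter_subset_left,
          hm.union (hR.inter (hP i)), hc, Or.inr ?_⟩
        rintro y ⟨hyR, hy⟩
        rcases hy with hy | hy
        · exact Or.inl (h ⟨hyR, Or.inl hy⟩)
        · obtain ⟨j, hj, hyj⟩ := Set.mem_iUnion₂.1 hy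
          rcases Finset.mem_insert.1 hj with rfl | hj
          · exact Or.inr ⟨hyR, hyj⟩
          · exact Or.inl (h ⟨hyR, Or.inr (Set.mem_iUnion₂.2 ⟨j, hj, hyj⟩)⟩)
      · refine ⟨R', hR', hm, hle, Or.inl ?_⟩
        have h1 := measureReal_union_le (μ := ν) R' (R ∩ P i)
        have h2 : ν.real (R ∩ P i) ≤ ν.real (P i) := measureReal_mono Set.inter_subset_right
        have h3 := hη i (Finset.mem_insert_self i s)
        linarith

/-- A set can be trimmed to a prescribed measure except for its atoms. Membership of finitely many
points in R n is constant along the ultrafilter, so the set A' of those that belong satisfies ν(A')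
≤ ν(R n) for almost all n, hence ν(A') ≤ t in the limit. The rest is filled up in small pieces. -/
theorem eventually_exists_subset_measureReal [StandardBorelSpace Y] [IsProbabilityMeasure ν]
    {ω : Ultrafilter ℕ} {R : ℕ → Set Y} (hR : ∀ n, MeasurableSet (R n)) {t η : ℝ}
    (ht : Tendsto (fun n => ν.real (R n)) ω (𝓝 t)) (hη : 0 < η) :
    ∀ᶠ n in (ω : Filter ℕ), ∃ R' ⊆ R n, MeasurableSet R' ∧ ν.real R' ≤ t ∧
      t - η ≤ ν.real R' := by
  classical
  obtain ⟨A, P, s, hP, hPη, hcov⟩ := exists_finite_small_cover ν hη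
  have hconst : ∀ᶠ n in (ω : Filter ℕ), ∀ a ∈ A, (a ∈ R n ↔ ∀ᶠ m in (ω : Filter ℕ), a ∈ R m) := by
    refine (Filter.eventually_all_finset A).2 fun a _ => ?_
    by_cases h : ∀ᶠ m in (ω : Filter ℕ), a ∈ R m
    · exact h.mono fun n hn => ⟨fun _ => h, fun _ => hn⟩
    · exact (Ultrafilter.eventually_not.2 h).mono fun n hn =>
        ⟨fun h' => absurd h' hn, fun h' => absurd h' h⟩
  let A' : Finset Y := A.filter fun a => ∀ᶠ m in (ω : Filter ℕ), a ∈ R m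
  have hinter : ∀ᶠ n in (ω : Filter ℕ), R n ∩ A = A' := by
    filter_upwards [hconst] with n hn
    ext y
    simp only [Set.mem_inter_iff, Finset.mem_coe, A', Finset.mem_filter]
    constructor
    · rintro ⟨h1, h2⟩
      exact ⟨h2, (hn y h2).1 h1⟩
    · rintro ⟨h1, h2⟩
      exact ⟨(hn y h1).2 h2, h1⟩
  have hA' : ν.real (A' : Set Y) ≤ t := by
    refine ge_of_tendsto ht ?_
    filter_upwards [hinter] with n hn
    rw [← hn]
    exact measureReal_mono Set.inter_subset_left
  filter_upwards [hinter, (tendsto_order.1 ht).1 (t - η) (by linarith)] with n hn hlt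
  obtain ⟨R', h1, h2, h3, h4⟩ := exists_subset_measureReal_le s hP hPη (hR n)
    A.measurableSet (t := t) (hn.symm ▸ hA')
  refine ⟨R', h1, h2, h3, h4.elim id fun h => hlt.le.trans (measureReal_mono fun y hy => ?_)⟩
  exact h ⟨hy, hcov (Set.mem_univ y)⟩

end Trim

/-! ### Cells of agreement -/

section Cells

variable {Γ : Type*} [Group Γ] [Countable Γ] {X : Type*} [MeasurableSpace X] [MulAction Γ X]
  {μ : Measure X} [MeasurableConstSMul Γ X] [SMulInvariantMeasure Γ X μ] [StandardBorelSpace X]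
  [IsProbabilityMeasure μ]
  {Λ : Type*} [Group Λ] [Countable Λ] {Y : Type*} [MeasurableSpace Y] [MulAction Λ Y]
  {ν : Measure Y} [MeasurableConstSMul Λ Y] [SMulInvariantMeasure Λ Y ν] [StandardBorelSpace Y]
  [IsProbabilityMeasure ν]

/-- An injection into the natural numbers. -/
noncomputable def code (Λ : Type*) [Countable Λ] : Λ → ℕ := (exists_injective_nat Λ).choose

theorem code_injective (Λ : Type*) [Countable Λ] : Function.Injective (code Λ) :=
  (exists_injective_nat Λ).choose_spec

/-- The elements with code less than `N`. -/
noncomputable def initialSegment (Λ : Type*) [Countable Λ] (N : ℕ) : Finset Λ :=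
  (Finset.range N).preimage (code Λ) (code_injective Λ).injOn

theorem mem_initialSegment {N : ℕ} {ψ : Λ} : ψ ∈ initialSegment Λ N ↔ code Λ ψ < N := by
  simp [initialSegment]

theorem exists_subset_initialSegment (F : Finset Λ) : ∃ N, ∀ n ≥ N, F ⊆ initialSegment Λ n := by
  refine ⟨F.sup (code Λ) + 1, fun n hn ψ hψ => mem_initialSegment.2 ?_⟩
  have := Finset.le_sup (f := code Λ) hψ
  omega

/-- The points where the transport of `φ⁻¹` agrees with `ψ⁻¹`, and with no earlier element. -/
def PointIso.cell (π : PointIso μ ν) (φ : Γ) (ψ : Λ) : Set Y :=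
  π.matchSet φ ψ \ ⋃ ψ' : Λ, ⋃ _ : code Λ ψ' < code Λ ψ, π.matchSet φ ψ'

theorem PointIso.cell_subset (π : PointIso μ ν) (φ : Γ) (ψ : Λ) :
    π.cell φ ψ ⊆ π.matchSet φ ψ := Set.sdiff_subset

theorem PointIso.measurableSet_cell (π : PointIso μ ν) (φ : Γ) (ψ : Λ) :
    MeasurableSet (π.cell φ ψ) :=
  (π.measurableSet_matchSet φ ψ).diff (MeasurableSet.iUnion fun ψ' =>
    MeasurableSet.iUnion fun _ => π.measurableSet_matchSet φ ψ')

theorem PointIso.pairwise_disjoint_cell (π : PointIso μ ν) (φ : Γ) :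
    Pairwise (Function.onFun Disjoint fun ψ : Λ => π.cell φ ψ) := by
  intro ψ ψ' hne
  rw [Function.onFun, Set.disjoint_left]
  intro y h h'
  rcases lt_or_gt_of_ne ((code_injective Λ).ne hne) with hlt | hlt
  · exact h'.2 (Set.mem_iUnion₂.2 ⟨ψ, hlt, h.1⟩)
  · exact h.2 (Set.mem_iUnion₂.2 ⟨ψ', hlt, h'.1⟩)

/-- A matched point lies in the cell of its matching element of least code, and initial segments are
closed downwards. -/
theorem PointIso.iUnion_matchSet_subset (π : PointIso μ ν) (φ : Γ) (N : ℕ) :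
    (⋃ ψ ∈ initialSegment Λ N, π.matchSet φ ψ) ⊆ ⋃ ψ ∈ initialSegment Λ N, π.cell φ ψ := by
  intro y hy
  obtain ⟨ψ, hψ, hy⟩ := Set.mem_iUnion₂.1 hy
  classical
  have hex : ∃ k, ∃ ψ : Λ, code Λ ψ = k ∧ y ∈ π.matchSet φ ψ := ⟨_, ψ, rfl, hy⟩
  obtain ⟨ψ', h1, h2⟩ := Nat.find_spec hex
  have hle : code Λ ψ' ≤ code Λ ψ := h1 ▸ Nat.find_min' hex ⟨ψ, rfl, hy⟩
  refine Set.mem_iUnion₂.2 ⟨ψ', mem_initialSegment.2 (hle.trans_lt (mem_initialSegment.1 hψ)), h2,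
    fun h => ?_⟩
  obtain ⟨ψ'', hlt, h3⟩ := Set.mem_iUnion₂.1 h
  exact Nat.find_min hex (h1 ▸ hlt) ⟨ψ'', rfl, h3⟩

theorem PointIso.sum_measureReal_cell (π : PointIso μ ν) (φ : Γ) (F : Finset Λ) :
    ∑ ψ ∈ F, ν.real (π.cell φ ψ) = ν.real (⋃ ψ ∈ F, π.cell φ ψ) :=
  (measureReal_biUnion_finset (fun _ _ _ _ h => π.pairwise_disjoint_cell φ h)
    fun ψ _ => π.measurableSet_cell φ ψ).symm

theorem Tight.exists_initialSegment {l : Filter ℕ} {π : ℕ → PointIso μ ν} (h : Tight Γ Λ l π)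
    (φ : Γ) {ε : ℝ} (hε : 0 < ε) : ∃ N, ∀ k ≥ N, ∀ᶠ n in l,
      1 - ε ≤ ∑ ψ ∈ initialSegment Λ k, ν.real ((π n).cell φ ψ) := by
  obtain ⟨F, hF⟩ := h φ ε hε
  obtain ⟨N, hN⟩ := exists_subset_initialSegment F
  refine ⟨N, fun k hk => hF.mono fun n hn => hn.trans ?_⟩
  rw [PointIso.sum_measureReal_cell]
  refine measureReal_mono (Set.Subset.trans ?_ ((π n).iUnion_matchSet_subset φ k))
    (measure_ne_top ν _)
  exact Set.biUnion_subset_biUnion_left (hN k hk)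

/-- Limits along ω of the measures of disjoint cells could a priori lose mass; tightness leaves mass
at least 1 - ε in a fixed finite set of cells, so the limits add up to 1. -/
theorem Tight.exists_weights {ω : Ultrafilter ℕ} {π : ℕ → PointIso μ ν} (h : Tight Γ Λ ω π)
    (φ : Γ) : ∃ t : Λ → ℝ,
      (∀ ψ, Tendsto (fun n => ν.real ((π n).cell φ ψ)) ω (𝓝 (t ψ))) ∧
      (∀ ψ, 0 ≤ t ψ ∧ t ψ ≤ 1) ∧ HasSum t 1 := by
  have hlim : ∀ ψ : Λ, ∃ t : ℝ, Tendsto (fun n => ν.real ((π n).cell φ ψ)) ω (𝓝 t) := by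
    intro ψ
    obtain ⟨z, -, hz⟩ := (isCompact_Icc (a := (0 : ℝ)) (b := 1)).ultrafilter_le_nhds
      (ω.map fun n => ν.real ((π n).cell φ ψ)) (le_principal_iff.2 (Filter.mem_map.2
        (Filter.univ_mem' fun n => ⟨measureReal_nonneg, measureReal_le_one⟩)))
    exact ⟨z, hz⟩
  choose t ht using hlim
  have h0 : ∀ ψ, 0 ≤ t ψ := fun ψ =>
    ge_of_tendsto' (ht ψ) fun n => measureReal_nonneg
  have hsum : ∀ F : Finset Λ, Tendsto (fun n => ∑ ψ ∈ F, ν.real ((π n).cell φ ψ)) ω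
      (𝓝 (∑ ψ ∈ F, t ψ)) := fun F => tendsto_finsetSum F fun ψ _ => ht ψ
  refine ⟨t, ht, fun ψ => ⟨h0 ψ, le_of_tendsto' (ht ψ) fun n => measureReal_le_one⟩, ?_⟩
  refine hasSum_of_isLUB_of_nonneg 1 h0 ⟨?_, fun b hb => ?_⟩
  · rintro _ ⟨F, rfl⟩
    refine le_of_tendsto' (hsum F) fun n => ?_
    rw [PointIso.sum_measureReal_cell]
    exact measureReal_le_one
  · refine le_of_forall_pos_sub_le fun ε hε => ?_
    obtain ⟨N, hN⟩ := h.exists_initialSegment φ hε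
    exact (ge_of_tendsto (hsum _) (hN N le_rfl)).trans (hb ⟨initialSegment Λ N, rfl⟩)

end Cells

/-! ### Approximation by piecewise actions -/

theorem isStarProjection_sum {A ι : Type*} [Ring A] [StarRing A] {q : ι → A} (s : Finset ι)
    (hq : ∀ i, IsStarProjection (q i)) (h : Pairwise fun i j => q i * q j = 0) :
    IsStarProjection (∑ i ∈ s, q i) := by
  classical
  refine ⟨?_, ?_⟩
  · change (∑ i ∈ s, q i) * (∑ i ∈ s, q i) = _
    rw [Finset.sum_mul_sum]
    refine Finset.sum_congr rfl fun i hi => ?_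
    rw [Finset.sum_eq_single_of_mem i hi fun j _ hj => h hj.symm]
    exact (hq i).1
  · change star _ = _
    rw [star_sum]
    exact Finset.sum_congr rfl fun i _ => (hq i).2

theorem TraceIso.apply_mul_eq_apply_mul {A : Type*} [Ring A] [StarRing A] [Algebra ℂ A]
    {τ : A → ℂ} {σ α : TraceIso τ τ} {q a p b c : A} (h1 : σ q = p) (h2 : α q = p) (h3 : σ a = b)
    (h4 : α a = c) (h5 : p * b = p * c) : σ (q * a) = α (q * a) := by
  rw [σ.apply_mul, α.apply_mul, h1, h2, h3, h4, h5]

namespace PartialIso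

variable {A : Type*} [Ring A] [StarRing A] [Algebra ℂ A] {τ : A → ℂ}

/-- The restriction of an automorphism of an abelian algebra to a projection. -/
def restrict (hA : ∀ a b : A, a * b = b * a) (σ : TraceIso τ τ) (e : A) (he : IsStarProjection e) :
    PartialIso τ where
  supp := e
  map :=
    { toFun := fun a => σ (e * a)
      map_smul' := fun c a => by
        rw [mul_smul_comm]; exact map_smul σ.toStarAlgEquiv c (e * a)
      map_zero' := by rw [mul_zero]; exact σ.apply_zero
      map_add' := fun a b => by rw [mul_add]; exact map_add σ.toStarAlgEquiv _ _
      map_mul' := fun a b => by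
        have h : e * a * (e * b) = e * (a * b) := by
          rw [mul_assoc e a, ← mul_assoc a e b, hA a e, mul_assoc e a b, ← mul_assoc e e, he.1]
        rw [← σ.apply_mul, h]
      map_star' := fun a => by
        rw [hA e (star a)]
        nth_rewrite 1 [← he.2]
        rw [← star_mul]
        exact map_star σ.toStarAlgEquiv (e * a) }
  isProj := he
  map_supp_mul := fun a => by
    change σ (e * (e * a)) = σ (e * a)
    rw [← mul_assoc, he.1]
  injOn := fun a h =>
    (map_eq_zero_iff σ.toStarAlgEquiv σ.toStarAlgEquiv.injective).1 h
  surjOn := fun b => ⟨σ.symm b, by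
    change σ (e * σ.symm b) = σ (e * e) * b
    rw [he.1, σ.apply_mul, σ.apply_symm_apply]⟩
  trace_map := fun a => σ.trace_apply (e * a)

theorem restrict_map (hA : ∀ a b : A, a * b = b * a) (σ : TraceIso τ τ) (e : A)
    (he : IsStarProjection e) (a : A) : (restrict hA σ e he).map a = σ (e * a) := rfl

theorem restrict_isDirectSum (hA : ∀ a b : A, a * b = b * a) (σ : TraceIso τ τ) {ι : Type*}
    {q : ι → A} (s : Finset ι) (hq : ∀ i, IsStarProjection (q i))
    (hqq : Pairwise fun i j => q i * q j = 0) (hs : ∀ i, i ∉ s → q i = 0)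
    (α : ι → TraceIso τ τ) (hα : ∀ i a, σ (q i * a) = α i (q i * a)) :
    (restrict hA σ (∑ i ∈ s, q i) (isStarProjection_sum s hq hqq)).IsDirectSum α q := by
  classical
  have heq : ∀ i, (∑ j ∈ s, q j) * q i = q i := by
    intro i
    by_cases hi : i ∈ s
    · rw [Finset.sum_mul, Finset.sum_eq_single_of_mem i hi fun j _ hj => hqq hj]
      exact (hq i).1
    · rw [hs i hi, mul_zero]
  refine ⟨heq, fun f _ hfq => ?_, fun i a => ?_⟩
  · change f * ∑ i ∈ s, q i = ∑ i ∈ s, q i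
    rw [Finset.mul_sum]
    exact Finset.sum_congr rfl fun i _ => hfq i
  · rw [restrict_map, ← mul_assoc, heq i, hα]

theorem dist2_ofAut_restrict_le (hA : ∀ a b : A, a * b = b * a) (σ : TraceIso τ τ) {e : A}
    (he : IsStarProjection e) (h1 : (τ 1).re = 1)
    (hb : BddAbove {t | ∃ p : A, IsStarProjection p ∧ (ofAut σ).supp * p = p ∧
      (restrict hA σ e he).supp * p = p ∧
      (∀ a, (ofAut σ).map (p * a) = (restrict hA σ e he).map (p * a)) ∧ t = (τ p).re})
    {ε : ℝ} (hε : 0 ≤ ε) (hτ : 1 - ε ^ 2 ≤ (τ e).re) :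
    (ofAut σ).dist2 (restrict hA σ e he) ≤ ε := by
  refine Real.sqrt_le_iff.2 ⟨hε, ?_⟩
  have h2 : (τ e).re ≤ (ofAut σ).agreement (restrict hA σ e he) := by
    refine le_csSup hb ⟨e, he, one_mul e, he.1, fun a => ?_, rfl⟩
    change σ (e * a) = σ (e * (e * a))
    rw [← mul_assoc e e a, he.1]
  have h3 : (τ (ofAut σ).supp).re = 1 := h1
  have h4 : (restrict hA σ e he).supp = e := rfl
  rw [h3, h4]
  linarith

end PartialIso

section Approximation

variable {Γ : Type*} [Group Γ] [Countable Γ] {X : Type*} [MeasurableSpace X] [MulAction Γ X]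
  {μ : Measure X} [MeasurableConstSMul Γ X] [SMulInvariantMeasure Γ X μ] [StandardBorelSpace X]
  [IsProbabilityMeasure μ]
  {Λ : Type*} [Group Λ] [Countable Λ] {Y : Type*} [MeasurableSpace Y] [MulAction Λ Y]
  {ν : Measure Y} [MeasurableConstSMul Λ Y] [SMulInvariantMeasure Λ Y ν] [StandardBorelSpace Y]
  [IsProbabilityMeasure ν]

variable (Γ μ) in
/-- The trace of `L^∞(X)` as a linear map. -/
noncomputable def cartanTrLinear : cartan Γ μ →ₗ[ℂ] ℂ where
  toFun := cartanTr Γ μ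
  map_add' a b := (orbitVNA Γ μ).tr_add a b
  map_smul' c a := (orbitVNA Γ μ).tr_smul c a

theorem cartanTr_sum {ι : Type*} (s : Finset ι) (a : ι → cartan Γ μ) :
    cartanTr Γ μ (∑ i ∈ s, a i) = ∑ i ∈ s, cartanTr Γ μ (a i) :=
  map_sum (cartanTrLinear Γ μ) a s

theorem cartanTr_zero : cartanTr Γ μ 0 = 0 := map_zero (cartanTrLinear Γ μ)

theorem exists_proj_of_isStarProjection {e : cartan Γ μ} (he : IsStarProjection e) :
    ∃ (s : Set X) (hs : MeasurableSet s), e = proj hs ∧ (cartanTr Γ μ e).re = μ.real s := by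
  obtain ⟨s, hs, rfl⟩ := exists_eq_proj he.1
  exact ⟨s, hs, rfl, by rw [cartanTr_proj, Complex.ofReal_re]⟩

theorem cartanTr_re_nonneg {e : cartan Γ μ} (he : IsStarProjection e) :
    0 ≤ (cartanTr Γ μ e).re := by
  obtain ⟨s, hs, -, h⟩ := exists_proj_of_isStarProjection he
  rw [h]; exact measureReal_nonneg

theorem cartanTr_re_le_of_mul_eq {e f : cartan Γ μ} (he : IsStarProjection e)
    (hf : IsStarProjection f) (h : f * e = e) : (cartanTr Γ μ e).re ≤ (cartanTr Γ μ f).re := by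
  obtain ⟨s, hs, rfl, h1⟩ := exists_proj_of_isStarProjection he
  obtain ⟨t, ht, rfl, h2⟩ := exists_proj_of_isStarProjection hf
  rw [h1, h2]
  rw [proj_mul ht hs, proj_eq_proj_iff] at h
  rw [← measureReal_congr h]
  exact measureReal_mono Set.inter_subset_left

theorem cartanTr_one : (cartanTr Γ μ 1).re = 1 := by
  rw [← proj_univ, cartanTr_proj, probReal_univ, Complex.ofReal_one, Complex.one_re]

theorem bddAbove_agreement (α β : PartialIso (cartanTr Γ μ)) :
    BddAbove {t | ∃ p : cartan Γ μ, IsStarProjection p ∧ α.supp * p = p ∧ β.supp * p = p ∧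
      (∀ a, α.map (p * a) = β.map (p * a)) ∧ t = (cartanTr Γ μ p).re} := by
  refine ⟨(cartanTr Γ μ β.supp).re, ?_⟩
  rintro _ ⟨p, hp, -, h, -, rfl⟩
  exact cartanTr_re_le_of_mul_eq hp β.isProj h

theorem agreement_le (α β : PartialIso (cartanTr Γ μ)) :
    α.agreement β ≤ (cartanTr Γ μ β.supp).re := by
  refine csSup_le ⟨0, 0, IsStarProjection.zero _, mul_zero _, mul_zero _, ?_, ?_⟩ ?_
  · intro a; rw [zero_mul, map_zero, map_zero]
  · rw [cartanTr_zero, Complex.zero_re]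
  · rintro _ ⟨p, hp, -, h, -, rfl⟩
    exact cartanTr_re_le_of_mul_eq hp β.isProj h

/-- `φ` is transported by `θ`, up to `ε`, to a piecewise action of `Λ` whose pieces have measure
at most `t`. -/
def Approximable (θ : TraceIso (cartanTr Γ μ) (cartanTr Λ ν)) (φ : Γ) (t : Λ → ℝ) (ε : ℝ)
    (q : Λ → cartan Λ ν) : Prop :=
  DisjointProjections (actionAut Λ ν) q ∧ (∀ ψ, (cartanTr Λ ν (q ψ)).re ≤ t ψ) ∧
    ∃ β : PartialIso (cartanTr Λ ν), β.IsDirectSum (actionAut Λ ν) q ∧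
      (PartialIso.ofAut (θ.conj (actionAut Γ μ φ))).dist2 β ≤ ε

theorem Realizes.conj_fn {π : PointIso μ ν} {θ : TraceIso (cartanTr Γ μ) (cartanTr Λ ν)}
    (h : Realizes π θ) (φ : Γ) {f : Y → ℂ} (hf : BddMeasurable f) :
    θ.conj (actionAut Γ μ φ) (fn hf) = fn (hf.comp (π.measurable_conj φ)) := by
  change θ (actionAut Γ μ φ (θ.symm (fn hf))) = _
  rw [h.symm f hf, actionAut_fn (hf.comp π.symm.mp_fwd.measurable), h]
  rfl

theorem PointIso.measurePreserving_conj (π : PointIso μ ν) (φ : Γ) :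
    MeasurePreserving (π.conj φ) ν ν :=
  π.mp_inv.comp ((measurePreserving_smul φ⁻¹ μ).comp π.mp_fwd)

theorem Realizes.conj_proj {π : PointIso μ ν} {θ : TraceIso (cartanTr Γ μ) (cartanTr Λ ν)}
    (h : Realizes π θ) (φ : Γ) {s : Set Y} (hs : MeasurableSet s) :
    θ.conj (actionAut Γ μ φ) (proj hs) = proj (π.measurable_conj φ hs) :=
  h.conj_fn φ (bddMeasurable_indicator hs)

theorem actionAut_proj (g : Γ) {s : Set X} (hs : MeasurableSet s) :
    actionAut Γ μ g (proj hs) = proj (measurable_const_smul (α := X) g⁻¹ hs) :=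
  actionAut_fn (bddMeasurable_indicator hs) g

variable (ν) in
/-- The projection `q` of `L^∞(Y)` with `ψ(q) = 1_R`. -/
noncomputable def pullProj (ψ : Λ) {R : Set Y} (hR : MeasurableSet R) : cartan Λ ν :=
  proj (measurable_const_smul (α := Y) ψ hR)

theorem actionAut_pullProj (ψ : Λ) {R : Set Y} (hR : MeasurableSet R) :
    actionAut Λ ν ψ (pullProj ν ψ hR) = proj hR := by
  unfold pullProj
  rw [actionAut_proj]
  congr 1
  ext y
  change ψ • ψ⁻¹ • y ∈ R ↔ y ∈ R
  rw [smul_inv_smul]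

theorem cartanTr_pullProj (ψ : Λ) {R : Set Y} (hR : MeasurableSet R) :
    (cartanTr Λ ν (pullProj ν ψ hR)).re = ν.real R := by
  rw [← (actionAut Λ ν ψ).trace_apply, actionAut_pullProj, cartanTr_proj, Complex.ofReal_re]

/-- The preimage of ψ⁻¹R under `conj φ` contains R because the map agrees with ψ⁻¹ there; it has the
same measure as R, so nothing else is contained in it up to null sets. -/
theorem Realizes.conj_pullProj {π : PointIso μ ν} {θ : TraceIso (cartanTr Γ μ) (cartanTr Λ ν)}
    (h : Realizes π θ) (φ : Γ) (ψ : Λ) {R : Set Y} (hR : MeasurableSet R)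
    (hRm : R ⊆ π.matchSet φ ψ) : θ.conj (actionAut Γ μ φ) (pullProj ν ψ hR) = proj hR := by
  unfold pullProj
  rw [h.conj_proj, proj_eq_proj_iff]
  have hsub : R ⊆ π.conj φ ⁻¹' ((fun y => ψ • y) ⁻¹' R) := fun y hy => by
    change ψ • π.conj φ y ∈ R
    rw [show π.conj φ y = ψ⁻¹ • y from hRm hy, smul_inv_smul]
    exact hy
  have hm : MeasurableSet ((fun y => ψ • y) ⁻¹' R) := measurable_const_smul (α := Y) ψ hR
  refine (ae_eq_of_subset_of_measure_ge hsub ?_ hR.nullMeasurableSet (measure_ne_top _ _)).symm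
  rw [(π.measurePreserving_conj φ).measure_preimage hm.nullMeasurableSet,
    (measurePreserving_smul ψ ν).measure_preimage hR.nullMeasurableSet]

theorem proj_mul_fn_congr {s : Set X} (hs : MeasurableSet s) {f g : X → ℂ} (hf : BddMeasurable f)
    (hg : BddMeasurable g) (h : ∀ x ∈ s, f x = g x) :
    (proj hs * fn hf : cartan Γ μ) = proj hs * fn hg := by
  unfold proj
  rw [← fn_mul (bddMeasurable_indicator hs) hf, ← fn_mul (bddMeasurable_indicator hs) hg,
    fn_eq_fn_iff]
  refine Eventually.of_forall fun x => ?_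
  by_cases hx : x ∈ s
  · simp only [Pi.mul_apply]
    rw [h x hx]
  · simp [hx]

theorem Realizes.conj_pullProj_mul {π : PointIso μ ν}
    {θ : TraceIso (cartanTr Γ μ) (cartanTr Λ ν)}
    (h : Realizes π θ) (φ : Γ) (ψ : Λ) {R : Set Y} (hR : MeasurableSet R)
    (hRm : R ⊆ π.matchSet φ ψ) (a : cartan Λ ν) :
    θ.conj (actionAut Γ μ φ) (pullProj ν ψ hR * a) = actionAut Λ ν ψ (pullProj ν ψ hR * a) := by
  obtain ⟨f, hf, rfl⟩ := exists_eq_fn a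
  exact TraceIso.apply_mul_eq_apply_mul (h.conj_pullProj φ ψ hR hRm) (actionAut_pullProj ψ hR)
    (h.conj_fn φ hf) (actionAut_fn hf ψ)
    (proj_mul_fn_congr hR _ _ fun y hy => congrArg f (hRm hy))

theorem Realizes.exists_approximable {π : PointIso μ ν}
    {θ : TraceIso (cartanTr Γ μ) (cartanTr Λ ν)} (h : Realizes π θ) (φ : Γ) {t : Λ → ℝ}
    (ht : ∀ ψ, 0 ≤ t ψ) (F : Finset Λ) {η ε : ℝ} (hε : 0 ≤ ε)
    (hF : ∀ ψ ∈ F, ∃ R ⊆ π.cell φ ψ, MeasurableSet R ∧ ν.real R ≤ t ψ ∧ t ψ - η ≤ ν.real R)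
    (hη : 1 - ε ^ 2 ≤ ∑ ψ ∈ F, (t ψ - η)) : ∃ q, Approximable θ φ t ε q := by
  classical
  -- Outside F the pieces are empty, which makes the direct sum over Λ a finite sum.
  have hF' : ∀ ψ, ∃ R ⊆ π.cell φ ψ, MeasurableSet R ∧ ν.real R ≤ t ψ ∧
      (ψ ∈ F → t ψ - η ≤ ν.real R) ∧ (ψ ∉ F → R = ∅) := by
    intro ψ
    by_cases hψ : ψ ∈ F
    · obtain ⟨R, h1, h2, h3, h4⟩ := hF ψ hψ
      exact ⟨R, h1, h2, h3, fun _ => h4, fun h => absurd hψ h⟩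
    · exact ⟨∅, Set.empty_subset _, MeasurableSet.empty, by simpa using ht ψ,
        fun h => absurd h hψ, fun _ => rfl⟩
  choose R hRc hRm hRt hRη hR0 using hF'
  have hRs : ∀ ψ, R ψ ⊆ π.matchSet φ ψ := fun ψ => (hRc ψ).trans (π.cell_subset φ ψ)
  set σ := θ.conj (actionAut Γ μ φ) with hσ
  let q : Λ → cartan Λ ν := fun ψ => pullProj ν ψ (hRm ψ)
  have hqp : ∀ ψ, IsStarProjection (q ψ) := fun ψ => isStarProjection_proj _
  have hdisj : Pairwise fun ψ ψ' => (proj (hRm ψ) * proj (hRm ψ') : cartan Λ ν) = 0 := by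
    intro ψ ψ' hne
    rw [proj_mul (hRm ψ) (hRm ψ'), ← proj_empty, proj_eq_proj_iff]
    rw [((π.pairwise_disjoint_cell φ hne).mono (hRc ψ) (hRc ψ')).inter_eq]
    exact ae_eq_refl _
  -- Only the images σ(q ψ) = 1_{R ψ} are visibly orthogonal, the cells being disjoint; injectivity
  -- of σ carries this back.
  have hq1 : Pairwise fun ψ ψ' => q ψ * q ψ' = 0 := by
    intro ψ ψ' hne
    refine (map_eq_zero_iff σ.toStarAlgEquiv σ.toStarAlgEquiv.injective).1 ?_
    refine (σ.apply_mul _ _).trans ?_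
    rw [h.conj_pullProj φ ψ (hRm ψ) (hRs ψ), h.conj_pullProj φ ψ' (hRm ψ') (hRs ψ')]
    exact hdisj hne
  have hq2 : Pairwise fun ψ ψ' => actionAut Λ ν ψ (q ψ) * actionAut Λ ν ψ' (q ψ') = 0 := by
    intro ψ ψ' hne
    simp only [q, actionAut_pullProj]
    exact hdisj hne
  have hq0 : ∀ ψ, ψ ∉ F → q ψ = 0 := by
    intro ψ hψ
    refine (map_eq_zero_iff σ.toStarAlgEquiv σ.toStarAlgEquiv.injective).1 ?_
    refine (h.conj_pullProj φ ψ (hRm ψ) (hRs ψ)).trans ?_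
    rw [← proj_empty, proj_eq_proj_iff, hR0 ψ hψ]
    exact ae_eq_refl _
  refine ⟨q, ⟨hqp, hq1, hq2⟩, fun ψ => (cartanTr_pullProj ψ (hRm ψ)).trans_le (hRt ψ), _,
    PartialIso.restrict_isDirectSum cartan_mul_comm σ F hqp hq1 hq0 _ fun ψ a =>
      h.conj_pullProj_mul φ ψ (hRm ψ) (hRs ψ) a,
    PartialIso.dist2_ofAut_restrict_le cartan_mul_comm σ _ cartanTr_one
      (bddAbove_agreement _ _) hε ?_⟩
  rw [cartanTr_sum, Complex.re_sum]
  exact hη.trans (Finset.sum_le_sum fun ψ hψ =>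
    (hRη ψ hψ).trans_eq (cartanTr_pullProj ψ (hRm ψ)).symm)

theorem Tight.exists_approximable {ω : Ultrafilter ℕ} {π : ℕ → PointIso μ ν}
    (h : Tight Γ Λ ω π) {θ : ℕ → TraceIso (cartanTr Γ μ) (cartanTr Λ ν)}
    (hπ : ∀ n, Realizes (π n) (θ n)) : ∃ t : Γ → Λ → ℝ, (∀ φ, HasSum (t φ) 1) ∧
      (∀ φ ψ, 0 ≤ t φ ψ ∧ t φ ψ ≤ 1) ∧ ∀ φ ε, 0 < ε →
        ∀ᶠ n in (ω : Filter ℕ), ∃ q, Approximable (θ n) φ (t φ) ε q := by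
  choose t ht h01 hsum using h.exists_weights
  refine ⟨t, hsum, h01, fun φ ε hε => ?_⟩
  obtain ⟨F, hF⟩ := ((tendsto_order.1 (hsum φ)).1 (1 - ε ^ 2 / 2)
    (by have := sq_pos_of_pos hε; linarith)).exists
  -- The weights outside F cost ε²/2 and the trimming, η for each element of F, costs at most ε²/2.
  -- The total is ε² because the squared distance is the missing trace.
  set η : ℝ := ε ^ 2 / (2 * (F.card + 1)) with hη
  have hη0 : 0 < η := by positivity
  have hηF : F.card * η ≤ ε ^ 2 / 2 := by
    rw [hη, mul_div_assoc', div_le_div_iff₀ (by positivity) (by positivity)]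
    nlinarith [sq_nonneg ε]
  have hev : ∀ᶠ n in (ω : Filter ℕ), ∀ ψ ∈ F, ∃ R ⊆ (π n).cell φ ψ, MeasurableSet R ∧
      ν.real R ≤ t φ ψ ∧ t φ ψ - η ≤ ν.real R :=
    (Filter.eventually_all_finset F).2 fun ψ _ => eventually_exists_subset_measureReal
      (fun n => (π n).measurableSet_cell φ ψ) (ht φ ψ) hη0
  filter_upwards [hev] with n hn
  refine (hπ n).exists_approximable φ (fun ψ => (h01 φ ψ).1) F hε.le hn ?_
  rw [Finset.sum_sub_distrib, Finset.sum_const, nsmul_eq_mul]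
  linarith

end Approximation

/-! ### From the local criterion to the sequential one, and to tightness -/

theorem PartialIso.eq_on_mul {A : Type*} [Ring A] [StarRing A] [Algebra ℂ A] {τ : A → ℂ}
    (hA : ∀ a b : A, a * b = b * a) {σ α : TraceIso τ τ} {β : PartialIso τ} {p q r : A}
    (hp : ∀ a, σ (p * a) = β.map (p * a)) (hq : ∀ a, β.map (q * a) = α (q * a)) (hr : r = p * q)
    (a : A) : σ (r * a) = α (r * a) := by
  rw [hr, mul_assoc, hp, ← mul_assoc, hA p q, mul_assoc, hq]

theorem PartialIso.exists_lt_of_lt_agreement {A : Type*} [Ring A] [StarRing A] [Algebra ℂ A]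
    {τ : A → ℂ} (h0 : τ 0 = 0) {σ : TraceIso τ τ} {β : PartialIso τ} {c : ℝ}
    (h : c < (ofAut σ).agreement β) : ∃ p, IsStarProjection p ∧ β.supp * p = p ∧
      (∀ a, σ (p * a) = β.map (p * a)) ∧ c < (τ p).re := by
  obtain ⟨_, ⟨p, hp, -, hp2, hp3, rfl⟩, hlt⟩ := exists_lt_of_lt_csSup
    (by
      refine ⟨0, 0, IsStarProjection.zero _, mul_zero _, mul_zero _, fun a => ?_, ?_⟩
      · rw [zero_mul, map_zero, map_zero]
      · rw [h0, Complex.zero_re]) h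
  exact ⟨p, hp, hp2, hp3, hlt⟩

section Sequential

variable {Γ : Type*} [Group Γ] [Countable Γ] {X : Type*} [MeasurableSpace X] [MulAction Γ X]
  {μ : Measure X} [MeasurableConstSMul Γ X] [SMulInvariantMeasure Γ X μ] [StandardBorelSpace X]
  [IsProbabilityMeasure μ]
  {Λ : Type*} [Group Λ] [Countable Λ] {Y : Type*} [MeasurableSpace Y] [MulAction Λ Y]
  {ν : Measure Y} [MeasurableConstSMul Λ Y] [SMulInvariantMeasure Λ Y ν] [StandardBorelSpace Y]
  [IsProbabilityMeasure ν]

/-- The union of the sets of the q ψ dominates each q ψ, so by the supremum clause of `IsDirectSum`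
it dominates the support; countable subadditivity does the rest. The bound by t makes the series
summable, so that `tsum` is not the default 0. -/
theorem cartanTr_supp_le_tsum {β : PartialIso (cartanTr Λ ν)} {q : Λ → cartan Λ ν}
    (hq : ∀ ψ, IsStarProjection (q ψ)) (hβ : β.IsDirectSum (actionAut Λ ν) q) {t : Λ → ℝ}
    (ht : Summable t) (hqt : ∀ ψ, (cartanTr Λ ν (q ψ)).re ≤ t ψ) :
    (cartanTr Λ ν β.supp).re ≤ ∑' ψ, (cartanTr Λ ν (q ψ)).re := by
  obtain ⟨S, hS, hS1, hS2⟩ := exists_proj_of_isStarProjection β.isProj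
  choose Q hQ hQ1 hQ2 using fun ψ => exists_proj_of_isStarProjection (hq ψ)
  have hU : MeasurableSet (⋃ ψ, Q ψ) := MeasurableSet.iUnion hQ
  have h1 := hβ.2.1 (proj hU) (isStarProjection_proj hU) fun ψ => by
    rw [hQ1 ψ, proj_mul hU (hQ ψ), proj_eq_proj_iff,
      Set.inter_eq_right.2 (Set.subset_iUnion Q ψ)]
    exact ae_eq_refl _
  rw [hS1, proj_mul hU hS, proj_eq_proj_iff] at h1
  have hsum : Summable fun ψ => (cartanTr Λ ν (q ψ)).re :=
    Summable.of_nonneg_of_le (fun ψ => cartanTr_re_nonneg (hq ψ)) hqt ht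
  have h2 : ν S ≤ ENNReal.ofReal (∑' ψ, (cartanTr Λ ν (q ψ)).re) := by
    rw [ENNReal.ofReal_tsum_of_nonneg (fun ψ => cartanTr_re_nonneg (hq ψ)) hsum]
    calc ν S = ν ((⋃ ψ, Q ψ) ∩ S) := (measure_congr h1).symm
      _ ≤ ν (⋃ ψ, Q ψ) := measure_mono Set.inter_subset_left
      _ ≤ ∑' ψ, ν (Q ψ) := measure_iUnion_le Q
      _ = _ := tsum_congr fun ψ => by rw [hQ2 ψ, ofReal_measureReal]
  rw [hS2]
  exact ENNReal.toReal_le_of_le_ofReal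
    (tsum_nonneg fun ψ => cartanTr_re_nonneg (hq ψ)) h2

theorem one_sub_sq_le_cartanTr_supp {σ : TraceIso (cartanTr Λ ν) (cartanTr Λ ν)}
    {β : PartialIso (cartanTr Λ ν)} {ε : ℝ} (h : (PartialIso.ofAut σ).dist2 β ≤ ε) :
    1 - ε ^ 2 ≤ (cartanTr Λ ν β.supp).re := by
  have h1 := (Real.sqrt_le_iff.1 h).2
  have h2 : (cartanTr Λ ν (PartialIso.ofAut σ).supp).re = 1 := cartanTr_one
  have h3 := agreement_le (PartialIso.ofAut σ) β
  rw [h2] at h1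
  linarith

/-- The deficits t ψ - τ(q ψ) are nonnegative and sum to at most ε², since the t ψ sum to 1 while
the q ψ cover trace 1 - ε². Hence each single deficit is at most ε²: upper bounds of total mass 1
also act as lower bounds. -/
theorem Approximable.sub_le {θ : TraceIso (cartanTr Γ μ) (cartanTr Λ ν)} {φ : Γ} {t : Λ → ℝ}
    {ε : ℝ} {q : Λ → cartan Λ ν} (h : Approximable θ φ t ε q) (ht : HasSum t 1) (ψ : Λ) :
    t ψ - ε ^ 2 ≤ (cartanTr Λ ν (q ψ)).re := by
  obtain ⟨⟨hq, -, -⟩, hqt, β, hβ, hd⟩ := h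
  have h1 := (one_sub_sq_le_cartanTr_supp hd).trans
    (cartanTr_supp_le_tsum hq hβ ht.summable hqt)
  have hsum : Summable fun ψ => (cartanTr Λ ν (q ψ)).re :=
    Summable.of_nonneg_of_le (fun ψ => cartanTr_re_nonneg (hq ψ)) hqt ht.summable
  have h2 := (ht.summable.sub hsum).le_tsum ψ fun ψ' _ => sub_nonneg.2 (hqt ψ')
  rw [ht.summable.tsum_sub hsum, ht.tsum_eq] at h2
  linarith

theorem disjointProjections_zero : DisjointProjections (actionAut Λ ν) fun _ => 0 :=
  ⟨fun _ => IsStarProjection.zero _, fun _ _ _ => mul_zero _, fun ψ ψ' _ => by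
    change actionAut Λ ν ψ 0 * actionAut Λ ν ψ' 0 = 0
    rw [TraceIso.apply_zero, zero_mul]⟩

theorem exists_isDirectSum_zero : ∃ β : PartialIso (cartanTr Λ ν),
    β.IsDirectSum (actionAut Λ ν) fun _ => 0 :=
  ⟨_, PartialIso.restrict_isDirectSum (ι := Λ) cartan_mul_comm (actionAut Λ ν 1) ∅
    (fun _ => IsStarProjection.zero _) (fun _ _ _ => mul_zero _) (fun _ _ => rfl) _ fun ψ a => by
      rw [zero_mul, TraceIso.apply_zero, TraceIso.apply_zero]⟩

/-- Good approximations on larger and larger finite sets give approximating sequences. -/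
theorem exists_sequence_of_approximable {θ : ℕ → TraceIso (cartanTr Γ μ) (cartanTr Λ ν)}
    {t : Γ → Λ → ℝ} (ht : ∀ φ, HasSum (t φ) 1)
    (h : ∀ n, ∀ φ ∈ initialSegment Γ n, ∃ q, Approximable (θ n) φ (t φ) (1 / (n + 1)) q) :
    ∃ (q : Γ → ℕ → Λ → cartan Λ ν) (β : Γ → ℕ → PartialIso (cartanTr Λ ν)),
      (∀ φ n, DisjointProjections (actionAut Λ ν) (q φ n) ∧
        (β φ n).IsDirectSum (actionAut Λ ν) (q φ n)) ∧
      (∀ φ, Tendsto (fun n => (PartialIso.ofAut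
        ((θ n).conj (actionAut Γ μ φ))).dist2 (β φ n)) atTop (𝓝 0)) ∧
      (∀ φ, HasSum (fun ψ => liminf (fun n => (cartanTr Λ ν (q φ n ψ)).re) atTop) 1) := by
  have h' : ∀ φ n, ∃ (q : Λ → cartan Λ ν) (β : PartialIso (cartanTr Λ ν)),
      (DisjointProjections (actionAut Λ ν) q ∧ β.IsDirectSum (actionAut Λ ν) q) ∧
      (φ ∈ initialSegment Γ n →
        (PartialIso.ofAut ((θ n).conj (actionAut Γ μ φ))).dist2 β ≤ 1 / (n + 1) ∧
        ∀ ψ, (cartanTr Λ ν (q ψ)).re ≤ t φ ψ ∧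
          t φ ψ - (1 / ((n : ℝ) + 1)) ^ 2 ≤ (cartanTr Λ ν (q ψ)).re) := by
    intro φ n
    by_cases hφ : φ ∈ initialSegment Γ n
    · obtain ⟨q, hq⟩ := h n φ hφ
      have hsub := hq.sub_le (ht φ)
      obtain ⟨h1, h2, β, h3, h4⟩ := hq
      exact ⟨q, β, ⟨h1, h3⟩, fun _ => ⟨h4, fun ψ => ⟨h2 ψ, hsub ψ⟩⟩⟩
    -- The finitely many indices n before φ enters the initial segment carry no requirement and are
    -- filled with zero.
    · obtain ⟨β, hβ⟩ := exists_isDirectSum_zero (Λ := Λ) (ν := ν)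
      exact ⟨_, β, ⟨disjointProjections_zero, hβ⟩, fun h => absurd h hφ⟩
  choose q β h1 h2 using h'
  have hev : ∀ φ, ∀ᶠ n in atTop, φ ∈ initialSegment Γ n := fun φ => by
    filter_upwards [eventually_gt_atTop (code Γ φ)] with n hn using mem_initialSegment.2 hn
  have hlim := tendsto_one_div_add_atTop_nhds_zero_nat (𝕜 := ℝ)
  refine ⟨q, β, h1, fun φ => ?_, fun φ => ?_⟩
  · refine squeeze_zero' (Eventually.of_forall fun n => Real.sqrt_nonneg _) ?_ hlim
    filter_upwards [hev φ] with n hn using (h2 φ n hn).1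
  · have htend : ∀ ψ, Tendsto (fun n => (cartanTr Λ ν (q φ n ψ)).re) atTop (𝓝 (t φ ψ)) := by
      intro ψ
      have h3 : Tendsto (fun n : ℕ => t φ ψ - (1 / ((n : ℝ) + 1)) ^ 2) atTop (𝓝 (t φ ψ)) := by
        simpa using tendsto_const_nhds.sub (hlim.pow 2)
      refine tendsto_of_tendsto_of_tendsto_of_le_of_le' h3 tendsto_const_nhds ?_ ?_
      · filter_upwards [hev φ] with n hn using ((h2 φ n hn).2 ψ).2
      · filter_upwards [hev φ] with n hn using ((h2 φ n hn).2 ψ).1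
    have e : (fun ψ => liminf (fun n => (cartanTr Λ ν (q φ n ψ)).re) atTop) = t φ :=
      funext fun ψ => (htend ψ).liminf_eq
    rw [e]
    exact ht φ

/-- If the transport of `φ` and `ψ` coincide under the projection `1_D`, then `ψ D` consists of
points of agreement. -/
theorem Realizes.ae_mem_matchSet {π : PointIso μ ν}
    {θ : TraceIso (cartanTr Γ μ) (cartanTr Λ ν)} (h : Realizes π θ) (φ : Γ) (ψ : Λ) {D : Set Y}
    (hD : MeasurableSet D)
    (hDa : ∀ a, θ.conj (actionAut Γ μ φ) (proj hD * a) = actionAut Λ ν ψ (proj hD * a)) :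
    ∀ᵐ y ∂ν, π.conj φ y ∈ D → y ∈ π.matchSet φ ψ := by
  obtain ⟨c, hc, hinj⟩ := MeasurableSpace.measurable_injection_nat_bool_of_countablySeparated Y
  have hCi : ∀ i, MeasurableSet {x | c x i = true} := fun i =>
    ((measurable_pi_apply i).comp hc) (measurableSet_singleton true)
  have hset : ∀ C, MeasurableSet C →
      ∀ᵐ y ∂ν, (π.conj φ y ∈ D ∩ C ↔ ψ⁻¹ • y ∈ D ∩ C) := by
    intro C hC
    have h1 := hDa (proj hC)
    rw [proj_mul hD hC, h.conj_proj φ (hD.inter hC), actionAut_proj ψ (hD.inter hC),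
      proj_eq_proj_iff] at h1
    exact h1.mono fun y hy => iff_of_eq hy
  -- The bits of a countable separating code identify points of D; the instance with the whole space
  -- supplies membership of ψ⁻¹y in D itself.
  filter_upwards [ae_all_iff.2 fun i => hset _ (hCi i), hset _ MeasurableSet.univ]
    with y hy hy' hyD
  have hyD' : ψ⁻¹ • y ∈ D := (hy'.1 ⟨hyD, Set.mem_univ _⟩).1
  refine hinj (funext fun i => Bool.eq_iff_iff.2 ⟨fun hi => ?_, fun hi => ?_⟩)
  · exact ((hy i).1 ⟨hyD, hi⟩).2
  · exact ((hy i).2 ⟨hyD', hi⟩).2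

/-- The trace of the support of β is at least the agreement, so 1 + τ(supp β) - 2·agreement < δ
already forces the agreement above 1 - δ. -/
theorem exists_agreement {σ : TraceIso (cartanTr Λ ν) (cartanTr Λ ν)}
    {β : PartialIso (cartanTr Λ ν)} {δ : ℝ} (h : (PartialIso.ofAut σ).dist2 β ^ 2 < δ) :
    ∃ p : cartan Λ ν, IsStarProjection p ∧ β.supp * p = p ∧
      (∀ a, σ (p * a) = β.map (p * a)) ∧ 1 - δ < (cartanTr Λ ν p).re := by
  have h1 : 1 + (cartanTr Λ ν β.supp).re - 2 * (PartialIso.ofAut σ).agreement β < δ := by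
    have h2 : (cartanTr Λ ν (PartialIso.ofAut σ).supp).re = 1 := cartanTr_one
    rw [PartialIso.dist2, h2] at h
    refine lt_of_le_of_lt ?_ h
    -- `Real.sqrt` sends negative numbers to 0, so squaring it recovers the radicand only when that
    -- is nonnegative.
    rcases le_total 0 (1 + (cartanTr Λ ν β.supp).re - 2 * (PartialIso.ofAut σ).agreement β)
      with h3 | h3
    · rw [Real.sq_sqrt h3]
    · exact h3.trans (sq_nonneg _)
  have h2 := agreement_le (PartialIso.ofAut σ) β
  have h3 : 1 - δ < (PartialIso.ofAut σ).agreement β := by linarith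
  exact PartialIso.exists_lt_of_lt_agreement (τ := cartanTr Λ ν) cartanTr_zero h3

/-- Under the agreement projection P, of measure above 1 - δ, the transport of φ acts on Q ψ as ψ
does, so `conj φ` pulls P ∩ Q ψ back into the match set of ψ. As `conj φ` preserves ν, intersecting
with P costs at most δ. -/
theorem Realizes.sub_le_measureReal_matchSet {π : PointIso μ ν}
    {θ : TraceIso (cartanTr Γ μ) (cartanTr Λ ν)} (h : Realizes π θ) (φ : Γ)
    {q : Λ → cartan Λ ν} (hq : DisjointProjections (actionAut Λ ν) q)
    {β : PartialIso (cartanTr Λ ν)} (hβ : β.IsDirectSum (actionAut Λ ν) q) {δ : ℝ}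
    (hd : (PartialIso.ofAut (θ.conj (actionAut Γ μ φ))).dist2 β ^ 2 < δ) (F : Finset Λ) :
    ∑ ψ ∈ F, (cartanTr Λ ν (q ψ)).re - δ ≤ ν.real (⋃ ψ ∈ F, π.matchSet φ ψ) := by
  obtain ⟨p, hp, -, hpa, hpδ⟩ := exists_agreement hd
  obtain ⟨P, hP, hP1, hP2⟩ := exists_proj_of_isStarProjection hp
  choose Q hQ hQ1 hQ2 using fun ψ => exists_proj_of_isStarProjection (hq.1 ψ)
  have hsumQ : ∑ ψ ∈ F, (cartanTr Λ ν (q ψ)).re = ν.real (⋃ ψ ∈ F, Q ψ) := by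
    rw [measureReal_biUnion_finset₀]
    · exact Finset.sum_congr rfl fun ψ _ => hQ2 ψ
    · intro ψ _ ψ' _ hne
      have h1 : q ψ * q ψ' = 0 := hq.2.1 hne
      rw [hQ1 ψ, hQ1 ψ', proj_mul (hQ ψ) (hQ ψ'), ← proj_empty, proj_eq_proj_iff] at h1
      exact (measure_congr h1).trans measure_empty
    · exact fun ψ _ => (hQ ψ).nullMeasurableSet
  have hUm : MeasurableSet (⋃ ψ ∈ F, Q ψ) := Finset.measurableSet_biUnion F fun ψ _ => hQ ψ
  have hmem : ∀ ψ, ∀ᵐ y ∂ν, π.conj φ y ∈ P ∩ Q ψ → y ∈ π.matchSet φ ψ := by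
    intro ψ
    have e : (proj (hP.inter (hQ ψ)) : cartan Λ ν) = p * q ψ := by
      rw [hP1, hQ1 ψ, proj_mul hP (hQ ψ)]
    exact h.ae_mem_matchSet φ ψ (hP.inter (hQ ψ))
      (PartialIso.eq_on_mul cartan_mul_comm hpa (hβ.2.2 ψ) e)
  have hsub : (π.conj φ ⁻¹' (P ∩ ⋃ ψ ∈ F, Q ψ) : Set Y) ≤ᵐ[ν] ⋃ ψ ∈ F, π.matchSet φ ψ := by
    filter_upwards [ae_all_iff.2 hmem] with y hy hyP
    obtain ⟨ψ, hψ, hyQ⟩ := Set.mem_iUnion₂.1 hyP.2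
    exact Set.mem_iUnion₂.2 ⟨ψ, hψ, hy ψ ⟨hyP.1, hyQ⟩⟩
  have h1 : ν.real (P ∩ ⋃ ψ ∈ F, Q ψ) ≤ ν.real (⋃ ψ ∈ F, π.matchSet φ ψ) := by
    have h2 := measure_mono_ae hsub
    rw [(π.measurePreserving_conj φ).measure_preimage (hP.inter hUm).nullMeasurableSet] at h2
    exact ENNReal.toReal_mono (measure_ne_top ν _) h2
  have h2 := measureReal_union_add_inter (μ := ν) (s := P) hUm (measure_ne_top ν _)
    (measure_ne_top ν _)
  have h3 : ν.real (P ∪ ⋃ ψ ∈ F, Q ψ) ≤ 1 := measureReal_le_one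
  rw [hsumQ]
  linarith

theorem tight_of_sequence {π : ℕ → PointIso μ ν}
    {θ : ℕ → TraceIso (cartanTr Γ μ) (cartanTr Λ ν)} (hπ : ∀ n, Realizes (π n) (θ n))
    {q : Γ → ℕ → Λ → cartan Λ ν} {β : Γ → ℕ → PartialIso (cartanTr Λ ν)}
    (hβ : ∀ φ n, DisjointProjections (actionAut Λ ν) (q φ n) ∧
      (β φ n).IsDirectSum (actionAut Λ ν) (q φ n))
    (hd : ∀ φ, Tendsto (fun n => (PartialIso.ofAut
      ((θ n).conj (actionAut Γ μ φ))).dist2 (β φ n)) atTop (𝓝 0))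
    (hs : ∀ φ, HasSum (fun ψ => liminf (fun n => (cartanTr Λ ν (q φ n ψ)).re) atTop) 1) :
    Tight Γ Λ atTop π := by
  intro φ ε hε
  -- Three losses of ε/3: the liminfs outside F, the passage from liminfs to actual traces (η for
  -- each element of F), and the squared distance.
  obtain ⟨F, hF⟩ := ((tendsto_order.1 (hs φ)).1 (1 - ε / 3) (by linarith)).exists
  set η : ℝ := ε / (3 * (F.card + 1)) with hη
  have hη0 : 0 < η := by positivity
  have hηF : F.card * η ≤ ε / 3 := by
    rw [hη, mul_div_assoc', div_le_div_iff₀ (by positivity) (by positivity)]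
    nlinarith
  have h1 : ∀ᶠ n in atTop, ∀ ψ ∈ F,
      liminf (fun n => (cartanTr Λ ν (q φ n ψ)).re) atTop - η < (cartanTr Λ ν (q φ n ψ)).re := by
    refine (Filter.eventually_all_finset F).2 fun ψ _ => ?_
    refine eventually_lt_of_lt_liminf (by linarith) ?_
    exact isBoundedUnder_of ⟨0, fun n => cartanTr_re_nonneg ((hβ φ n).1.1 ψ)⟩
  have h2 : ∀ᶠ n in atTop, (PartialIso.ofAut
      ((θ n).conj (actionAut Γ μ φ))).dist2 (β φ n) ^ 2 < ε / 3 := by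
    have h3 := (hd φ).pow 2
    rw [zero_pow two_ne_zero] at h3
    exact (tendsto_order.1 h3).2 _ (by linarith)
  refine ⟨F, ?_⟩
  filter_upwards [h1, h2] with n hn1 hn2
  refine le_trans ?_ ((hπ n).sub_le_measureReal_matchSet φ (hβ φ n).1 (hβ φ n).2 hn2 F)
  have h3 := Finset.sum_le_sum fun ψ hψ => (hn1 ψ hψ).le
  rw [Finset.sum_sub_distrib, Finset.sum_const, nsmul_eq_mul] at h3
  linarith

end Sequential

/-! ### Piecewise unitaries -/

section Piecewise

open TracialVNA

variable {Λ : Type*} [Group Λ] [Countable Λ] {Y : Type*} [MeasurableSpace Y] [MulAction Λ Y]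
  {ν : Measure Y} [MeasurableConstSMul Λ Y] [SMulInvariantMeasure Λ Y ν] [StandardBorelSpace Y]
  [IsProbabilityMeasure ν]

variable (Λ ν) in
/-- The projection of a measurable set, as an element of the von Neumann algebra. -/
noncomputable def setProj {s : Set Y} (hs : MeasurableSet s) : (orbitVNA Λ ν).Carrier :=
  (proj hs : cartan Λ ν)

theorem setProj_mul {s t : Set Y} (hs : MeasurableSet s) (ht : MeasurableSet t) :
    setProj Λ ν hs * setProj Λ ν ht = setProj Λ ν (hs.inter ht) :=
  congrArg Subtype.val (proj_mul hs ht)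

theorem setProj_congr {s t : Set Y} (hs : MeasurableSet s) (ht : MeasurableSet t)
    (h : s =ᵐ[ν] t) : setProj Λ ν hs = setProj Λ ν ht :=
  congrArg Subtype.val ((proj_eq_proj_iff hs ht).2 h)

theorem star_setProj {s : Set Y} (hs : MeasurableSet s) :
    star (setProj Λ ν hs) = setProj Λ ν hs :=
  congrArg Subtype.val (star_proj hs)

theorem setProj_compl {s : Set Y} (hs : MeasurableSet s) :
    setProj Λ ν hs.compl = 1 - setProj Λ ν hs :=
  congrArg Subtype.val (proj_compl hs)

theorem setProj_empty : setProj Λ ν MeasurableSet.empty = 0 :=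
  congrArg Subtype.val proj_empty

theorem norm_setProj_le {s : Set Y} (hs : MeasurableSet s) : ‖setProj Λ ν hs‖ ≤ 1 :=
  norm_fn_le (bddMeasurable_indicator hs) zero_le_one (Eventually.of_forall fun y => by
    by_cases hy : y ∈ s <;> simp [hy])

theorem norm2_setProj {s : Set Y} (hs : MeasurableSet s) :
    (orbitVNA Λ ν).norm2 (setProj Λ ν hs) = √(ν.real s) := by
  have h := norm2_sq_fn (Γ := Λ) (μ := ν) (bddMeasurable_indicator hs)
  have e : ∫ y, ‖s.indicator (fun _ => (1 : ℂ)) y‖ ^ 2 ∂ν = ν.real s := by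
    rw [← integral_indicator_one hs]
    refine integral_congr_ae (Eventually.of_forall fun y => ?_)
    by_cases hy : y ∈ s <;> simp [hy]
  rw [e] at h
  rw [← h, Real.sqrt_sq ((orbitVNA Λ ν).norm2_nonneg _)]
  rfl

theorem setProj_mul_canonicalUnitary {s : Set Y} (hs : MeasurableSet s) (ψ : Λ) :
    setProj Λ ν hs * canonicalUnitary Λ ν ψ =
      canonicalUnitary Λ ν ψ * setProj Λ ν (measurable_const_smul (α := Y) ψ hs) := by
  refine Eq.trans ?_ (canonicalUnitary_mul_fn (Γ := Λ) (μ := ν)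
    (bddMeasurable_indicator (measurable_const_smul (α := Y) ψ hs)) ψ).symm
  refine congrArg (fun a : cartan Λ ν => (a : (orbitVNA Λ ν).Carrier) * canonicalUnitary Λ ν ψ)
    ((fn_eq_fn_iff (Γ := Λ) (μ := ν) (bddMeasurable_indicator hs) _).2
      (Eventually.of_forall fun y => ?_))
  by_cases hy : y ∈ s <;> simp [hy]

theorem setProj_mul_canonicalUnitary_congr {s t : Set Y} (hs : MeasurableSet s)
    (ht : MeasurableSet t) (hst : s =ᵐ[ν] t) {ψ ψ' : Λ} (h : ∀ y ∈ s, ψ⁻¹ • y = ψ'⁻¹ • y) :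
    setProj Λ ν hs * canonicalUnitary Λ ν ψ = setProj Λ ν ht * canonicalUnitary Λ ν ψ' := by
  rw [← setProj_congr hs ht hst]
  refine fn_mul_canonicalUnitary_congr (Γ := Λ) (μ := ν) (bddMeasurable_indicator hs)
    (bddMeasurable_indicator hs) (Eventually.of_forall fun y => ⟨rfl, fun hy => ?_⟩)
  by_cases hys : y ∈ s
  · exact h y hys
  · exact absurd (Set.indicator_of_notMem hys _) hy

/-- Disjointness is asked only up to null sets, since the right supports of the piecewise isometries
are disjoint only in that sense. -/
theorem sum_setProj {ι : Type*} (F : Finset ι) {s : ι → Set Y} (hs : ∀ i, MeasurableSet (s i))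
    (hd : ∀ i j, i ≠ j → AEDisjoint ν (s i) (s j)) :
    ∑ i ∈ F, setProj Λ ν (hs i) =
      setProj Λ ν (Finset.measurableSet_biUnion F fun i _ => hs i) := by
  classical
  induction F using Finset.induction_on with
  | empty =>
    rw [Finset.sum_empty, ← setProj_empty]
    refine setProj_congr _ _ (by simp)
  | insert i F hi ih =>
    rw [Finset.sum_insert hi, ih]
    have hU : MeasurableSet (⋃ j ∈ F, s j) := Finset.measurableSet_biUnion F fun j _ => hs j
    have h0 : setProj Λ ν (hs i) * setProj Λ ν hU = 0 := by
      rw [setProj_mul, ← setProj_empty]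
      refine setProj_congr _ _ ?_
      have h1 : ∀ᵐ y ∂ν, ∀ j ∈ F, y ∉ s i ∩ s j := by
        refine (Filter.eventually_all_finset F).2 fun j hj => ?_
        exact measure_eq_zero_iff_ae_notMem.1 (hd i j fun h => hi (h ▸ hj))
      filter_upwards [h1] with y hy
      refine eq_false fun h => ?_
      obtain ⟨j, hj, hyj⟩ := Set.mem_iUnion₂.1 h.2
      exact hy j hj ⟨h.1, hyj⟩
    have h2 : setProj Λ ν (Finset.measurableSet_biUnion (insert i F) fun j _ => hs j) =
        1 - setProj Λ ν (hs i).compl * setProj Λ ν hU.compl := by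
      rw [setProj_mul, ← setProj_compl]
      refine setProj_congr _ _ (Eventually.of_forall fun y => propext ?_)
      change y ∈ (⋃ j ∈ insert i F, s j) ↔ ¬ (y ∉ s i ∧ y ∉ ⋃ j ∈ F, s j)
      rw [Finset.set_biUnion_insert, Set.mem_union]
      tauto
    have h3 : (1 - setProj Λ ν (hs i)) * (1 - setProj Λ ν hU) =
        1 - setProj Λ ν hU - (setProj Λ ν (hs i) - setProj Λ ν (hs i) * setProj Λ ν hU) := by
      rw [sub_mul, one_mul, mul_sub, mul_one]
    rw [h2, setProj_compl (hs i), setProj_compl hU, h3, h0]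
    abel

/-- An element annihilated by countably many projections is annihilated by their supremum. -/
theorem setProj_mul_eq_zero_of_cover {ι : Type*} [Countable ι] {z : (orbitVNA Λ ν).Carrier}
    {D : ι → Set Y} (hD : ∀ i, MeasurableSet (D i)) (h : ∀ i, setProj Λ ν (hD i) * z = 0)
    {E : Set Y} (hE : MeasurableSet E) (hED : E ⊆ ⋃ i, D i) : setProj Λ ν hE * z = 0 := by
  have hval : ∀ {s : Set Y} (hs : MeasurableSet s) (ξ : OrbitL2 Λ ν),
      ((setProj Λ ν hs * z : (orbitVNA Λ ν).Carrier) : OrbitL2 Λ ν →L[ℂ] OrbitL2 Λ ν) ξ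
        =ᵐ[orbitMeasure Λ ν] fun p => s.indicator (fun _ => (1 : ℂ)) p.1 *
          (z : OrbitL2 Λ ν →L[ℂ] OrbitL2 Λ ν) ξ p := fun hs ξ =>
    mulOp_coe _ ((bddMeasurable_indicator hs).comp measurable_fst) _
  refine Subtype.ext (ContinuousLinearMap.ext fun ξ => ?_)
  refine (Lp.eq_zero_iff_ae_eq_zero).2 ?_
  have h0 : ∀ᵐ p ∂orbitMeasure Λ ν, ∀ i, (D i).indicator (fun _ => (1 : ℂ)) p.1 *
      (z : OrbitL2 Λ ν →L[ℂ] OrbitL2 Λ ν) ξ p = 0 := by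
    refine ae_all_iff.2 fun i => ?_
    have h1 := hval (hD i) ξ
    rw [h i] at h1
    filter_upwards [h1, Lp.coeFn_zero ℂ 2 (orbitMeasure Λ ν)] with p hp hp0
    rw [← hp]
    exact hp0
  filter_upwards [hval hE ξ, h0] with p hp hp0
  rw [hp]
  by_cases hpE : p.1 ∈ E
  · obtain ⟨i, hi⟩ := Set.mem_iUnion.1 (hED hpE)
    have h2 := hp0 i
    rw [Set.indicator_of_mem hi, one_mul] at h2
    rw [h2, mul_zero]
    rfl
  · rw [Set.indicator_of_notMem hpE, zero_mul]
    rfl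

variable {Γ : Type*} [Group Γ] [Countable Γ] {X : Type*} [MeasurableSpace X] [MulAction Γ X]
  {μ : Measure X} [MeasurableConstSMul Γ X] [SMulInvariantMeasure Γ X μ] [StandardBorelSpace X]
  [IsProbabilityMeasure μ]

namespace PointIso

variable (π : PointIso μ ν) (φ φ' : Γ) (n : ℕ)

/-- The order of composition is reversed because `conj φ` transports φ⁻¹; the identity holds only
almost everywhere because π.fwd ∘ π.inv is the identity only there. -/
theorem ae_conj_mul : ∀ᵐ y ∂ν, π.conj (φ * φ') y = π.conj φ' (π.conj φ y) := by
  have h := ((measurePreserving_smul φ⁻¹ μ).comp π.mp_fwd).quasiMeasurePreserving.ae π.fwd_inv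
  filter_upwards [h] with y hy
  simp only [Function.comp] at hy
  unfold conj
  rw [hy, mul_inv_rev, mul_smul]

theorem ae_conj_one : ∀ᵐ y ∂ν, π.conj (1 : Γ) y = y := by
  filter_upwards [π.inv_fwd] with y hy
  rw [conj, inv_one, one_smul, hy]

theorem ae_conj_inv : ∀ᵐ y ∂ν, π.conj φ⁻¹ (π.conj φ y) = y := by
  filter_upwards [π.ae_conj_mul φ φ⁻¹, π.ae_conj_one (Γ := Γ)] with y h1 h2
  rw [← h1, mul_inv_cancel, h2]

theorem ae_fwd_conj : ∀ᵐ y ∂ν, π.fwd (π.conj φ y) = φ⁻¹ • π.fwd y :=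
  ((measurePreserving_smul φ⁻¹ μ).comp π.mp_fwd).quasiMeasurePreserving.ae π.fwd_inv

variable (Λ) in
/-- The points covered by the first `n` cells. -/
def domain : Set Y := ⋃ ψ ∈ initialSegment Λ n, π.cell φ ψ

variable (Λ) in
theorem measurableSet_domain : MeasurableSet (π.domain Λ φ n) :=
  Finset.measurableSet_biUnion _ fun ψ _ => π.measurableSet_cell φ ψ

variable (Λ) in
/-- The partial isometry equal to `u_ψ` on the cell of `ψ`. -/
noncomputable def piecewise : (orbitVNA Λ ν).Carrier :=
  ∑ ψ ∈ initialSegment Λ n, setProj Λ ν (π.measurableSet_cell φ ψ) * canonicalUnitary Λ ν ψ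

/-- On D ∩ cell(ψ') both ψ⁻¹ and ψ'⁻¹ coincide with the transport of φ⁻¹, so u_ψ' may be replaced by
u_ψ there; the cells then add up to the projection of D. All computations with `piecewise` reduce to
this. -/
theorem setProj_mul_piecewise {D : Set Y} (hD : MeasurableSet D) {ψ : Λ}
    (h : D ⊆ π.matchSet φ ψ) (h' : D ⊆ π.domain Λ φ n) :
    setProj Λ ν hD * π.piecewise Λ φ n = setProj Λ ν hD * canonicalUnitary Λ ν ψ := by
  have h1 : ∀ ψ', setProj Λ ν hD *
      (setProj Λ ν (π.measurableSet_cell φ ψ') * canonicalUnitary Λ ν ψ') =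
      setProj Λ ν (hD.inter (π.measurableSet_cell φ ψ')) * canonicalUnitary Λ ν ψ := by
    intro ψ'
    rw [← mul_assoc, setProj_mul]
    refine setProj_mul_canonicalUnitary_congr _ _ (ae_eq_refl _) fun y hy => ?_
    have h2 : π.conj φ y = ψ⁻¹ • y := h hy.1
    have h3 : π.conj φ y = ψ'⁻¹ • y := π.cell_subset φ ψ' hy.2
    rw [← h2, h3]
  rw [piecewise, Finset.mul_sum, Finset.sum_congr rfl fun ψ' _ => h1 ψ', ← Finset.sum_mul,
    sum_setProj _ (fun ψ' => hD.inter (π.measurableSet_cell φ ψ'))]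
  · congr 1
    refine setProj_congr _ _ (Eventually.of_forall fun y => propext ⟨fun hy => ?_, fun hy => ?_⟩)
    · obtain ⟨ψ', -, hy⟩ := Set.mem_iUnion₂.1 hy
      exact hy.1
    · obtain ⟨ψ', hψ', hy'⟩ := Set.mem_iUnion₂.1 (h' hy)
      exact Set.mem_iUnion₂.2 ⟨ψ', hψ', hy, hy'⟩
  · intro i j hij
    exact ((π.pairwise_disjoint_cell φ hij).mono Set.inter_subset_right
      Set.inter_subset_right).aedisjoint

/-- The right supports ψ⁻¹(cell ψ) are disjoint up to null sets because `conj φ` is injective almost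
everywhere, and each has the measure of its cell. -/
theorem star_piecewise_mul_piecewise : ∃ (Q : Set Y) (hQ : MeasurableSet Q),
    star (π.piecewise Λ φ n) * π.piecewise Λ φ n = setProj Λ ν hQ ∧
      ν.real Q = ν.real (π.domain Λ φ n) := by
  have hm : ∀ ψ, MeasurableSet {y | ψ • y ∈ π.cell φ ψ} := fun ψ : Λ =>
    measurable_const_smul (α := Y) ψ (π.measurableSet_cell φ ψ)
  have hdisj : ∀ ψ ψ' : Λ, ψ ≠ ψ' →
      AEDisjoint ν {y | ψ • y ∈ π.cell φ ψ} {y | ψ' • y ∈ π.cell φ ψ'} := by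
    intro ψ ψ' hne
    have h1 : ∀ ψ : Λ, ∀ᵐ y ∂ν, π.conj φ⁻¹ (π.conj φ (ψ • y)) = ψ • y := fun ψ =>
      (measurePreserving_smul ψ ν).quasiMeasurePreserving.ae (π.ae_conj_inv φ)
    refine measure_eq_zero_iff_ae_notMem.2 ?_
    filter_upwards [h1 ψ, h1 ψ'] with y hy hy' h
    have h2 : ∀ ψ : Λ, ψ • y ∈ π.cell φ ψ → π.conj φ (ψ • y) = y := fun ψ h => by
      have : π.conj φ (ψ • y) = ψ⁻¹ • ψ • y := π.cell_subset φ ψ h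
      rwa [inv_smul_smul] at this
    rw [h2 ψ h.1] at hy
    rw [h2 ψ' h.2] at hy'
    refine Set.disjoint_left.1 (π.pairwise_disjoint_cell φ hne) h.1 ?_
    rw [← hy, hy']
    exact h.2
  refine ⟨_, Finset.measurableSet_biUnion (initialSegment Λ n) fun ψ _ => hm ψ, ?_, ?_⟩
  · rw [← sum_setProj _ hm hdisj]
    conv_lhs => enter [1]; rw [piecewise]
    rw [star_sum, Finset.sum_mul]
    refine Finset.sum_congr rfl fun ψ hψ => ?_
    rw [star_mul, star_setProj, star_canonicalUnitary, mul_assoc,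
      π.setProj_mul_piecewise φ n (π.measurableSet_cell φ ψ) (π.cell_subset φ ψ)
        (Set.subset_biUnion_of_mem (u := fun ψ => π.cell φ ψ) hψ),
      setProj_mul_canonicalUnitary, ← mul_assoc, canonicalUnitary_inv_mul, one_mul]
  · rw [domain, ← π.sum_measureReal_cell φ (initialSegment Λ n), measureReal_biUnion_finset₀]
    · refine Finset.sum_congr rfl fun ψ _ => ?_
      exact (measurePreserving_smul ψ ν).measureReal_preimage
        (π.measurableSet_cell φ ψ).nullMeasurableSet
    · exact fun ψ _ ψ' _ hne => hdisj ψ ψ' hne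
    · exact fun ψ _ => (hm ψ).nullMeasurableSet

theorem norm_piecewise_le : ‖π.piecewise Λ φ n‖ ≤ 1 := by
  obtain ⟨Q, hQ, h, -⟩ := π.star_piecewise_mul_piecewise (Λ := Λ) φ n
  have h1 : ‖π.piecewise Λ φ n‖ * ‖π.piecewise Λ φ n‖ ≤ 1 := by
    have h2 : ‖star (π.piecewise Λ φ n) * π.piecewise Λ φ n‖ =
        ‖π.piecewise Λ φ n‖ * ‖π.piecewise Λ φ n‖ :=
      CStarRing.norm_star_mul_self
        (x := ((π.piecewise Λ φ n : (orbitVNA Λ ν).Carrier) : OrbitL2 Λ ν →L[ℂ] OrbitL2 Λ ν))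
    rw [← h2, h]
    exact norm_setProj_le hQ
  nlinarith [norm_nonneg (π.piecewise Λ φ n)]

theorem piecewise_mul_fn {b : Y → ℂ} (hb : BddMeasurable b) :
    π.piecewise Λ φ n * (fn hb : cartan Λ ν) =
      (fn (hb.comp (π.measurable_conj φ)) : cartan Λ ν) * π.piecewise Λ φ n := by
  rw [piecewise, Finset.sum_mul, Finset.mul_sum]
  refine Finset.sum_congr rfl fun ψ _ => ?_
  have h1 : setProj Λ ν (π.measurableSet_cell φ ψ) *
      (fn (hb.comp (measurable_const_smul ψ⁻¹)) : cartan Λ ν) =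
      (fn (hb.comp (π.measurable_conj φ)) : cartan Λ ν) *
        setProj Λ ν (π.measurableSet_cell φ ψ) := by
    have h2 := proj_mul_fn_congr (Γ := Λ) (μ := ν) (π.measurableSet_cell φ ψ)
      (hb.comp (measurable_const_smul ψ⁻¹)) (hb.comp (π.measurable_conj φ))
      fun y hy => congrArg b (π.cell_subset φ ψ hy).symm
    exact congrArg Subtype.val (h2.trans (cartan_mul_comm _ _))
  rw [mul_assoc, canonicalUnitary_mul_fn hb ψ, ← mul_assoc, h1, mul_assoc]

/-- On the cell of ψ the fixed points of ψ are those of the transport of φ, so the traces of the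
summands assemble into one integral in which Λ enters only through the domain. -/
theorem tr_fn_mul_piecewise {b : Y → ℂ} (hb : BddMeasurable b) :
    (orbitVNA Λ ν).tr ((fn hb : cartan Λ ν) * π.piecewise Λ φ n) =
      ∫ y in {y | π.conj φ y = y} ∩ π.domain Λ φ n, b y ∂ν := by
  have hfix : MeasurableSet {y | π.conj φ y = y} :=
    ((π.measurable_conj φ).prodMk measurable_id) (measurableSet_diagonal (α := Y))
  have h1 : ∀ ψ : Λ, (orbitVNA Λ ν).tr ((fn hb : cartan Λ ν) *
      (setProj Λ ν (π.measurableSet_cell φ ψ) * canonicalUnitary Λ ν ψ)) =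
      ∫ y in {y | π.conj φ y = y} ∩ π.cell φ ψ, b y ∂ν := by
    intro ψ
    have h2 : (fn hb : cartan Λ ν) * setProj Λ ν (π.measurableSet_cell φ ψ) =
        (fn (hb.mul (bddMeasurable_indicator (π.measurableSet_cell φ ψ))) : cartan Λ ν) :=
      congrArg Subtype.val (fn_mul hb (bddMeasurable_indicator (π.measurableSet_cell φ ψ))).symm
    rw [← mul_assoc, h2, tr_fn_mul_canonicalUnitary, mul_indicator_one,
      setIntegral_indicator (π.measurableSet_cell φ ψ)]
    congr 2
    ext y
    refine and_congr_left fun hy => ?_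
    rw [Set.mem_ofPred_eq, Set.mem_ofPred_eq, show π.conj φ y = ψ⁻¹ • y from π.cell_subset φ ψ hy]
  have h3 : (orbitVNA Λ ν).tr ((fn hb : cartan Λ ν) * π.piecewise Λ φ n) =
      ∑ ψ ∈ initialSegment Λ n, (orbitVNA Λ ν).tr ((fn hb : cartan Λ ν) *
        (setProj Λ ν (π.measurableSet_cell φ ψ) * canonicalUnitary Λ ν ψ)) := by
    rw [piecewise, Finset.mul_sum]
    exact map_sum (AddMonoidHom.mk' (orbitVNA Λ ν).tr (orbitVNA Λ ν).tr_add) _ _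
  rw [h3, Finset.sum_congr rfl fun ψ _ => h1 ψ, domain, Set.inter_iUnion₂,
    integral_biUnion_finset _ (fun ψ _ => hfix.inter (π.measurableSet_cell φ ψ))]
  · intro ψ _ ψ' _ hne
    exact (π.pairwise_disjoint_cell φ hne).mono Set.inter_subset_right Set.inter_subset_right
  · exact fun ψ _ => (hb.integrable ν).integrableOn

end PointIso

end Piecewise

/-! ### From tightness to an isomorphism of ultraproduct form -/

section UltraPiecewise

open TracialVNA

variable {Γ : Type*} [Group Γ] [Countable Γ] {X : Type*} [MeasurableSpace X] [MulAction Γ X]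
  {μ : Measure X} [MeasurableConstSMul Γ X] [SMulInvariantMeasure Γ X μ] [StandardBorelSpace X]
  [IsProbabilityMeasure μ]
  {Λ : Type*} [Group Λ] [Countable Λ] {Y : Type*} [MeasurableSpace Y] [MulAction Λ Y]
  {ν : Measure Y} [MeasurableConstSMul Λ Y] [SMulInvariantMeasure Λ Y ν] [StandardBorelSpace Y]
  [IsProbabilityMeasure ν] {ω : Ultrafilter ℕ}

theorem FnSeq.seq_congr {f g : FnSeq Y} (h : ∀ n, f.toFun n =ᵐ[ν] g.toFun n) :
    f.seq Λ ν = g.seq Λ ν :=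
  BoundedContinuousFunction.ext fun n =>
    congrArg Subtype.val ((fn_eq_fn_iff (Γ := Λ) (f.bddMeasurable n) (g.bddMeasurable n)).2 (h n))

/-- The pointwise complex conjugate. -/
def FnSeq.conj (f : FnSeq Y) : FnSeq Y where
  toFun n := star (f.toFun n)
  measurable n := (f.bddMeasurable n).star.1
  bound := f.bound
  norm_le n y := by
    rw [Pi.star_apply, norm_star]
    exact f.norm_le n y

theorem FnSeq.seq_conj (f : FnSeq Y) : f.conj.seq Λ ν = star (f.seq Λ ν) :=
  BoundedContinuousFunction.ext fun n =>
    congrArg Subtype.val (fn_star (Γ := Λ) (μ := ν) (f.bddMeasurable n))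

theorem FnSeq.seq_one :
    (FnSeq.indicator fun _ => MeasurableSet.univ : FnSeq Y).seq Λ ν = 1 :=
  BoundedContinuousFunction.ext fun _ => congrArg Subtype.val (proj_univ (Γ := Λ) (μ := ν))

theorem norm2_sub_le_of_setProj {x y : (orbitVNA Λ ν).Carrier} {E : Set Y} (hE : MeasurableSet E)
    (h : setProj Λ ν hE * (x - y) = 0) :
    (orbitVNA Λ ν).norm2 (x - y) ≤ ‖x - y‖ * √(ν.real Eᶜ) := by
  have e : x - y = setProj Λ ν hE.compl * (x - y) := by
    rw [setProj_compl hE, sub_mul, one_mul, h, sub_zero]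
  conv_lhs => rw [e]
  refine ((orbitVNA Λ ν).norm2_mul_le' _ _).trans_eq ?_
  rw [norm2_setProj]

theorem ultraMk_eq_of_setProj {x y : ℕ →ᵇ (orbitVNA Λ ν).Carrier} {E : ℕ → Set Y}
    (hE : ∀ n, MeasurableSet (E n)) (h : ∀ n, setProj Λ ν (hE n) * (x n - y n) = 0)
    (hlim : Tendsto (fun n => ν.real (E n)ᶜ) ω (𝓝 0)) :
    (orbitVNA Λ ν).ultraMk ω x = (orbitVNA Λ ν).ultraMk ω y := by
  refine ((orbitVNA Λ ν).ultraMk_eq_iff ω).2 (squeeze_zero (fun n => (orbitVNA Λ ν).norm2_nonneg _)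
    (g := fun n => ‖x - y‖ * √(ν.real (E n)ᶜ)) (fun n => ?_) ?_)
  · exact (norm2_sub_le_of_setProj (hE n) (h n)).trans
      (mul_le_mul_of_nonneg_right ((x - y).norm_coe_le_norm n) (Real.sqrt_nonneg _))
  · have h1 := ((Real.continuous_sqrt.tendsto 0).comp hlim).const_mul ‖x - y‖
    rw [Real.sqrt_zero, mul_zero] at h1
    exact h1

theorem ultraNorm2_sub_le_of_setProj {x y : ℕ →ᵇ (orbitVNA Λ ν).Carrier} {E : ℕ → Set Y}
    (hE : ∀ n, MeasurableSet (E n)) (hx : ∀ n, ‖x n‖ ≤ 1) {δ : ℝ}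
    (h : ∀ᶠ n in (ω : Filter ℕ), setProj Λ ν (hE n) * x n = y n ∧ ν.real (E n)ᶜ ≤ δ) :
    (orbitVNA Λ ν).ultraNorm2 ω ((orbitVNA Λ ν).ultraMk ω x - (orbitVNA Λ ν).ultraMk ω y) ≤
      √δ := by
  refine le_of_tendsto (tendsto_norm2 ω (x - y)) ?_
  filter_upwards [h] with n hn
  have e : (x - y) n = setProj Λ ν (hE n).compl * x n := by
    rw [setProj_compl (hE n), sub_mul, one_mul, hn.1]
    rfl
  rw [e]
  refine ((orbitVNA Λ ν).norm2_mul_le' _ _).trans ?_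
  refine (mul_le_of_le_one_left ((orbitVNA Λ ν).norm2_nonneg _) (hx n)).trans ?_
  rw [norm2_setProj]
  exact Real.sqrt_le_sqrt hn.2

/-- The product can fail to be the piecewise isometry of φφ' only at points outside the domain of φ
or of φφ', or sent by `conj φ` outside the domain of φ'. Since `conj φ` preserves ν, the three
complements bound the exceptional set. -/
theorem PointIso.setProj_mul_piecewise_mul_piecewise (π : PointIso μ ν) (φ φ' : Γ) (n : ℕ) :
    ∃ (E : Set Y) (hE : MeasurableSet E), setProj Λ ν hE * (π.piecewise Λ φ n *
      π.piecewise Λ φ' n - π.piecewise Λ (φ * φ') n) = 0 ∧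
      ν.real Eᶜ ≤ ν.real (π.domain Λ φ n)ᶜ + ν.real (π.domain Λ (φ * φ') n)ᶜ +
        ν.real (π.domain Λ φ' n)ᶜ := by
  have hgood : MeasurableSet {y | π.conj (φ * φ') y = π.conj φ' (π.conj φ y)} :=
    ((π.measurable_conj (φ * φ')).prodMk ((π.measurable_conj φ').comp (π.measurable_conj φ)))
      (measurableSet_diagonal (α := Y))
  have hpre : MeasurableSet (π.conj φ ⁻¹' π.domain Λ φ' n) :=
    π.measurable_conj φ (π.measurableSet_domain Λ φ' n)
  set E : Set Y := ((π.domain Λ φ n ∩ π.domain Λ (φ * φ') n) ∩ π.conj φ ⁻¹' π.domain Λ φ' n) ∩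
    {y | π.conj (φ * φ') y = π.conj φ' (π.conj φ y)} with hEdef
  have hE : MeasurableSet E := (((π.measurableSet_domain Λ φ n).inter
    (π.measurableSet_domain Λ (φ * φ') n)).inter hpre).inter hgood
  refine ⟨E, hE, ?_, ?_⟩
  -- On the piece indexed by (ψ, ψ') the three isometries are u_ψ, u_ψ' (after translation by ψ⁻¹)
  -- and u_{ψψ'}, so the claim is multiplicativity of the canonical unitaries.
  · have hD : ∀ i : Λ × Λ, MeasurableSet
        (E ∩ π.matchSet φ i.1 ∩ {y | i.1⁻¹ • y ∈ π.matchSet φ' i.2}) := fun i =>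
      (hE.inter (π.measurableSet_matchSet φ i.1)).inter
        (measurable_const_smul (α := Y) i.1⁻¹ (π.measurableSet_matchSet φ' i.2))
    refine setProj_mul_eq_zero_of_cover hD ?_ hE ?_
    · rintro ⟨ψ, ψ'⟩
      have hm := measurable_const_smul (α := Y) ψ (hD (ψ, ψ'))
      have k1 : setProj Λ ν (hD (ψ, ψ')) * π.piecewise Λ φ n =
          setProj Λ ν (hD (ψ, ψ')) * canonicalUnitary Λ ν ψ :=
        π.setProj_mul_piecewise φ n (hD (ψ, ψ')) (fun y hy => hy.1.2)
          (fun y hy => hy.1.1.1.1.1)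
      have k2 : setProj Λ ν hm * π.piecewise Λ φ' n = setProj Λ ν hm * canonicalUnitary Λ ν ψ' := by
        refine π.setProj_mul_piecewise φ' n hm (fun y hy => ?_) (fun y hy => ?_)
        · have h1 : ψ⁻¹ • ψ • y ∈ π.matchSet φ' ψ' := hy.2
          rwa [inv_smul_smul] at h1
        · have h1 : π.conj φ (ψ • y) ∈ π.domain Λ φ' n := hy.1.1.1.2
          have h2 : π.conj φ (ψ • y) = ψ⁻¹ • ψ • y := hy.1.2
          rwa [h2, inv_smul_smul] at h1
      have k3 : setProj Λ ν (hD (ψ, ψ')) * π.piecewise Λ (φ * φ') n =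
          setProj Λ ν (hD (ψ, ψ')) * canonicalUnitary Λ ν (ψ * ψ') := by
        refine π.setProj_mul_piecewise (φ * φ') n (hD (ψ, ψ')) (fun y hy => ?_)
          (fun y hy => hy.1.1.1.1.2)
        have h1 : π.conj (φ * φ') y = π.conj φ' (π.conj φ y) := hy.1.1.2
        have h2 : π.conj φ y = ψ⁻¹ • y := hy.1.2
        have h3 : π.conj φ' (ψ⁻¹ • y) = ψ'⁻¹ • ψ⁻¹ • y := hy.2
        change π.conj (φ * φ') y = (ψ * ψ')⁻¹ • y
        rw [h1, h2, h3, mul_inv_rev, mul_smul]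
      have k4 := setProj_mul_canonicalUnitary (Λ := Λ) (ν := ν) (hD (ψ, ψ')) ψ
      rw [mul_sub, ← mul_assoc, k1, k4, mul_assoc, k2, ← mul_assoc, ← k4, mul_assoc,
        canonicalUnitary_mul, k3, sub_self]
    · intro y hy
      obtain ⟨ψ, -, h1⟩ := Set.mem_iUnion₂.1 hy.1.1.1
      obtain ⟨ψ', -, h2⟩ := Set.mem_iUnion₂.1 hy.1.2
      have h3 : π.conj φ y = ψ⁻¹ • y := π.cell_subset φ ψ h1
      refine Set.mem_iUnion.2 ⟨(ψ, ψ'), ⟨hy, π.cell_subset φ ψ h1⟩, ?_⟩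
      change ψ⁻¹ • y ∈ π.matchSet φ' ψ'
      rw [← h3]
      exact π.cell_subset φ' ψ' h2
  · have h1 : ν Eᶜ ≤ ν (((π.domain Λ φ n)ᶜ ∪ (π.domain Λ (φ * φ') n)ᶜ) ∪
        π.conj φ ⁻¹' (π.domain Λ φ' n)ᶜ) := by
      refine measure_mono_ae ?_
      filter_upwards [π.ae_conj_mul φ φ'] with y hy hyE
      by_contra h
      exact hyE ⟨⟨⟨by_contra fun k => h (Or.inl (Or.inl k)),
        by_contra fun k => h (Or.inl (Or.inr k))⟩, by_contra fun k => h (Or.inr k)⟩, hy⟩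
    have h2 := ENNReal.toReal_mono (measure_ne_top ν _) h1
    have h3 := measureReal_union_le (μ := ν) ((π.domain Λ φ n)ᶜ ∪ (π.domain Λ (φ * φ') n)ᶜ)
      (π.conj φ ⁻¹' (π.domain Λ φ' n)ᶜ)
    have h4 := measureReal_union_le (μ := ν) (π.domain Λ φ n)ᶜ (π.domain Λ (φ * φ') n)ᶜ
    rw [(π.measurePreserving_conj φ).measureReal_preimage
      (π.measurableSet_domain Λ φ' n).compl.nullMeasurableSet] at h3
    exact h2.trans (h3.trans (add_le_add_left h4 _))

theorem PointIso.setProj_mul_piecewise_one (π : PointIso μ ν) (n : ℕ) :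
    ∃ (E : Set Y) (hE : MeasurableSet E),
      setProj Λ ν hE * (π.piecewise Λ (1 : Γ) n - 1) = 0 ∧
      ν.real Eᶜ ≤ ν.real (π.domain Λ (1 : Γ) n)ᶜ := by
  have hE := (π.measurableSet_domain Λ (1 : Γ) n).inter (π.measurableSet_matchSet (1 : Γ) (1 : Λ))
  refine ⟨_, hE, ?_, ?_⟩
  · rw [mul_sub, π.setProj_mul_piecewise (1 : Γ) n hE (ψ := 1) Set.inter_subset_right
      Set.inter_subset_left, canonicalUnitary_one, sub_self]
  · refine ENNReal.toReal_mono (measure_ne_top ν _) (measure_mono_ae ?_)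
    filter_upwards [π.ae_conj_one (Γ := Γ)] with y hy hyE h
    refine hyE ⟨h, ?_⟩
    change π.conj (1 : Γ) y = (1 : Λ)⁻¹ • y
    rw [hy, inv_one, one_smul]

variable (π : ℕ → PointIso μ ν)

variable (Λ ω) in
/-- The class in the ultrapower of the piecewise partial isometries. -/
noncomputable def ultraPiecewise (φ : Γ) : (orbitVNA Λ ν).Ultra ω :=
  (orbitVNA Λ ν).ultraMk ω (BoundedContinuousFunction.ofNormedAddCommGroupDiscrete
    (fun n => (π n).piecewise Λ φ n) 1 fun n => (π n).norm_piecewise_le φ n)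

variable {π}

/-- The number of cells used at index n is n itself, and ω is free, so it eventually exceeds the
number N that tightness requires for any given ε. -/
theorem Tight.tendsto_domain (hω : (ω : Filter ℕ) ≤ cofinite) (h : Tight Γ Λ ω π) (φ : Γ) :
    Tendsto (fun n => ν.real ((π n).domain Λ φ n)ᶜ) ω (𝓝 0) := by
  refine tendsto_order.2 ⟨fun a ha => Eventually.of_forall fun n => ha.trans_le measureReal_nonneg,
    fun ε hε => ?_⟩
  obtain ⟨N, hN⟩ := h.exists_initialSegment φ (half_pos hε)
  have hge : ∀ᶠ n in (ω : Filter ℕ), N ≤ n :=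
    (Nat.cofinite_eq_atTop ▸ hω) (eventually_ge_atTop N)
  filter_upwards [hN N le_rfl, hge] with n hn hNn
  rw [probReal_compl_eq_one_sub ((π n).measurableSet_domain Λ φ n)]
  rw [PointIso.sum_measureReal_cell] at hn
  have h1 : ν.real (⋃ ψ ∈ initialSegment Λ N, (π n).cell φ ψ) ≤
      ν.real ((π n).domain Λ φ n) :=
    measureReal_mono (Set.biUnion_subset_biUnion_left fun ψ hψ =>
      mem_initialSegment.2 ((mem_initialSegment.1 hψ).trans_le hNn)) (measure_ne_top ν _)
  linarith

theorem ultraPiecewise_mul (hd : ∀ φ : Γ, Tendsto (fun n => ν.real ((π n).domain Λ φ n)ᶜ) ω (𝓝 0))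
    (φ φ' : Γ) :
    ultraPiecewise Λ ω π φ * ultraPiecewise Λ ω π φ' = ultraPiecewise Λ ω π (φ * φ') := by
  choose E hE h1 h2 using fun n =>
    (π n).setProj_mul_piecewise_mul_piecewise (Λ := Λ) φ φ' n
  refine ultraMk_eq_of_setProj hE h1 (squeeze_zero (fun n => measureReal_nonneg) h2 ?_)
  simpa using ((hd φ).add (hd (φ * φ'))).add (hd φ')

theorem ultraPiecewise_one
    (hd : ∀ φ : Γ, Tendsto (fun n => ν.real ((π n).domain Λ φ n)ᶜ) ω (𝓝 0)) :
    ultraPiecewise Λ ω π (1 : Γ) = 1 := by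
  choose E hE h1 h2 using fun n => (π n).setProj_mul_piecewise_one (Λ := Λ) (Γ := Γ) n
  rw [← ultraMk_one]
  exact ultraMk_eq_of_setProj hE h1 (squeeze_zero (fun n => measureReal_nonneg) h2 (hd 1))

theorem star_ultraPiecewise_mul
    (hd : ∀ φ : Γ, Tendsto (fun n => ν.real ((π n).domain Λ φ n)ᶜ) ω (𝓝 0)) (φ : Γ) :
    star (ultraPiecewise Λ ω π φ) * ultraPiecewise Λ ω π φ = 1 := by
  choose Q hQ h1 h2 using fun n => (π n).star_piecewise_mul_piecewise (Λ := Λ) φ n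
  rw [← ultraMk_one, ultraPiecewise, star_ultraMk, ← ultraMk_mul]
  refine ultraMk_eq_of_setProj hQ (fun n => ?_) ((hd φ).congr fun n => ?_)
  · change setProj Λ ν (hQ n) * (star ((π n).piecewise Λ φ n) * (π n).piecewise Λ φ n - 1) = 0
    rw [h1, mul_sub, mul_one, setProj_mul, sub_eq_zero]
    exact setProj_congr _ _ (by rw [Set.inter_self]; exact ae_eq_refl _)
  · rw [probReal_compl_eq_one_sub (hQ n), h2,
      probReal_compl_eq_one_sub ((π n).measurableSet_domain Λ φ n)]

theorem star_ultraPiecewise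
    (hd : ∀ φ : Γ, Tendsto (fun n => ν.real ((π n).domain Λ φ n)ᶜ) ω (𝓝 0)) (φ : Γ) :
    star (ultraPiecewise Λ ω π φ) = ultraPiecewise Λ ω π φ⁻¹ := by
  have h1 : ultraPiecewise Λ ω π φ * ultraPiecewise Λ ω π φ⁻¹ = 1 := by
    rw [ultraPiecewise_mul hd, mul_inv_cancel, ultraPiecewise_one hd]
  rw [← mul_one (star (ultraPiecewise Λ ω π φ)), ← h1, ← mul_assoc, star_ultraPiecewise_mul hd,
    one_mul]

theorem ultraPiecewise_mul_seq (φ : Γ) (b : FnSeq Y) :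
    ultraPiecewise Λ ω π φ * (orbitVNA Λ ν).ultraMk ω (b.seq Λ ν) =
      (orbitVNA Λ ν).ultraMk ω ((b.comp fun n => (π n).measurable_conj φ).seq Λ ν) *
        ultraPiecewise Λ ω π φ :=
  congrArg ((orbitVNA Λ ν).ultraMk ω) (BoundedContinuousFunction.ext fun n =>
    (π n).piecewise_mul_fn φ n (b.bddMeasurable n))

/-- Both traces are limits of integrals over fixed points, of φ on X and of its transport on Y,
which π n matches. The second integral is restricted to the domain, whose complement has vanishing
measure. -/
theorem ultraTr_seq_mul_ultraPiecewise
    (hd : ∀ φ : Γ, Tendsto (fun n => ν.real ((π n).domain Λ φ n)ᶜ) ω (𝓝 0)) (φ : Γ)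
    (a : FnSeq X) :
    (orbitVNA Γ μ).ultraTr ω ((orbitVNA Γ μ).ultraMk ω (a.seq Γ μ) *
        ultraConst ω (canonicalUnitary Γ μ φ)) =
      (orbitVNA Λ ν).ultraTr ω ((orbitVNA Λ ν).ultraMk ω
        ((a.comp fun n => (π n).mp_fwd.measurable).seq Λ ν) * ultraPiecewise Λ ω π φ) := by
  have hfix : ∀ n, MeasurableSet {y | (π n).conj φ y = y} := fun n =>
    (((π n).measurable_conj φ).prodMk measurable_id) (measurableSet_diagonal (α := Y))
  let b := a.comp fun n => (π n).mp_fwd.measurable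
  have h1 : Tendsto (fun n => ∫ y in {y | (π n).conj φ y = y}, b.toFun n y ∂ν) ω
      (𝓝 ((orbitVNA Γ μ).ultraTr ω ((orbitVNA Γ μ).ultraMk ω (a.seq Γ μ) *
        ultraConst ω (canonicalUnitary Γ μ φ)))) := by
    refine (tendsto_tr ω (a.seq Γ μ *
      BoundedContinuousFunction.const ℕ (canonicalUnitary Γ μ φ))).congr fun n => ?_
    refine (tr_fn_mul_canonicalUnitary (a.bddMeasurable n) φ).trans ?_
    rw [← integral_indicator (measurableSet_fixed φ), ← integral_indicator (hfix n)]
    conv_lhs => rw [← (π n).mp_fwd.map_eq]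
    rw [integral_map (π n).mp_fwd.measurable.aemeasurable
        ((a.measurable n).indicator (measurableSet_fixed φ)).aestronglyMeasurable]
    refine integral_congr_ae ?_
    filter_upwards [(π n).ae_fwd_conj φ, (π n).inv_fwd] with y hy hy'
    by_cases hf : (π n).conj φ y = y
    · have hf' : φ⁻¹ • (π n).fwd y = (π n).fwd y := by rw [← hy, hf]
      rw [Set.indicator_of_mem (s := {x | φ⁻¹ • x = x}) hf',
        Set.indicator_of_mem (s := {y | (π n).conj φ y = y}) hf]
      rfl
    · have hf' : ¬ φ⁻¹ • (π n).fwd y = (π n).fwd y := fun h => hf (by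
        rw [PointIso.conj, h, hy'])
      rw [Set.indicator_of_notMem (s := {x | φ⁻¹ • x = x}) hf',
        Set.indicator_of_notMem (s := {y | (π n).conj φ y = y}) hf]
  have h2 : Tendsto (fun n => ∫ y in {y | (π n).conj φ y = y} ∩ (π n).domain Λ φ n,
      b.toFun n y ∂ν) ω (𝓝 ((orbitVNA Λ ν).ultraTr ω ((orbitVNA Λ ν).ultraMk ω
        (b.seq Λ ν) * ultraPiecewise Λ ω π φ))) :=
    (tendsto_tr ω (b.seq Λ ν * BoundedContinuousFunction.ofNormedAddCommGroupDiscrete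
      (fun n => (π n).piecewise Λ φ n) 1 fun n => (π n).norm_piecewise_le φ n)).congr fun n =>
        (π n).tr_fn_mul_piecewise φ n (b.bddMeasurable n)
  refine tendsto_nhds_unique h1 (tendsto_of_tendsto_of_dist h2 ?_)
  refine squeeze_zero (fun n => dist_nonneg) (g := fun n => b.bound *
    ν.real ((π n).domain Λ φ n)ᶜ) (fun n => ?_) (by simpa using (hd φ).const_mul b.bound)
  have hm := (π n).measurableSet_domain Λ φ n
  have h3 := integral_inter_add_sdiff (μ := ν) (s := {y | (π n).conj φ y = y}) hm
    ((b.bddMeasurable n).integrable ν).integrableOn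
  rw [dist_comm, dist_eq_norm, ← h3, add_sub_cancel_left]
  refine (norm_setIntegral_le_of_norm_le_const (measure_lt_top ν _)
    fun y _ => b.norm_le n y).trans ?_
  have hne := nonempty_of_isProbabilityMeasure ν
  exact mul_le_mul_of_nonneg_left (measureReal_mono (fun y hy => hy.2)) b.bound_nonneg

end UltraPiecewise

/-! ### Construction of the isomorphism of ultrapowers -/

section UltraIso

open TracialVNA

variable {Γ : Type*} [Group Γ] [Countable Γ] {X : Type*} [MeasurableSpace X] [MulAction Γ X]
  {μ : Measure X} [MeasurableConstSMul Γ X] [SMulInvariantMeasure Γ X μ] [StandardBorelSpace X]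
  [IsProbabilityMeasure μ]
  {Λ : Type*} [Group Λ] [Countable Λ] {Y : Type*} [MeasurableSpace Y] [MulAction Λ Y]
  {ν : Measure Y} [MeasurableConstSMul Λ Y] [SMulInvariantMeasure Λ Y ν] [StandardBorelSpace Y]
  [IsProbabilityMeasure ν] {ω : Ultrafilter ℕ}

theorem mem_ultraCartan_of_forall_lt {x : (orbitVNA Λ ν).Ultra ω}
    (h : ∀ ε > 0, ∃ z ∈ (orbitVNA Λ ν).ultraCartan (cartan Λ ν) ω,
      (orbitVNA Λ ν).ultraNorm2 ω (x - z) < ε) :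
    x ∈ (orbitVNA Λ ν).ultraCartan (cartan Λ ν) ω := by
  refine (mem_ultraCartan_iff ω).2 fun ε hε => ?_
  obtain ⟨z, hz, h1⟩ := h (ε / 2) (half_pos hε)
  obtain ⟨y, hy, h2⟩ := (mem_ultraCartan_iff ω).1 hz (ε / 2) (half_pos hε)
  exact ⟨y, hy, (ultraNorm2_sub_le x z y).trans_lt (by linarith)⟩

variable {π : ℕ → PointIso μ ν}

/-- At index n the representative uses n cells, so it is not itself a fixed finite sum. By tightness
a number N of cells independent of n already approximates it along ω, and that truncation lies in
the span of the B^ω u_ψ. -/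
theorem Tight.ultraPiecewise_mem (hω : (ω : Filter ℕ) ≤ cofinite) (h : Tight Γ Λ ω π) (φ : Γ) :
    ultraPiecewise Λ ω π φ ∈ (orbitVNA Λ ν).ultraCartan (cartan Λ ν) ω := by
  refine mem_ultraCartan_of_forall_lt fun ε hε => ?_
  -- The ‖·‖₂-norm of a projection is the square root of its trace, so the measure is controlled to
  -- order (ε/2)².
  obtain ⟨N, hN⟩ := h.exists_initialSegment φ (ε := (ε / 2) ^ 2) (by positivity)
  have hge : ∀ᶠ n in (ω : Filter ℕ), N ≤ n :=
    (Nat.cofinite_eq_atTop ▸ hω) (eventually_ge_atTop N)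
  let y : ℕ →ᵇ (orbitVNA Λ ν).Carrier := ∑ ψ ∈ initialSegment Λ N,
    (FnSeq.indicator fun n => (π n).measurableSet_cell φ ψ).seq Λ ν *
      BoundedContinuousFunction.const ℕ (canonicalUnitary Λ ν ψ)
  have hy : ∀ n, y n = ∑ ψ ∈ initialSegment Λ N,
      setProj Λ ν ((π n).measurableSet_cell φ ψ) * canonicalUnitary Λ ν ψ := fun n => by
    simp only [y, BoundedContinuousFunction.sum_apply]
    rfl
  refine ⟨(orbitVNA Λ ν).ultraMk ω y, ?_, ?_⟩
  · have e : (orbitVNA Λ ν).ultraMk ω y = ∑ ψ ∈ initialSegment Λ N,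
        (orbitVNA Λ ν).ultraMk ω
          ((FnSeq.indicator fun n => (π n).measurableSet_cell φ ψ).seq Λ ν) *
          ultraConst ω (canonicalUnitary Λ ν ψ) :=
      map_sum ((orbitVNA Λ ν).ultraMkHom ω) _ _
    rw [e]
    exact sum_mem fun ψ _ => mul_mem (ultraSub_le_ultraCartan (FnSeq.mk_seq_mem ω _))
      (ultraConst_canonicalUnitary_mem ψ)
  · have hE : ∀ n, MeasurableSet (⋃ ψ ∈ initialSegment Λ N, (π n).cell φ ψ) := fun n =>
      Finset.measurableSet_biUnion _ fun ψ _ => (π n).measurableSet_cell φ ψ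
    let x : ℕ →ᵇ (orbitVNA Λ ν).Carrier :=
      BoundedContinuousFunction.ofNormedAddCommGroupDiscrete
        (fun n => (π n).piecewise Λ φ n) 1 fun n => (π n).norm_piecewise_le φ n
    have hx : ultraPiecewise Λ ω π φ = (orbitVNA Λ ν).ultraMk ω x := rfl
    rw [hx]
    have hx1 : ∀ n, ‖x n‖ ≤ 1 := fun n => (π n).norm_piecewise_le φ n
    refine (ultraNorm2_sub_le_of_setProj (x := x) (y := y) hE (δ := (ε / 2) ^ 2)
      hx1 ?_).trans_lt ?_
    · filter_upwards [hN N le_rfl, hge] with n hn hNn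
      constructor
      · rw [← sum_setProj _ (fun ψ => (π n).measurableSet_cell φ ψ)
          (fun i j hij => ((π n).pairwise_disjoint_cell φ hij).aedisjoint), Finset.sum_mul, hy]
        refine Finset.sum_congr rfl fun ψ hψ => ?_
        exact (π n).setProj_mul_piecewise φ n _ ((π n).cell_subset φ ψ)
          (Set.subset_biUnion_of_mem (u := fun ψ => (π n).cell φ ψ)
            (mem_initialSegment.2 ((mem_initialSegment.1 hψ).trans_le hNn)))
      · rw [PointIso.sum_measureReal_cell] at hn
        rw [probReal_compl_eq_one_sub (hE n)]
        linarith
    · rw [Real.sqrt_sq (by positivity)]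
      linarith

theorem PointIso.ae_mem_matchSet_of_symm (π : PointIso μ ν) (φ : Γ) (ψ : Λ) :
    ∀ᵐ y ∂ν, π.fwd y ∈ π.symm.matchSet ψ φ → y ∈ π.matchSet φ ψ := by
  have h := (measurePreserving_smul ψ⁻¹ ν).quasiMeasurePreserving.ae π.inv_fwd
  filter_upwards [π.inv_fwd, h] with y h1 h2 hy
  have h3 : π.fwd (ψ⁻¹ • π.inv (π.fwd y)) = φ⁻¹ • π.fwd y := hy
  rw [h1] at h3
  change π.inv (φ⁻¹ • π.fwd y) = ψ⁻¹ • y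
  rw [← h3, h2]

/-- The unitaries of `Λ` are approximated by sums of piecewise unitaries. -/
theorem exists_sum_ultraPiecewise
    (hd : ∀ φ : Γ, Tendsto (fun n => ν.real ((π n).domain Λ φ n)ᶜ) ω (𝓝 0))
    (h : Tight Λ Γ ω fun n => (π n).symm) (ψ : Λ) {ε : ℝ} (hε : 0 < ε) :
    ∃ (F : Finset Γ) (b : Γ → FnSeq Y), (orbitVNA Λ ν).ultraNorm2 ω
      (ultraConst ω (canonicalUnitary Λ ν ψ) -
        ∑ φ ∈ F, (orbitVNA Λ ν).ultraMk ω ((b φ).seq Λ ν) * ultraPiecewise Λ ω π φ) < ε := by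
  -- Half of (ε/2)² is spent on points missed by the cells of the inverse maps, half on points
  -- missed by the domains of the finitely many φ.
  obtain ⟨N, hN⟩ := h.exists_initialSegment ψ (ε := (ε / 2) ^ 2 / 2) (by positivity)
  set F := initialSegment Γ N with hF
  -- The first set makes the pieces disjoint in φ; on the other two the piecewise isometry of φ
  -- equals u_ψ.
  have hD : ∀ n (φ : Γ), MeasurableSet ((π n).fwd ⁻¹' (π n).symm.cell ψ φ ∩
      ((π n).matchSet φ ψ ∩ (π n).domain Λ φ n)) := fun n φ =>
    ((π n).mp_fwd.measurable ((π n).symm.measurableSet_cell ψ φ)).inter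
      (((π n).measurableSet_matchSet φ ψ).inter ((π n).measurableSet_domain Λ φ n))
  let y : ℕ →ᵇ (orbitVNA Λ ν).Carrier := ∑ φ ∈ F, (FnSeq.indicator fun n => hD n φ).seq Λ ν *
    BoundedContinuousFunction.ofNormedAddCommGroupDiscrete
      (fun n => (π n).piecewise Λ φ n) 1 fun n => (π n).norm_piecewise_le φ n
  have hy : ∀ n, y n = ∑ φ ∈ F, setProj Λ ν (hD n φ) * (π n).piecewise Λ φ n := fun n => by
    simp only [y, BoundedContinuousFunction.sum_apply]
    rfl
  have e : (orbitVNA Λ ν).ultraMk ω y = ∑ φ ∈ F, (orbitVNA Λ ν).ultraMk ω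
      ((FnSeq.indicator fun n => hD n φ).seq Λ ν) * ultraPiecewise Λ ω π φ :=
    map_sum ((orbitVNA Λ ν).ultraMkHom ω) _ _
  refine ⟨F, fun φ => FnSeq.indicator fun n => hD n φ, ?_⟩
  rw [← e]
  have hE : ∀ n, MeasurableSet (⋃ φ ∈ F, (π n).fwd ⁻¹' (π n).symm.cell ψ φ ∩
      ((π n).matchSet φ ψ ∩ (π n).domain Λ φ n)) := fun n =>
    Finset.measurableSet_biUnion _ fun φ _ => hD n φ
  have hu : ‖canonicalUnitary Λ ν ψ‖ ≤ 1 :=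
    ContinuousLinearMap.opNorm_le_bound _ zero_le_one fun ξ => by
      rw [one_mul]; exact (norm_leftShift Λ ν ψ ξ).le
  have hsum : Tendsto (fun n => ∑ φ ∈ F, ν.real ((π n).domain Λ φ n)ᶜ) ω (𝓝 0) := by
    have h1 := tendsto_finsetSum F fun φ _ => hd φ
    rwa [Finset.sum_const_zero] at h1
  refine (ultraNorm2_sub_le_of_setProj (x := BoundedContinuousFunction.const ℕ
    (canonicalUnitary Λ ν ψ)) hE (δ := (ε / 2) ^ 2) (fun n => hu) ?_).trans_lt ?_
  · filter_upwards [hN N le_rfl, (tendsto_order.1 hsum).2 ((ε / 2) ^ 2 / 2) (by positivity)]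
      with n hn hn'
    constructor
    · rw [← sum_setProj _ (hD n) (fun i j hij => (((((π n).symm.pairwise_disjoint_cell ψ
        hij).preimage (π n).fwd).mono Set.inter_subset_left Set.inter_subset_left)).aedisjoint),
        Finset.sum_mul, hy]
      refine Finset.sum_congr rfl fun φ _ => ?_
      exact ((π n).setProj_mul_piecewise φ n (hD n φ) (fun y hy => hy.2.1)
        (fun y hy => hy.2.2)).symm
    · rw [PointIso.sum_measureReal_cell] at hn
      have hUm : MeasurableSet (⋃ φ ∈ F, (π n).symm.cell ψ φ) :=
        Finset.measurableSet_biUnion _ fun φ _ => (π n).symm.measurableSet_cell ψ φ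
      have h1 : ν (⋃ φ ∈ F, (π n).fwd ⁻¹' (π n).symm.cell ψ φ ∩
          ((π n).matchSet φ ψ ∩ (π n).domain Λ φ n))ᶜ ≤
          ν ((π n).fwd ⁻¹' (⋃ φ ∈ F, (π n).symm.cell ψ φ)ᶜ ∪
            ⋃ φ ∈ F, ((π n).domain Λ φ n)ᶜ) := by
        refine measure_mono_ae ?_
        filter_upwards [ae_all_iff.2 fun φ : Γ => (π n).ae_mem_matchSet_of_symm φ ψ]
          with y hy hyE
        by_contra hc
        have h2 : (π n).fwd y ∈ ⋃ φ ∈ F, (π n).symm.cell ψ φ :=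
          by_contra fun k => hc (Or.inl k)
        obtain ⟨φ, hφ, h3⟩ := Set.mem_iUnion₂.1 h2
        refine hyE (Set.mem_iUnion₂.2 ⟨φ, hφ, h3, hy φ ((π n).symm.cell_subset ψ φ h3), ?_⟩)
        exact by_contra fun k => hc (Or.inr (Set.mem_iUnion₂.2 ⟨φ, hφ, k⟩))
      have h2 := ENNReal.toReal_mono (measure_ne_top ν _) h1
      have h3 := measureReal_union_le (μ := ν) ((π n).fwd ⁻¹' (⋃ φ ∈ F, (π n).symm.cell ψ φ)ᶜ)
        (⋃ φ ∈ F, ((π n).domain Λ φ n)ᶜ)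
      have h4 := measureReal_biUnion_finset_le (μ := ν) F fun φ => ((π n).domain Λ φ n)ᶜ
      rw [(π n).mp_fwd.measureReal_preimage hUm.compl.nullMeasurableSet,
        probReal_compl_eq_one_sub hUm] at h3
      refine h2.trans (h3.trans ?_)
      linarith
  · rw [Real.sqrt_sq (by positivity)]
    linarith

variable (Γ Λ ω π) in
/-- The pairs `(a u_φ, θ(a) v_φ)`. -/
def graphGenerators : Set ((orbitVNA Γ μ).Ultra ω × (orbitVNA Λ ν).Ultra ω) :=
  {p | ∃ (a : FnSeq X) (φ : Γ),
    p = ((orbitVNA Γ μ).ultraMk ω (a.seq Γ μ) * ultraConst ω (canonicalUnitary Γ μ φ),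
      (orbitVNA Λ ν).ultraMk ω ((a.comp fun n => (π n).mp_fwd.measurable).seq Λ ν) *
        ultraPiecewise Λ ω π φ)}

theorem seq_comp_fwd_conj (φ : Γ) (a : FnSeq X) :
    ((a.comp fun n => (π n).mp_fwd.measurable).comp fun n => (π n).measurable_conj φ).seq Λ ν =
      ((a.comp fun _ => measurable_const_smul (α := X) φ⁻¹).comp
        fun n => (π n).mp_fwd.measurable).seq Λ ν :=
  FnSeq.seq_congr fun n => by
    filter_upwards [(π n).ae_fwd_conj φ] with y hy
    exact congrArg (a.toFun n) hy

variable (hd : ∀ φ : Γ, Tendsto (fun n => ν.real ((π n).domain Λ φ n)ᶜ) ω (𝓝 0))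
include hd

theorem one_mem_graphGenerators : 1 ∈ graphGenerators Γ Λ ω π := by
  refine ⟨FnSeq.indicator fun _ => MeasurableSet.univ, 1, ?_⟩
  have e : ((FnSeq.indicator fun _ => MeasurableSet.univ : FnSeq X).comp
      fun n => (π n).mp_fwd.measurable).seq Λ ν = 1 := FnSeq.seq_one
  rw [e, FnSeq.seq_one, ultraMk_one, ultraMk_one, canonicalUnitary_one, map_one,
    ultraPiecewise_one hd, mul_one, mul_one]
  rfl

theorem mul_mem_graphGenerators : ∀ p ∈ graphGenerators Γ Λ ω π,
    ∀ q ∈ graphGenerators Γ Λ ω π, p * q ∈ graphGenerators Γ Λ ω π := by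
  rintro _ ⟨a, φ, rfl⟩ _ ⟨a', φ', rfl⟩
  refine ⟨a.mul (a'.comp fun _ => measurable_const_smul (α := X) φ⁻¹), φ * φ', Prod.ext ?_ ?_⟩
  · change _ * _ * (_ * _) = _ * _
    rw [FnSeq.seq_mul, ultraMk_mul, ← canonicalUnitary_mul, map_mul, mul_assoc,
      ← mul_assoc (ultraConst ω (canonicalUnitary Γ μ φ)), FnSeq.const_mul_mk_seq]
    simp only [mul_assoc]
  · change _ * _ * (_ * _) = _ * _
    have e : ((a.mul (a'.comp fun _ => measurable_const_smul (α := X) φ⁻¹)).comp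
        fun n => (π n).mp_fwd.measurable).seq Λ ν =
        (a.comp fun n => (π n).mp_fwd.measurable).seq Λ ν *
          ((a'.comp fun n => (π n).mp_fwd.measurable).comp
            fun n => (π n).measurable_conj φ).seq Λ ν := by
      rw [seq_comp_fwd_conj, ← FnSeq.seq_mul]
      rfl
    rw [e, ultraMk_mul, ← ultraPiecewise_mul hd, mul_assoc,
      ← mul_assoc (ultraPiecewise Λ ω π φ), ultraPiecewise_mul_seq]
    simp only [mul_assoc]

theorem star_mem_graphGenerators : ∀ p ∈ graphGenerators Γ Λ ω π,
    star p ∈ graphGenerators Γ Λ ω π := by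
  rintro _ ⟨a, φ, rfl⟩
  refine ⟨a.conj.comp fun _ => measurable_const_smul (α := X) φ⁻¹⁻¹, φ⁻¹, Prod.ext ?_ ?_⟩
  · change star (_ * _) = _ * _
    rw [star_mul, ← map_star, star_canonicalUnitary, star_ultraMk, ← FnSeq.seq_conj,
      FnSeq.const_mul_mk_seq]
  · change star (_ * _) = _ * _
    have e : (a.conj.comp fun n => (π n).mp_fwd.measurable).seq Λ ν =
        star ((a.comp fun n => (π n).mp_fwd.measurable).seq Λ ν) := by
      rw [← FnSeq.seq_conj]
      rfl
    rw [star_mul, star_ultraPiecewise hd, star_ultraMk, ← e, ultraPiecewise_mul_seq,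
      seq_comp_fwd_conj]

/-- The pairs (a u_φ, θ(a) v_φ) span the graph of a trace preserving *-isomorphism, which is
extended to the closures. Tightness forwards puts the second components in N(ω); tightness of the
inverses makes them dense there. -/
theorem exists_ultraproductIso (hω : (ω : Filter ℕ) ≤ cofinite) (h : Tight Γ Λ ω π)
    (h' : Tight Λ Γ ω fun n => (π n).symm)
    {θ : ℕ → TraceIso (cartanTr Γ μ) (cartanTr Λ ν)} (hπ : ∀ n, Realizes (π n) (θ n)) :
    UltraproductIso (orbitVNA Γ μ) (cartan Γ μ) (orbitVNA Λ ν) (cartan Λ ν) ω := by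
  let G := spanStarSubalgebra (graphGenerators Γ Λ ω π) (one_mem_graphGenerators hd)
    (mul_mem_graphGenerators hd) (star_mem_graphGenerators hd)
  have hgen : ∀ (a : FnSeq X) (φ : Γ),
      ((orbitVNA Γ μ).ultraMk ω (a.seq Γ μ) * ultraConst ω (canonicalUnitary Γ μ φ),
        (orbitVNA Λ ν).ultraMk ω ((a.comp fun n => (π n).mp_fwd.measurable).seq Λ ν) *
          ultraPiecewise Λ ω π φ) ∈ G := fun a φ => Submodule.subset_span ⟨a, φ, rfl⟩
  have hgen1 : ∀ a : FnSeq X, ((orbitVNA Γ μ).ultraMk ω (a.seq Γ μ),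
      (orbitVNA Λ ν).ultraMk ω ((a.comp fun n => (π n).mp_fwd.measurable).seq Λ ν)) ∈ G := by
    intro a
    have h1 := hgen a 1
    rwa [canonicalUnitary_one, map_one, mul_one, ultraPiecewise_one hd, mul_one] at h1
  have hinv : ∀ b : FnSeq Y, ((b.comp fun n => (π n).mp_inv.measurable).comp
      fun n => (π n).mp_fwd.measurable).seq Λ ν = b.seq Λ ν := fun b =>
    FnSeq.seq_congr fun n => (π n).inv_fwd.mono fun y hy => congrArg (b.toFun n) hy
  have htr : ∀ p ∈ G, (orbitVNA Γ μ).ultraTr ω p.1 = (orbitVNA Λ ν).ultraTr ω p.2 := by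
    intro p hp
    change p ∈ Submodule.span ℂ _ at hp
    induction hp using Submodule.span_induction with
    | mem p hp =>
      obtain ⟨a, φ, rfl⟩ := hp
      exact ultraTr_seq_mul_ultraPiecewise hd φ a
    | zero =>
      have h1 := ultraTr_smul (0 : ℂ) (0 : (orbitVNA Γ μ).Ultra ω)
      have h2 := ultraTr_smul (0 : ℂ) (0 : (orbitVNA Λ ν).Ultra ω)
      rw [zero_smul, zero_mul] at h1 h2
      exact h1.trans h2.symm
    | add p q _ _ h1 h2 =>
      rw [Prod.fst_add, Prod.snd_add, ultraTr_add, ultraTr_add, h1, h2]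
    | smul c p _ h1 =>
      rw [Prod.smul_fst, Prod.smul_snd, ultraTr_smul, ultraTr_smul, h1]
  have hfst : ∀ p ∈ G, p.1 ∈ ultraOrbitSpan Γ μ ω := by
    intro p hp
    change p ∈ Submodule.span ℂ _ at hp
    induction hp using Submodule.span_induction with
    | mem p hp =>
      obtain ⟨a, φ, rfl⟩ := hp
      exact mul_mem_ultraOrbitSpan ω (a.mk_seq_mem ω) φ
    | zero => exact zero_mem _
    | add p q _ _ h1 h2 => exact add_mem h1 h2
    | smul c p _ h1 => exact (ultraOrbitSpan Γ μ ω).smul_mem h1 c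
  have hfst' : ∀ x ∈ ultraOrbitSpan Γ μ ω, ∃ p ∈ G, p.1 = x := by
    intro x hx
    change x ∈ Submodule.span ℂ _ at hx
    induction hx using Submodule.span_induction with
    | mem x hx =>
      obtain ⟨a, φ, ha, rfl⟩ := hx
      obtain ⟨f, rfl⟩ := FnSeq.exists_eq_seq ω ha
      exact ⟨_, hgen f φ, rfl⟩
    | zero => exact ⟨0, zero_mem _, rfl⟩
    | add x z _ _ h1 h2 =>
      obtain ⟨p, hp, rfl⟩ := h1
      obtain ⟨q, hq, rfl⟩ := h2
      exact ⟨p + q, add_mem hp hq, rfl⟩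
    | smul c x _ h1 =>
      obtain ⟨p, hp, rfl⟩ := h1
      exact ⟨c • p, G.smul_mem hp c, rfl⟩
  have hsnd : ∀ p ∈ G, p.2 ∈ (orbitVNA Λ ν).ultraCartan (cartan Λ ν) ω := by
    intro p hp
    change p ∈ Submodule.span ℂ _ at hp
    induction hp using Submodule.span_induction with
    | mem p hp =>
      obtain ⟨a, φ, rfl⟩ := hp
      exact mul_mem (ultraSub_le_ultraCartan (FnSeq.mk_seq_mem ω _)) (h.ultraPiecewise_mem hω φ)
    | zero => exact zero_mem _
    | add p q _ _ h1 h2 => exact add_mem h1 h2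
    | smul c p _ h1 => exact ((orbitVNA Λ ν).ultraCartan (cartan Λ ν) ω).smul_mem h1 c
  -- S is the closure of the second components of G. It contains B^ω and the v_φ, and it must be
  -- shown to contain every u_ψ.
  let S := ultraClosure (G.map (StarAlgHom.snd ℂ ((orbitVNA Γ μ).Ultra ω)
    ((orbitVNA Λ ν).Ultra ω)))
  have hmemS : ∀ p ∈ G, p.2 ∈ S := fun p hp => mem_ultraClosure.2 fun ε hε =>
    ⟨p.2, ⟨p, hp, rfl⟩, by rwa [sub_self, ultraNorm2_zero]⟩
  have hseqS : ∀ b : FnSeq Y, (orbitVNA Λ ν).ultraMk ω (b.seq Λ ν) ∈ S := fun b => by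
    have h1 := hmemS _ (hgen1 (b.comp fun n => (π n).mp_inv.measurable))
    rwa [hinv] at h1
  have hpwS : ∀ φ, ultraPiecewise Λ ω π φ ∈ S := fun φ => by
    have h1 := hmemS _ (hgen (FnSeq.indicator fun _ => MeasurableSet.univ) φ)
    have e : ((FnSeq.indicator fun _ => MeasurableSet.univ : FnSeq X).comp
      fun n => (π n).mp_fwd.measurable).seq Λ ν = 1 := FnSeq.seq_one
    rwa [e, ultraMk_one, one_mul] at h1
  have hclosed : ∀ x, (∀ ε > 0, ∃ z ∈ S, (orbitVNA Λ ν).ultraNorm2 ω (x - z) < ε) → x ∈ S := by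
    refine fun x hx => mem_ultraClosure.2 fun ε hε => ?_
    obtain ⟨z, hz, h1⟩ := hx (ε / 2) (half_pos hε)
    obtain ⟨y, hy, h2⟩ := mem_ultraClosure.1 hz (ε / 2) (half_pos hε)
    exact ⟨y, hy, (ultraNorm2_sub_le x z y).trans_lt (by linarith)⟩
  -- The only use of the tightness of the inverse maps: each u_ψ is a limit of sums of elements b
  -- v_φ.
  have huS : ∀ ψ, ultraConst ω (canonicalUnitary Λ ν ψ) ∈ S := fun ψ => hclosed _ fun ε hε => by
    obtain ⟨F, b, hF⟩ := exists_sum_ultraPiecewise hd h' ψ hε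
    exact ⟨_, sum_mem fun φ _ => mul_mem (hseqS (b φ)) (hpwS φ), hF⟩
  have hspanS : ∀ x ∈ ultraOrbitSpan Λ ν ω, x ∈ S := by
    intro x hx
    change x ∈ Submodule.span ℂ _ at hx
    induction hx using Submodule.span_induction with
    | mem x hx =>
      obtain ⟨a, ψ, ha, rfl⟩ := hx
      obtain ⟨f, rfl⟩ := FnSeq.exists_eq_seq ω ha
      exact mul_mem (hseqS f) (huS ψ)
    | zero => exact zero_mem _
    | add x z _ _ h1 h2 => exact add_mem h1 h2
    | smul c x _ h1 => exact S.smul_mem h1 c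
  obtain ⟨Θ, hΘ⟩ := exists_traceIso_of_graph hω htr
    ((orbitVNA Γ μ).ultraCartan (cartan Γ μ) ω) ((orbitVNA Λ ν).ultraCartan (cartan Λ ν) ω)
    (fun x => (mem_ultraCartan_iff ω).trans
      ⟨fun hx ε hε => by
        obtain ⟨y, hy, h1⟩ := hx ε hε
        obtain ⟨p, hp, rfl⟩ := hfst' y hy
        exact ⟨p, hp, h1⟩,
      fun hx ε hε => by
        obtain ⟨p, hp, h1⟩ := hx ε hε
        exact ⟨p.1, hfst p hp, h1⟩⟩)
    (fun x => ⟨fun hx ε hε => by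
        have h1 : x ∈ S := hclosed x fun δ hδ => by
          obtain ⟨y, hy, h2⟩ := (mem_ultraCartan_iff ω).1 hx δ hδ
          exact ⟨y, hspanS y hy, h2⟩
        obtain ⟨_, ⟨p, hp, rfl⟩, h2⟩ := mem_ultraClosure.1 h1 ε hε
        exact ⟨p, hp, h2⟩,
      fun hx => mem_ultraCartan_of_forall_lt fun ε hε => by
        obtain ⟨p, hp, h1⟩ := hx ε hε
        exact ⟨p.2, hsnd p hp, h1⟩⟩)
  refine ⟨Θ, fun x => ⟨fun hx => ?_, fun hx => ?_⟩, θ, fun a b ha hb x hx => ?_⟩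
  · obtain ⟨f, hf⟩ := FnSeq.exists_eq_seq ω hx
    rw [hΘ x _ (hf ▸ hgen1 f)]
    exact FnSeq.mk_seq_mem ω _
  -- The sequence g pulled back to X is an element of A^ω with the same image as x, so injectivity
  -- identifies it with x.
  · obtain ⟨g, hg⟩ := FnSeq.exists_eq_seq ω hx
    let f := g.comp fun n => (π n).mp_inv.measurable
    let x' : (orbitVNA Γ μ).ultraCartan (cartan Γ μ) ω :=
      ⟨_, ultraSub_le_ultraCartan (f.mk_seq_mem ω)⟩
    have h1 : (Θ x' : (orbitVNA Λ ν).Ultra ω) = (orbitVNA Λ ν).ultraMk ω (g.seq Λ ν) := by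
      rw [hΘ x' _ (hgen1 f), hinv]
    have h2 : x = x' := Θ.toStarAlgEquiv.injective (Subtype.ext (hg.trans h1.symm))
    rw [h2]
    exact f.mk_seq_mem ω
  · obtain ⟨f, rfl⟩ := FnSeq.exists_eq_seq_of_mem ha
    rw [hΘ x _ (hx ▸ hgen1 f)]
    congr 1
    refine BoundedContinuousFunction.ext fun n => ?_
    rw [hb n]
    exact (congrArg Subtype.val (hπ n _ (f.bddMeasurable n))).symm

end UltraIso

/-! ### Ultraproduct isomorphisms and two-sided tightness -/

section Criteria

variable {Γ : Type*} [Group Γ] [Countable Γ] {X : Type*} [MeasurableSpace X] [MulAction Γ X]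
  {μ : Measure X} [MeasurableConstSMul Γ X] [SMulInvariantMeasure Γ X μ] [StandardBorelSpace X]
  [IsProbabilityMeasure μ]
  {Λ : Type*} [Group Λ] [Countable Λ] {Y : Type*} [MeasurableSpace Y] [MulAction Λ Y]
  {ν : Measure Y} [MeasurableConstSMul Λ Y] [SMulInvariantMeasure Λ Y ν] [StandardBorelSpace Y]
  [IsProbabilityMeasure ν] {ω : Ultrafilter ℕ}

theorem Tight.mono {l l' : Filter ℕ} (hl : l' ≤ l) {π : ℕ → PointIso μ ν} (h : Tight Γ Λ l π) :
    Tight Γ Λ l' π := fun φ ε hε =>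
  let ⟨F, hF⟩ := h φ ε hε
  ⟨F, hF.filter_mono hl⟩

/-- An isomorphism of ultraproduct form comes from a sequence of point isomorphisms which is
tight in both directions. -/
theorem exists_tight_of_ultraproductIso
    (h : UltraproductIso (orbitVNA Γ μ) (cartan Γ μ) (orbitVNA Λ ν) (cartan Λ ν) ω) :
    ∃ (θ : ℕ → TraceIso (cartanTr Γ μ) (cartanTr Λ ν)) (π : ℕ → PointIso μ ν),
      (∀ n, Realizes (π n) (θ n)) ∧ Tight Γ Λ ω π ∧ Tight Λ Γ ω fun n => (π n).symm := by
  obtain ⟨Θ, -, θ, hΘ⟩ := h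
  choose π hπ using fun n => exists_realization (θ n)
  refine ⟨θ, π, hπ, tight_of_ultraproductIso Θ hΘ hπ,
    tight_of_ultraproductIso Θ.symm (θ := fun n => (θ n).symm) (fun b a hb hab y hy => ?_)
      fun n => (hπ n).symm⟩
  -- The inverse of Θ must be shown to be given on B^ω by the inverses of the θ n, so that the
  -- tightness argument applies to it as well.
  have ha : ∀ n, a n ∈ cartan Γ μ := fun n => hab n ▸ ((θ n).symm ⟨b n, hb n⟩).2
  let x : (orbitVNA Γ μ).ultraCartan (cartan Γ μ) ω :=
    ⟨(orbitVNA Γ μ).ultraMk ω a, ultraSub_le_ultraCartan ⟨a, ha, rfl⟩⟩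
  have h1 : (Θ x : (orbitVNA Λ ν).Ultra ω) = (orbitVNA Λ ν).ultraMk ω b := by
    refine hΘ a b ha (fun n => ?_) x rfl
    have h2 : (⟨a n, ha n⟩ : cartan Γ μ) = (θ n).symm ⟨b n, hb n⟩ := Subtype.ext (hab n)
    rw [h2]
    exact congrArg Subtype.val ((θ n).toStarAlgEquiv.apply_symm_apply ⟨b n, hb n⟩).symm
  have h2 : Θ x = y := Subtype.ext (h1.trans hy.symm)
  have h3 : Θ.symm y = x := by
    rw [← h2]
    exact Θ.toStarAlgEquiv.symm_apply_apply x
  rw [h3]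

/-- Every free ultrafilter is finer than `atTop`, so tightness of one sequence of isomorphisms
serves all free ultrafilters at once. -/
theorem ultraproductIso_of_tight (hω : (ω : Filter ℕ) ≤ cofinite)
    {θ : ℕ → TraceIso (cartanTr Γ μ) (cartanTr Λ ν)} {π : ℕ → PointIso μ ν}
    (hπ : ∀ n, Realizes (π n) (θ n)) (h : Tight Γ Λ atTop π)
    (h' : Tight Λ Γ atTop fun n => (π n).symm) :
    UltraproductIso (orbitVNA Γ μ) (cartan Γ μ) (orbitVNA Λ ν) (cartan Λ ν) ω := by
  have hl : (ω : Filter ℕ) ≤ atTop := Nat.cofinite_eq_atTop ▸ hω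
  exact exists_ultraproductIso ((h.mono hl).tendsto_domain hω) hω (h.mono hl) (h'.mono hl) hπ

end Criteria

end AppOE

/-! ### The equivalence of the four conditions -/

theorem proposition4p2
    {Γ : Type*} [Group Γ] [Countable Γ] {Λ : Type*} [Group Λ] [Countable Λ]
    {X : Type*} [MeasurableSpace X] [StandardBorelSpace X] (μ : Measure X)
    [IsProbabilityMeasure μ] [MulAction Γ X] [MeasurableConstSMul Γ X]
    [SMulInvariantMeasure Γ X μ]
    {Y : Type*} [MeasurableSpace Y] [StandardBorelSpace Y] (ν : Measure Y)
    [IsProbabilityMeasure ν] [MulAction Λ Y] [MeasurableConstSMul Λ Y]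
    [SMulInvariantMeasure Λ Y ν] :
    List.TFAE [
      -- (a) for some free ultrafilter
      ∃ ω : Ultrafilter ℕ, (ω : Filter ℕ) ≤ cofinite ∧
        AppOE.UltraproductIso (AppOE.orbitVNA Γ μ) (AppOE.cartan Γ μ)
          (AppOE.orbitVNA Λ ν) (AppOE.cartan Λ ν) ω,
      -- (b) for every free ultrafilter
      ∀ ω : Ultrafilter ℕ, (ω : Filter ℕ) ≤ cofinite →
        AppOE.UltraproductIso (AppOE.orbitVNA Γ μ) (AppOE.cartan Γ μ)
          (AppOE.orbitVNA Λ ν) (AppOE.cartan Λ ν) ω,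
      -- (c) the local criterion, with uniform weights `t`, `s`
      ∃ (t : Γ → Λ → ℝ) (s : Λ → Γ → ℝ),
        (∀ φ, HasSum (t φ) 1) ∧ (∀ ψ, HasSum (s ψ) 1) ∧
        (∀ φ ψ, 0 ≤ t φ ψ ∧ t φ ψ ≤ 1) ∧ (∀ ψ φ, 0 ≤ s ψ φ ∧ s ψ φ ≤ 1) ∧
        ∀ (E : Finset Γ) (F : Finset Λ) (ε : ℝ), 0 < ε →
          ∃ (θ : AppOE.TraceIso (AppOE.cartanTr Γ μ) (AppOE.cartanTr Λ ν))
            (p : Λ → Γ → AppOE.cartan Γ μ) (q : Γ → Λ → AppOE.cartan Λ ν),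
            (∀ φ₀ ∈ E, AppOE.DisjointProjections (AppOE.actionAut Λ ν) (q φ₀) ∧
              (∀ ψ, (AppOE.cartanTr Λ ν (q φ₀ ψ)).re ≤ t φ₀ ψ) ∧
              ∃ β : AppOE.PartialIso (AppOE.cartanTr Λ ν),
                β.IsDirectSum (AppOE.actionAut Λ ν) (q φ₀) ∧
                (AppOE.PartialIso.ofAut (θ.conj (AppOE.actionAut Γ μ φ₀))).dist2 β ≤ ε) ∧
            (∀ ψ₀ ∈ F, AppOE.DisjointProjections (AppOE.actionAut Γ μ) (p ψ₀) ∧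
              (∀ φ, (AppOE.cartanTr Γ μ (p ψ₀ φ)).re ≤ s ψ₀ φ) ∧
              ∃ α : AppOE.PartialIso (AppOE.cartanTr Γ μ),
                α.IsDirectSum (AppOE.actionAut Γ μ) (p ψ₀) ∧
                (AppOE.PartialIso.ofAut (θ.symm.conj (AppOE.actionAut Λ ν ψ₀))).dist2 α ≤ ε),
      -- (d) the sequential criterion
      ∃ (θ : ℕ → AppOE.TraceIso (AppOE.cartanTr Γ μ) (AppOE.cartanTr Λ ν))
        (p : Λ → ℕ → Γ → AppOE.cartan Γ μ) (q : Γ → ℕ → Λ → AppOE.cartan Λ ν)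
        (α : Λ → ℕ → AppOE.PartialIso (AppOE.cartanTr Γ μ))
        (β : Γ → ℕ → AppOE.PartialIso (AppOE.cartanTr Λ ν)),
        (∀ ψ n, AppOE.DisjointProjections (AppOE.actionAut Γ μ) (p ψ n) ∧
          (α ψ n).IsDirectSum (AppOE.actionAut Γ μ) (p ψ n)) ∧
        (∀ φ n, AppOE.DisjointProjections (AppOE.actionAut Λ ν) (q φ n) ∧
          (β φ n).IsDirectSum (AppOE.actionAut Λ ν) (q φ n)) ∧
        (∀ φ, Tendsto (fun n => (AppOE.PartialIso.ofAut
          ((θ n).conj (AppOE.actionAut Γ μ φ))).dist2 (β φ n)) atTop (𝓝 0)) ∧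
        (∀ ψ, Tendsto (fun n => (AppOE.PartialIso.ofAut
          ((θ n).symm.conj (AppOE.actionAut Λ ν ψ))).dist2 (α ψ n)) atTop (𝓝 0)) ∧
        (∀ ψ, HasSum (fun φ =>
          liminf (fun n => (AppOE.cartanTr Γ μ (p ψ n φ)).re) atTop) 1) ∧
        (∀ φ, HasSum (fun ψ =>
          liminf (fun n => (AppOE.cartanTr Λ ν (q φ n ψ)).re) atTop) 1)] := by
  tfae_have 2 → 1 := fun h =>
    ⟨Filter.hyperfilter ℕ, Filter.hyperfilter_le_cofinite, h _ Filter.hyperfilter_le_cofinite⟩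
  tfae_have 1 → 3 := by
    rintro ⟨ω, -, h⟩
    obtain ⟨θ, π, hπ, hT, hT'⟩ := AppOE.exists_tight_of_ultraproductIso h
    obtain ⟨t, ht, ht01, htq⟩ := hT.exists_approximable hπ
    obtain ⟨s, hs, hs01, hsp⟩ := hT'.exists_approximable fun n => (hπ n).symm
    refine ⟨t, s, ht, hs, ht01, hs01, fun E F ε hε => ?_⟩
    -- E and F are finite, so ω-almost every index works for all their elements in both directions,
    -- and one such θ n is taken. The weights come from ω and do not depend on E, F, ε.
    have hE := (Filter.eventually_all_finset E).2 fun φ _ => htq φ ε hε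
    have hF := (Filter.eventually_all_finset F).2 fun ψ _ => hsp ψ ε hε
    obtain ⟨n, hn, hn'⟩ := (hE.and hF).exists
    have : Nonempty (Λ → AppOE.cartan Λ ν) := ⟨fun _ => 1⟩
    have : Nonempty (Γ → AppOE.cartan Γ μ) := ⟨fun _ => 1⟩
    choose! q hq using hn
    choose! p hp using hn'
    exact ⟨θ n, p, q, hq, hp⟩
  tfae_have 3 → 4 := by
    rintro ⟨t, s, ht, hs, -, -, h⟩
    -- The n-th isomorphism is accurate to 1/(n+1) on the first n elements of each group, so every
    -- fixed element is eventually controlled.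
    choose θ p q hq hp using fun n : ℕ => h (AppOE.initialSegment Γ n)
      (AppOE.initialSegment Λ n) (1 / (n + 1)) (by positivity)
    obtain ⟨q', β, hβ, hd, hsum⟩ := AppOE.exists_sequence_of_approximable ht
      fun n φ hφ => ⟨q n φ, hq n φ hφ⟩
    obtain ⟨p', α, hα, hd', hsum'⟩ := AppOE.exists_sequence_of_approximable hs
      (θ := fun n => (θ n).symm) fun n ψ hψ => ⟨p n ψ, hp n ψ hψ⟩
    exact ⟨θ, p', q', α, β, hα, hβ, hd, hd', hsum', hsum⟩
  tfae_have 4 → 2 := by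
    rintro ⟨θ, p, q, α, β, hα, hβ, hd, hd', hsum', hsum⟩ ω hω
    choose π hπ using fun n => AppOE.exists_realization (θ n)
    exact AppOE.ultraproductIso_of_tight hω hπ (AppOE.tight_of_sequence hπ hβ hd hsum)
      (AppOE.tight_of_sequence (θ := fun n => (θ n).symm) (fun n => (hπ n).symm) hα hd' hsum')
  tfae_finish
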